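/- Model. An $n$-vertex graph has vertex set $\{0,\dots,n-1\}$. A path-reporting oracle for it is a data structure of $S$ words (stored table plus working memory of the queries) produced by a randomized preprocessing of the graph; it is queried by a program of a unit-cost word RAM with words of $b\lceil\log_2(n+1)\rceil$ bits, $b$ constant. On a query $(u,v)$ the program outputs a path $\Pi$ of $G$ from $u$ to $v$ (possibly with repeated vertices), or the empty sequence if $u,v$ lie in different components. The oracle has stretch $(\alpha,\beta)$ if always $d_G(u,v)\le|\Pi|\le\alpha\, d_G(u,v)+\beta$, where $|\Pi|$ is the number of edges of $\Pi$ ($0$ for the empty output). Query time $O(q)$ means time $O(q+|\Pi|)$ for every query. "Whp" means with probability at least $1-n^{-c}$ over the preprocessing, for any prescribed constant $c$. Theorem. There is a universal constant $A$ such that the following holds. (1) For every constant $\varepsilon>0$ and every constant $c$ there are a query program, constants $b$ and $C$, and a function $\beta$ with $\beta(k)\le k^{A\log\log k}$ for all large $k$ (so $\beta(k)=k^{O(\log\log k)}$), such that for every $k=1,2,\dots$, every $n\ge 1$ and every unweighted undirected $n$-vertex graph $G$ there is a path-reporting oracle for $G$ with stretch $(C,\beta(k))$ such that, with probability at least $1-n^{-c}$,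 it uses space at most $C\,\beta(k)\,n^{1+1/k}$ and every query takes time at most $C\,(n^{\varepsilon}+|\Pi|)$. (2) For every constant $\eta>0$ and every constant $c$ there are a query program, constants $b$ and $C$, a function $\alpha$ with $\alpha(k)=o(k)$, and a function $\beta$ with $\beta(k)\le k^{A\log\log k}$ for all large $k$, such that for every $k=1,2,\dots$, every $n\ge 1$ and every unweighted undirected $n$-vertex graph $G$ there is a path-reporting oracle for $G$ with stretch $(\alpha(k),\beta(k))$ such that, with probability at least $1-n^{-c}$, it uses space at most $C\,\beta(k)\,n^{1+1/k}$ and every query takes time at most $C\left(n^{C k^{-1/(\log_{4/3}7+\eta)}}+|\Pi|\right)$. -/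

import Mathlib

namespace PathOracle

/-- Binary operations of the word RAM on `w`-bit words (arithmetic is modulo `2 ^ w`). -/
inductive BinOp where
  | add | sub | mul | div | mod | and | or | xor | shl | shr | eq | lt

/-- The value of a binary operation. Words are read as unsigned numbers; quotients by `0` are `0`,
remainders by `0` are the dividend, and comparisons return `1` (true) or `0` (false). -/
def BinOp.eval {w : ℕ} : BinOp → BitVec w → BitVec w → BitVec w
  | .add, x, y => x + y
  | .sub, x, y => x - y
  | .mul, x, y => x * y
  | .div, x, y => x / y
  | .mod, x, y => x % y
  | .and, x, y => x &&& y
  | .or, x, y => x ||| y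
  | .xor, x, y => x ^^^ y
  | .shl, x, y => x <<< y.toNat
  | .shr, x, y => x >>> y.toNat
  | .eq, x, y => if x = y then 1 else 0
  | .lt, x, y => if x.toNat < y.toNat then 1 else 0

/-- Instructions of the word RAM that answers queries. `r`, `s`, `t` are names of registers.
* `const r a`: put the constant `a` into `r`;
* `bin o r s t`: put `s o t` into `r`;
* `read r s`: put the word of the stored data structure at the address held by `s` into `r`;
* `load r s`: put the word of the working memory at the address held by `s` into `r`;
* `store r s`: write the content of `s` into the working memory at the address held by `r`;
* `jz r p`: go to instruction number `p` if `r` holds `0`;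
* `emit r`: append the content of `r` to the output.

The machine stops when the instruction counter leaves the program. -/
inductive Instr where
  | const (r a : ℕ)
  | bin (o : BinOp) (r s t : ℕ)
  | read (r s : ℕ)
  | load (r s : ℕ)
  | store (r s : ℕ)
  | jz (r p : ℕ)
  | emit (r : ℕ)

/-- A query algorithm: a finite list of instructions. -/
abbrev Program := List Instr

/-- What the preprocessing of a graph leaves behind, in words of `w` bits: a table `data`, which
queries can only read, and the number `scratch` of cells of working memory reserved for queries.
(Every query finds the working memory filled with zeros: undoing the writes of the previous query
takes no more than a constant factor of its time.) -/
structure Oracle (w : ℕ) where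
  data : List (BitVec w)
  scratch : ℕ

/-- The space of an oracle in words: stored data and working memory together. -/
def Oracle.space {w : ℕ} (O : Oracle w) : ℕ := O.data.length + O.scratch

/-- A configuration of the machine during a query. -/
structure State (w : ℕ) where
  pc : ℕ
  reg : ℕ → BitVec w
  mem : ℕ → BitVec w
  out : List (BitVec w)

/-- The effect of one instruction. Reading at an address outside the data structure or outside the
working memory returns `0`, and writing outside the working memory has no effect. -/
def Instr.exec {w : ℕ} (O : Oracle w) : Instr → State w → State w
  | .const r a, σ =>
      { σ with pc := σ.pc + 1, reg := Function.update σ.reg r (BitVec.ofNat w a) }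
  | .bin o r s t, σ =>
      { σ with pc := σ.pc + 1, reg := Function.update σ.reg r (o.eval (σ.reg s) (σ.reg t)) }
  | .read r s, σ =>
      { σ with pc := σ.pc + 1, reg := Function.update σ.reg r (O.data.getD (σ.reg s).toNat 0) }
  | .load r s, σ =>
      { σ with
        pc := σ.pc + 1
        reg := Function.update σ.reg r
          (if (σ.reg s).toNat < O.scratch then σ.mem (σ.reg s).toNat else 0) }
  | .store r s, σ =>
      { σ with
        pc := σ.pc + 1
        mem := if (σ.reg r).toNat < O.scratch
          then Function.update σ.mem (σ.reg r).toNat (σ.reg s) else σ.mem }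
  | .jz r p, σ => { σ with pc := if σ.reg r = 0 then p else σ.pc + 1 }
  | .emit r, σ => { σ with pc := σ.pc + 1, out := σ.out ++ [σ.reg r] }

/-- One unit of time; a configuration in which the machine has stopped does not change. -/
def step {w : ℕ} (P : Program) (O : Oracle w) (σ : State w) : State w :=
  match P[σ.pc]? with
  | some i => i.exec O σ
  | none => σ

/-- The configuration at the start of the query `(u, v)`: the two vertices are in registers
`0` and `1`, everything else is `0`. -/
def init (w u v : ℕ) : State w where
  pc := 0
  reg := fun i => if i = 0 then BitVec.ofNat w u else if i = 1 then BitVec.ofNat w v else 0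
  mem := fun _ => 0
  out := []

/-- On the query `(u, v)` the machine stops within `T` units of time and its output is `l`. -/
def Reports {w : ℕ} (P : Program) (O : Oracle w) (u v T : ℕ) (l : List ℕ) : Prop :=
  P.length ≤ ((step P O)^[T] (init w u v)).pc ∧
    ((step P O)^[T] (init w u v)).out.map BitVec.toNat = l

/-- Path-reporting with stretch `(α, β)`: on every query `(u, v)` the machine stops. If `u` and `v`
are connected in `G`, it outputs the sequence of vertices of a path of `G` from `u` to `v` whose
length `δ` satisfies `d(u, v) ≤ δ ≤ α * d(u, v) + β`. (Paths may repeat vertices.) Otherwise it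
outputs the empty sequence. -/
def Oracle.HasStretch {w n : ℕ} (O : Oracle w) (P : Program) (G : SimpleGraph (Fin n))
    (α β : ℝ) : Prop :=
  ∀ u v : Fin n, ∃ (T : ℕ) (l : List ℕ), Reports P O u v T l ∧
    (G.Reachable u v → ∃ p : G.Walk u v, l = p.support.map Fin.val ∧
      G.dist u v ≤ p.length ∧ (p.length : ℝ) ≤ α * G.dist u v + β) ∧
    (¬ G.Reachable u v → l = [])

/-- Query time `O(q)` with constant `C` for a graph on `n` vertices: on every query the machine
stops within `C * (q + |Π|)` units of time, where `|Π|` is the number of edges of the reported path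
(which is one less than the number of its vertices, and `0` if nothing is reported). -/
def Oracle.HasQueryTime {w : ℕ} (O : Oracle w) (P : Program) (n : ℕ) (C q : ℝ) : Prop :=
  ∀ u v : Fin n, ∃ (T : ℕ) (l : List ℕ), Reports P O u v T l ∧
    (T : ℝ) ≤ C * (q + ((l.length - 1 : ℕ) : ℝ))

/-- There is a randomized preprocessing of `G` (given by the law `μ` of the oracle it produces, in
words of `w` bits, to be queried by the program `P`), such that the oracle always reports paths of
stretch `(α, β)`, and such that, with probability at least `1 - n ^ (-c)`, its space is at most `S`
words and every query takes time at most `C * (q + |Π|)`. -/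
def HasOracle {n : ℕ} (P : Program) (w : ℕ) (G : SimpleGraph (Fin n))
    (α β C q S c : ℝ) : Prop :=
  ∃ μ : PMF (Oracle w),
    (∀ O ∈ μ.support, O.HasStretch P G α β) ∧
    1 - ENNReal.ofReal ((n : ℝ) ^ (-c)) ≤
      μ.toOuterMeasure {O | O.HasQueryTime P n C q ∧ (O.space : ℝ) ≤ S}

end PathOracle

/-!
The oracle is deterministic, and one query program serves all parameters.

*Spanner.* Every graph `G` on `n < b ^ (2 ^ L - 1)` vertices has a subgraph `H` with
`O(L * Y * n * b)` edges in which distances are at most `3 * d + 3 * Y`, where `Y = r ^ L` and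
`r ≥ 16 * (L + 1)` (`exists_spanner`). It is built from a ladder of `L` nested vertex sets
(`exists_ladder`). At level `i`, a vertex with fewer than `b ^ (2 ^ i)` points of the current set
nearby stores shortest paths to all of them; the other vertices are represented by a packing, which
is the next set and is smaller by the factor `b ^ (2 ^ i)`. As the sets shrink doubly
exponentially, `L ≈ log₂ k` levels suffice for `b ≈ n ^ (1 / (2 * k))`, and `Y` is
`k ^ O(log log k)`. All that follows takes place in `H`.

*Near queries.* A breadth-first search from `v` with volume at most `B ^ 2` either meets `u` or
stops at a radius `Rad v < d(u, v)`. Here `n ≤ B ^ κ`, so that its time is `O(n ^ (2 / κ))`.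

*Far queries.* For each scale `2 ^ j`, a net is chosen to which far queries are routed through
pivots, and the net is clustered in `B * log n` slots: ball growing with growth factor `B` gives
disjoint clusters of radius `O(κ * 2 ^ j)`, and each net point has a home slot in which its whole
neighbourhood lies in one cluster (`exists_clusterings`). At the first scale at which `v` has the
label of the home cluster of `u`, both vertices walk to the center of this cluster along the stored
trees, so that the length of the path is `O(κ * d(u, v))`. Two kinds of nets pay for the space.
For `2 ^ j < Y * B`, searches stopped by their volume give a net with `O(|H| / B ^ 2)` points,
so paths of length `2 ^ j` between net points can be stored (`exists_scale_of_lt`). For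
`2 ^ j ≥ Y * B`, the net consists of at most `n / B` points such that each relevant vertex is
at distance `O(B)` from one, and the clusters are those of a spanner of the graph that joins points at
distance at most `5 * B`; the additive error `Y` of this spanner, in steps of length `5 * B`, is
absorbed by the scale (`exists_scale_of_le`).

*Machine.* Queries are written in a small structured language, which compiles to the word RAM
(`Ex.reports`); `query_spec` is the correctness and running time of the program on a table with the
layout which `exists_table` provides.

With `κ = ⌈2 / ε⌉` this proves the first part (`hasOracle`). For the second part,
`κ = ⌈k ^ (1 / 6)⌉` is `o(k)`, and `(4 / 3) ^ 6 < 7` shows that `2 / κ` is at most the allowed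
exponent.
-/

namespace PathOracle

/-! ### A structured language for the word RAM -/

/-- Structured query programs. `ite r a b` runs `a` if register `r` is nonzero and `b` otherwise.
`loop c r b` runs `c`, stops if register `r` is zero, and else runs `b` and starts over. -/
inductive Cmd where
  | blk (l : List Instr)
  | seq (a b : Cmd)
  | ite (r : ℕ) (a b : Cmd)
  | loop (c : Cmd) (r : ℕ) (b : Cmd)

/-- The number of machine instructions of a structured program. -/
def Cmd.size : Cmd → ℕ
  | .blk l => l.length
  | .seq a b => a.size + b.size
  | .ite _ a b => a.size + b.size + 2
  | .loop c _ b => c.size + b.size + 2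

/-- Machine code of a structured program, to be placed at address `o`. Register `2` always holds
`0`, so that `jz 2 p` is an unconditional jump. -/
def Cmd.compile : Cmd → ℕ → Program
  | .blk l, _ => l
  | .seq a b, o => a.compile o ++ b.compile (o + a.size)
  | .ite r a b, o =>
      [.jz r (o + a.size + 2)] ++ a.compile (o + 1) ++ [.jz 2 (o + a.size + b.size + 2)] ++
        b.compile (o + a.size + 2)
  | .loop c r b, o =>
      c.compile o ++ [.jz r (o + c.size + b.size + 2)] ++ b.compile (o + c.size + 1) ++ [.jz 2 o]

theorem Cmd.length_compile (c : Cmd) (o : ℕ) : (c.compile o).length = c.size := by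
  induction c generalizing o with
  | blk l => rfl
  | seq a b iha ihb => simp [compile, size, iha, ihb]
  | ite r a b iha ihb => simp [compile, size, iha, ihb]; omega
  | loop c r b ihc ihb => simp [compile, size, ihc, ihb]; omega

/-- A configuration of the machine without instruction counter, whose cells hold natural numbers. -/
structure NS where
  reg : ℕ → ℕ
  mem : ℕ → ℕ
  out : List ℕ

/-- The binary operations on natural numbers; those that are not needed return `0`. -/
def BinOp.nat : BinOp → ℕ → ℕ → ℕ
  | .add, x, y => x + y
  | .sub, x, y => x - y
  | .mul, x, y => x * y
  | .eq, x, y => if x = y then 1 else 0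
  | .lt, x, y => if x < y then 1 else 0
  | _, _, _ => 0

/-- Effect of an instruction on a configuration of natural numbers, for a stored table `dat` and
`sc` cells of working memory. -/
def nexec (dat : ℕ → ℕ) (sc : ℕ) : Instr → NS → NS
  | .const r a, σ => { σ with reg := Function.update σ.reg r a }
  | .bin o r s t, σ => { σ with reg := Function.update σ.reg r (o.nat (σ.reg s) (σ.reg t)) }
  | .read r s, σ => { σ with reg := Function.update σ.reg r (dat (σ.reg s)) }
  | .load r s, σ =>
      { σ with reg := Function.update σ.reg r (if σ.reg s < sc then σ.mem (σ.reg s) else 0) }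
  | .store r s, σ =>
      { σ with mem := if σ.reg r < sc then Function.update σ.mem (σ.reg r) (σ.reg s) else σ.mem }
  | .jz _ _, σ => σ
  | .emit r, σ => { σ with out := σ.out ++ [σ.reg r] }

/-- The instruction has the same effect on natural numbers as on words with `W` values. -/
def Instr.Ok (W : ℕ) : Instr → NS → Prop
  | .const _ a, _ => a < W
  | .bin .add _ s t, σ => σ.reg s + σ.reg t < W
  | .bin .sub _ s t, σ => σ.reg t ≤ σ.reg s
  | .bin .mul _ s t, σ => σ.reg s * σ.reg t < W
  | .bin .eq _ _ _, _ => True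
  | .bin .lt _ _ _, _ => True
  | .bin _ _ _ _, _ => False
  | .jz _ _, _ => False
  | _, _ => True

/-- Effect of a list of instructions. -/
def nexecs (dat : ℕ → ℕ) (sc : ℕ) : List Instr → NS → NS
  | [], σ => σ
  | i :: l, σ => nexecs dat sc l (nexec dat sc i σ)

/-- All instructions of the list can be carried out without overflow. -/
def Oks (dat : ℕ → ℕ) (sc W : ℕ) : List Instr → NS → Prop
  | [], _ => True
  | i :: l, σ => i.Ok W σ ∧ Oks dat sc W l (nexec dat sc i σ)

/-- Big-step semantics with running time: `Ex dat sc W c σ t σ'` says that `c` leads from `σ` to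
`σ'` in exactly `t` machine steps without overflow. -/
inductive Ex (dat : ℕ → ℕ) (sc W : ℕ) : Cmd → NS → ℕ → NS → Prop
  | blk (l : List Instr) (σ : NS) (h : Oks dat sc W l σ) :
      Ex dat sc W (.blk l) σ l.length (nexecs dat sc l σ)
  | seq {a b : Cmd} {σ σ₁ σ₂ : NS} {s t : ℕ} (h₁ : Ex dat sc W a σ s σ₁)
      (h₂ : Ex dat sc W b σ₁ t σ₂) : Ex dat sc W (.seq a b) σ (s + t) σ₂
  | ite_true {r : ℕ} {a b : Cmd} {σ σ₁ : NS} {t : ℕ} (h : σ.reg r ≠ 0)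
      (h₁ : Ex dat sc W a σ t σ₁) : Ex dat sc W (.ite r a b) σ (1 + t + 1) σ₁
  | ite_false {r : ℕ} {a b : Cmd} {σ σ₁ : NS} {t : ℕ} (h : σ.reg r = 0)
      (h₁ : Ex dat sc W b σ t σ₁) : Ex dat sc W (.ite r a b) σ (1 + t) σ₁
  | loop_done {r : ℕ} {c b : Cmd} {σ σ₁ : NS} {t : ℕ} (h₁ : Ex dat sc W c σ t σ₁)
      (h : σ₁.reg r = 0) : Ex dat sc W (.loop c r b) σ (t + 1) σ₁
  | loop_step {r : ℕ} {c b : Cmd} {σ σ₁ σ₂ σ₃ : NS} {t₁ t₂ t₃ : ℕ}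
      (h₁ : Ex dat sc W c σ t₁ σ₁) (h : σ₁.reg r ≠ 0) (h₂ : Ex dat sc W b σ₁ t₂ σ₂)
      (h₃ : Ex dat sc W (.loop c r b) σ₂ t₃ σ₃) :
      Ex dat sc W (.loop c r b) σ (t₁ + 1 + t₂ + 1 + t₃) σ₃

/-- The register written by an instruction. -/
def Instr.target : Instr → Option ℕ
  | .const r _ => some r
  | .bin _ r _ _ => some r
  | .read r _ => some r
  | .load r _ => some r
  | _ => none

/-- The registers that a program may write. -/
def Cmd.writes : Cmd → List ℕ
  | .blk l => l.filterMap Instr.target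
  | .seq a b => a.writes ++ b.writes
  | .ite _ a b => a.writes ++ b.writes
  | .loop c _ b => c.writes ++ b.writes

/-- Whether an instruction writes to the working memory. -/
def Instr.stores : Instr → Bool
  | .store _ _ => true
  | _ => false

/-- Whether an instruction produces output. -/
def Instr.emits : Instr → Bool
  | .emit _ => true
  | _ => false

/-- Whether some instruction of the program has the property `f`. -/
def Cmd.has (f : Instr → Bool) : Cmd → Bool
  | .blk l => l.any f
  | .seq a b => a.has f || b.has f
  | .ite _ a b => a.has f || b.has f
  | .loop c _ b => c.has f || b.has f

section Frame

variable {dat : ℕ → ℕ} {sc W : ℕ}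

theorem nexec_reg {i : Instr} {σ : NS} {r : ℕ} (h : i.target ≠ some r) :
    (nexec dat sc i σ).reg r = σ.reg r := by
  cases i <;> simp [nexec, Instr.target] at h ⊢ <;> rw [Function.update_of_ne (Ne.symm h)]

theorem nexecs_reg {l : List Instr} {σ : NS} {r : ℕ} (h : r ∉ l.filterMap Instr.target) :
    (nexecs dat sc l σ).reg r = σ.reg r := by
  induction l generalizing σ with
  | nil => rfl
  | cons i l ih =>
    simp only [List.mem_filterMap, List.mem_cons, not_exists, not_and] at h
    rw [nexecs, ih, nexec_reg (h i (Or.inl rfl))]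
    simp only [List.mem_filterMap, not_exists, not_and]
    exact fun j hj => h j (Or.inr hj)

theorem nexecs_mem {l : List Instr} {σ : NS} (h : l.any Instr.stores = false) :
    (nexecs dat sc l σ).mem = σ.mem := by
  induction l generalizing σ with
  | nil => rfl
  | cons i l ih =>
    simp only [List.any_cons, Bool.or_eq_false_iff] at h
    rw [nexecs, ih h.2]
    cases i <;> simp [nexec, Instr.stores] at h ⊢

theorem nexecs_out {l : List Instr} {σ : NS} (h : l.any Instr.emits = false) :
    (nexecs dat sc l σ).out = σ.out := by
  induction l generalizing σ with
  | nil => rfl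
  | cons i l ih =>
    simp only [List.any_cons, Bool.or_eq_false_iff] at h
    rw [nexecs, ih h.2]
    cases i <;> simp [nexec, Instr.emits] at h ⊢

/-- A run changes only registers that its program may write. -/
theorem Ex.reg_eq {c : Cmd} {σ σ' : NS} {t r : ℕ} (h : Ex dat sc W c σ t σ') :
    r ∉ c.writes → σ'.reg r = σ.reg r := by
  induction h with
  | blk l σ h => exact nexecs_reg
  | seq _ _ ih₁ ih₂ =>
    intro h
    simp only [Cmd.writes, List.mem_append, not_or] at h
    rw [ih₂ h.2, ih₁ h.1]
  | ite_true _ _ ih =>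
    intro h
    simp only [Cmd.writes, List.mem_append, not_or] at h
    exact ih h.1
  | ite_false _ _ ih =>
    intro h
    simp only [Cmd.writes, List.mem_append, not_or] at h
    exact ih h.2
  | loop_done _ _ ih =>
    intro h
    simp only [Cmd.writes, List.mem_append, not_or] at h
    exact ih h.1
  | loop_step _ _ _ _ ih₁ ih₂ ih₃ =>
    intro h
    rw [ih₃ h]
    simp only [Cmd.writes, List.mem_append, not_or] at h
    rw [ih₂ h.2, ih₁ h.1]

theorem Ex.mem_eq {c : Cmd} {σ σ' : NS} {t : ℕ} (h : Ex dat sc W c σ t σ') :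
    c.has Instr.stores = false → σ'.mem = σ.mem := by
  induction h with
  | blk l σ h => exact nexecs_mem
  | seq _ _ ih₁ ih₂ =>
    intro h
    simp only [Cmd.has, Bool.or_eq_false_iff] at h
    rw [ih₂ h.2, ih₁ h.1]
  | ite_true _ _ ih =>
    intro h
    simp only [Cmd.has, Bool.or_eq_false_iff] at h
    exact ih h.1
  | ite_false _ _ ih =>
    intro h
    simp only [Cmd.has, Bool.or_eq_false_iff] at h
    exact ih h.2
  | loop_done _ _ ih =>
    intro h
    simp only [Cmd.has, Bool.or_eq_false_iff] at h
    exact ih h.1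
  | loop_step _ _ _ _ ih₁ ih₂ ih₃ =>
    intro h
    rw [ih₃ h]
    simp only [Cmd.has, Bool.or_eq_false_iff] at h
    rw [ih₂ h.2, ih₁ h.1]

theorem Ex.out_eq {c : Cmd} {σ σ' : NS} {t : ℕ} (h : Ex dat sc W c σ t σ') :
    c.has Instr.emits = false → σ'.out = σ.out := by
  induction h with
  | blk l σ h => exact nexecs_out
  | seq _ _ ih₁ ih₂ =>
    intro h
    simp only [Cmd.has, Bool.or_eq_false_iff] at h
    rw [ih₂ h.2, ih₁ h.1]
  | ite_true _ _ ih =>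
    intro h
    simp only [Cmd.has, Bool.or_eq_false_iff] at h
    exact ih h.1
  | ite_false _ _ ih =>
    intro h
    simp only [Cmd.has, Bool.or_eq_false_iff] at h
    exact ih h.2
  | loop_done _ _ ih =>
    intro h
    simp only [Cmd.has, Bool.or_eq_false_iff] at h
    exact ih h.1
  | loop_step _ _ _ _ ih₁ ih₂ ih₃ =>
    intro h
    rw [ih₃ h]
    simp only [Cmd.has, Bool.or_eq_false_iff] at h
    rw [ih₂ h.2, ih₁ h.1]

end Frame

/-! ### Correctness of the compiler -/

/-- All cells hold numbers below `W`. -/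
def NS.Below (W : ℕ) (σ : NS) : Prop := (∀ r, σ.reg r < W) ∧ ∀ a, σ.mem a < W

/-- The machine configuration that holds the numbers of `σ` as words. -/
def NS.toState (w : ℕ) (σ : NS) (pc : ℕ) : State w where
  pc := pc
  reg := fun r => BitVec.ofNat w (σ.reg r)
  mem := fun a => BitVec.ofNat w (σ.mem a)
  out := σ.out.map (BitVec.ofNat w)

section Simulation

variable {w : ℕ} {dat : List ℕ} {sc : ℕ}

theorem getD_lt {L : List ℕ} {W : ℕ} (hW : 0 < W) (h : ∀ x ∈ L, x < W) (a : ℕ) :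
    L.getD a 0 < W := by
  rw [List.getD_eq_getElem?_getD]
  rcases h' : L[a]? with _ | x
  · simpa using hW
  · simpa using h x (List.mem_of_getElem? h')

theorem NS.Below.nexec {i : Instr} {σ : NS} (hw : 0 < w) (hdat : ∀ x ∈ dat, x < 2 ^ w)
    (hσ : σ.Below (2 ^ w)) (hi : i.Ok (2 ^ w) σ) :
    (nexec (fun a => dat.getD a 0) sc i σ).Below (2 ^ w) := by
  have hupd : ∀ (f : ℕ → ℕ) (r x : ℕ), (∀ r, f r < 2 ^ w) → x < 2 ^ w →
      ∀ s, Function.update f r x s < 2 ^ w := by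
    intro f r x hf hx s
    rw [Function.update_apply]
    split_ifs
    exacts [hx, hf s]
  have h1 : 1 < 2 ^ w := Nat.one_lt_two_pow hw.ne'
  cases i with
  | const r a => exact ⟨hupd _ _ _ hσ.1 hi, hσ.2⟩
  | bin o r s t =>
    refine ⟨hupd _ _ _ hσ.1 ?_, hσ.2⟩
    have := hσ.1 s
    have := hσ.1 t
    cases o <;> simp only [Instr.Ok, BinOp.nat] at hi ⊢ <;> try split_ifs
    all_goals omega
  | read r s => exact ⟨hupd _ _ _ hσ.1 (getD_lt (by omega) hdat _), hσ.2⟩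
  | load r s =>
    refine ⟨hupd _ _ _ hσ.1 ?_, hσ.2⟩
    split_ifs
    exacts [hσ.2 _, by omega]
  | store r s =>
    refine ⟨hσ.1, ?_⟩
    simp only [PathOracle.nexec]
    split_ifs
    exacts [hupd _ _ _ hσ.2 (hσ.1 s), hσ.2]
  | jz r p => exact hi.elim
  | emit r => exact hσ

/-- As long as nothing overflows, an instruction acts on words as on natural numbers. -/
theorem exec_toState {i : Instr} {σ : NS} {pc : ℕ} (hσ : σ.Below (2 ^ w)) (hi : i.Ok (2 ^ w) σ) :
    i.exec ⟨dat.map (BitVec.ofNat w), sc⟩ (σ.toState w pc) =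
      (nexec (fun a => dat.getD a 0) sc i σ).toState w (pc + 1) := by
  have hupd : ∀ (f : ℕ → ℕ) (r x : ℕ),
      Function.update (fun r => BitVec.ofNat w (f r)) r (BitVec.ofNat w x) =
        fun s => BitVec.ofNat w (Function.update f r x s) := by
    intro f r x
    funext s
    simp only [Function.update_apply]
    split_ifs <;> rfl
  have hr : ∀ r, σ.reg r % 2 ^ w = σ.reg r := fun r => Nat.mod_eq_of_lt (hσ.1 r)
  have hinj : ∀ s t, BitVec.ofNat w (σ.reg s) = BitVec.ofNat w (σ.reg t) ↔
      σ.reg s = σ.reg t := by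
    intro s t
    rw [← BitVec.toNat_inj, BitVec.toNat_ofNat, BitVec.toNat_ofNat, hr, hr]
  cases i with
  | const r a => simp [Instr.exec, nexec, NS.toState, hupd]
  | bin o r s t =>
    have key : o.eval (BitVec.ofNat w (σ.reg s)) (BitVec.ofNat w (σ.reg t)) =
        BitVec.ofNat w (o.nat (σ.reg s) (σ.reg t)) := by
      cases o <;> simp only [Instr.Ok, BinOp.eval, BinOp.nat] at hi ⊢
      · rw [BitVec.ofNat_add]
      · apply BitVec.eq_of_toNat_eq
        rw [BitVec.toNat_sub_of_le]
        · simp only [BitVec.toNat_ofNat, hr]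
          rw [Nat.mod_eq_of_lt (lt_of_le_of_lt (Nat.sub_le _ _) (hσ.1 s))]
        · rw [BitVec.le_def, BitVec.toNat_ofNat, BitVec.toNat_ofNat, hr, hr]
          exact hi
      · rw [BitVec.ofNat_mul]
      · simp only [hinj]
        split_ifs <;> rfl
      · simp only [BitVec.toNat_ofNat, hr]
        split_ifs <;> rfl
    simp only [Instr.exec, nexec, NS.toState, key, hupd]
  | read r s =>
    have : (dat.map (BitVec.ofNat w)).getD (σ.reg s) 0 =
        BitVec.ofNat w (dat.getD (σ.reg s) 0) := by
      rw [List.getD_eq_getElem?_getD, List.getD_eq_getElem?_getD, List.getElem?_map]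
      cases dat[σ.reg s]? <;> rfl
    simp only [Instr.exec, nexec, NS.toState, BitVec.toNat_ofNat, hr, this, hupd]
  | load r s =>
    simp only [Instr.exec, nexec, NS.toState, BitVec.toNat_ofNat, hr, ← hupd]
    congr 2
    split_ifs <;> rfl
  | store r s =>
    simp only [Instr.exec, nexec, NS.toState, BitVec.toNat_ofNat, hr]
    congr 1
    split_ifs
    · rw [hupd]
    · rfl
  | jz r p => exact hi.elim
  | emit r => simp [Instr.exec, nexec, NS.toState]

theorem step_toState {P : Program} {i : Instr} {σ : NS} {pc : ℕ}
    (hP : P[pc]? = some i) (hσ : σ.Below (2 ^ w)) (hi : i.Ok (2 ^ w) σ) :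
    step P ⟨dat.map (BitVec.ofNat w), sc⟩ (σ.toState w pc) =
      (nexec (fun a => dat.getD a 0) sc i σ).toState w (pc + 1) := by
  rw [← exec_toState hσ hi]
  simp only [step, NS.toState, hP]

theorem step_jz {P : Program} {r p : ℕ} {σ : NS} {pc : ℕ} {O : Oracle w}
    (hP : P[pc]? = some (.jz r p)) (hσ : σ.Below (2 ^ w)) :
    step P O (σ.toState w pc) = σ.toState w (if σ.reg r = 0 then p else pc + 1) := by
  have : BitVec.ofNat w (σ.reg r) = 0 ↔ σ.reg r = 0 := by
    rw [← BitVec.toNat_inj, BitVec.toNat_ofNat, Nat.mod_eq_of_lt (hσ.1 r)]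
    simp
  simp only [step, NS.toState, hP, Instr.exec, this]

/-- The code `Q` stands in `P` at address `o`. -/
def CodeAt (P Q : Program) (o : ℕ) : Prop := ∀ i < Q.length, P[o + i]? = Q[i]?

theorem CodeAt.left {P Q₁ Q₂ : Program} {o : ℕ} (h : CodeAt P (Q₁ ++ Q₂) o) : CodeAt P Q₁ o := by
  intro i hi
  rw [h i (by simp; omega), List.getElem?_append_left hi]

theorem CodeAt.right {P Q₁ Q₂ : Program} {o : ℕ} (h : CodeAt P (Q₁ ++ Q₂) o) :
    CodeAt P Q₂ (o + Q₁.length) := by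
  intro i hi
  rw [add_assoc, h _ (by simp; omega), List.getElem?_append_right (by omega)]
  simp

theorem CodeAt.single {P : Program} {i : Instr} {o : ℕ} (h : CodeAt P [i] o) :
    P[o]? = some i := by
  simpa using h 0 (by simp)

theorem nexecs_toState {P : Program} {l : List Instr} {σ : NS} {pc : ℕ} (hw : 0 < w)
    (hdat : ∀ x ∈ dat, x < 2 ^ w) (hP : CodeAt P l pc) (hσ : σ.Below (2 ^ w))
    (hi : Oks (fun a => dat.getD a 0) sc (2 ^ w) l σ) :
    (nexecs (fun a => dat.getD a 0) sc l σ).Below (2 ^ w) ∧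
    (step P ⟨dat.map (BitVec.ofNat w), sc⟩)^[l.length] (σ.toState w pc) =
      (nexecs (fun a => dat.getD a 0) sc l σ).toState w (pc + l.length) := by
  induction l generalizing σ pc with
  | nil => exact ⟨hσ, rfl⟩
  | cons i l ih =>
    rw [← List.singleton_append] at hP
    have h := ih hP.right (hσ.nexec hw hdat hi.1) hi.2
    refine ⟨h.1, ?_⟩
    rw [List.length_cons, Function.iterate_succ_apply, step_toState hP.left.single hσ hi.1]
    simp only [List.length_singleton] at h
    rw [h.2, nexecs]
    congr 1
    omega

/-- Correctness of the compiler: a run of a structured program is a run of its machine code, in the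
same time. Register `2` has to hold `0`, since it is the condition of the unconditional jumps. -/
theorem Ex.run {P : Program} {c : Cmd} {σ σ' : NS} {t : ℕ} (hw : 0 < w)
    (hdat : ∀ x ∈ dat, x < 2 ^ w) (h : Ex (fun a => dat.getD a 0) sc (2 ^ w) c σ t σ') :
    ∀ pc, CodeAt P (c.compile pc) pc → 2 ∉ c.writes → σ.Below (2 ^ w) → σ.reg 2 = 0 →
      σ'.Below (2 ^ w) ∧ (step P ⟨dat.map (BitVec.ofNat w), sc⟩)^[t] (σ.toState w pc) =
        σ'.toState w (pc + c.size) := by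
  induction h with
  | blk l σ h => exact fun pc hP _ hσ _ => nexecs_toState hw hdat hP hσ h
  | @seq a b σ σ₁ σ₂ s t h₁ h₂ ih₁ ih₂ =>
    intro pc hP hz hσ h0
    simp only [Cmd.writes, List.mem_append, not_or] at hz
    rw [Cmd.compile] at hP
    have r₁ := ih₁ pc hP.left hz.1 hσ h0
    have hP₂ := hP.right
    rw [Cmd.length_compile] at hP₂
    have r₂ := ih₂ _ hP₂ hz.2 r₁.1 (by rw [h₁.reg_eq hz.1, h0])
    refine ⟨r₂.1, ?_⟩
    rw [add_comm s t, Function.iterate_add_apply, r₁.2, r₂.2, Cmd.size, add_assoc]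
  | @ite_true r a b σ σ₁ t h h₁ ih =>
    intro pc hP hz hσ h0
    simp only [Cmd.writes, List.mem_append, not_or] at hz
    rw [Cmd.compile] at hP
    have r₁ := ih (pc + 1) hP.left.left.right hz.1 hσ h0
    have hj := hP.left.right.single
    simp only [List.length_append, List.length_singleton, Cmd.length_compile] at hj
    refine ⟨r₁.1, ?_⟩
    rw [add_comm 1 t, add_comm (t + 1) 1, Function.iterate_add_apply, Function.iterate_add_apply,
      Function.iterate_one, step_jz hP.left.left.left.single hσ, if_neg h, r₁.2]
    rw [show pc + 1 + a.size = pc + (1 + a.size) by omega, step_jz hj r₁.1, h₁.reg_eq hz.1, h0,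
      if_pos rfl, Cmd.size]
    congr 1
    omega
  | @ite_false r a b σ σ₁ t h h₁ ih =>
    intro pc hP hz hσ h0
    simp only [Cmd.writes, List.mem_append, not_or] at hz
    rw [Cmd.compile] at hP
    have hb := hP.right
    simp only [List.length_append, List.length_singleton, Cmd.length_compile] at hb
    rw [show pc + (1 + a.size + 1) = pc + a.size + 2 by omega] at hb
    have r₁ := ih _ hb hz.2 hσ h0
    refine ⟨r₁.1, ?_⟩
    rw [add_comm 1 t, Function.iterate_add_apply,
      Function.iterate_one, step_jz hP.left.left.left.single hσ, if_pos h, r₁.2, Cmd.size]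
    congr 1
    omega
  | @loop_done r c b σ σ₁ t h₁ h ih =>
    intro pc hP hz hσ h0
    simp only [Cmd.writes, List.mem_append, not_or] at hz
    rw [Cmd.compile] at hP
    have r₁ := ih pc hP.left.left.left hz.1 hσ h0
    have hj := hP.left.left.right.single
    simp only [Cmd.length_compile] at hj
    refine ⟨r₁.1, ?_⟩
    rw [add_comm t 1, Function.iterate_add_apply, r₁.2, Function.iterate_one, step_jz hj r₁.1,
      if_pos h, Cmd.size]
    congr 1
    omega
  | @loop_step r c b σ σ₁ σ₂ σ₃ t₁ t₂ t₃ h₁ h h₂ h₃ ih₁ ih₂ ih₃ =>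
    intro pc hP hz hσ h0
    have hP' := hP
    have hz' := hz
    simp only [Cmd.writes, List.mem_append, not_or] at hz
    rw [Cmd.compile] at hP
    have r₁ := ih₁ pc hP.left.left.left hz.1 hσ h0
    have hj := hP.left.left.right.single
    have hb := hP.left.right
    have hk := hP.right.single
    simp only [List.length_append, List.length_singleton, Cmd.length_compile] at hj hb hk
    have e₁ : σ₁.reg 2 = 0 := by rw [h₁.reg_eq hz.1, h0]
    rw [← add_assoc] at hb
    have r₂ := ih₂ _ hb hz.2 r₁.1 e₁
    have e₂ : σ₂.reg 2 = 0 := by rw [h₂.reg_eq hz.2, e₁]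
    have r₃ := ih₃ pc hP' hz' r₂.1 e₂
    refine ⟨r₃.1, ?_⟩
    rw [show t₁ + 1 + t₂ + 1 + t₃ = t₃ + (1 + (t₂ + (1 + t₁))) by omega,
      Function.iterate_add_apply, Function.iterate_add_apply, Function.iterate_add_apply,
      Function.iterate_add_apply, r₁.2, Function.iterate_one, step_jz hj r₁.1, if_neg h, r₂.2,
      show pc + c.size + 1 + b.size = pc + (c.size + 1 + b.size) by omega,
      step_jz hk r₂.1, e₂, if_pos rfl, r₃.2]

/-- The initial configuration of the query `(u, v)`. -/
def startNS (u v : ℕ) : NS where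
  reg := fun i => if i = 0 then u else if i = 1 then v else 0
  mem := fun _ => 0
  out := []

/-- A terminating run of a structured program is a run of the machine, with the same output. -/
theorem Ex.reports {c : Cmd} {σ' : NS} {t u v : ℕ} (hw : 0 < w)
    (hdat : ∀ x ∈ dat, x < 2 ^ w) (hu : u < 2 ^ w) (hv : v < 2 ^ w) (hz : 2 ∉ c.writes)
    (h : Ex (fun a => dat.getD a 0) sc (2 ^ w) c (startNS u v) t σ')
    (hout : ∀ x ∈ σ'.out, x < 2 ^ w) :
    Reports (c.compile 0) ⟨dat.map (BitVec.ofNat w), sc⟩ u v t σ'.out := by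
  have h0 : 0 < 2 ^ w := by positivity
  have hinit : init w u v = (startNS u v).toState w 0 := by
    simp only [init, startNS, NS.toState, List.map_nil, State.mk.injEq, true_and, and_true]
    refine ⟨?_, rfl⟩
    funext i
    split_ifs <;> rfl
  have hb : (startNS u v).Below (2 ^ w) := by
    refine ⟨fun r => ?_, fun _ => h0⟩
    simp only [startNS]
    split_ifs <;> assumption
  have hc : CodeAt (c.compile 0) (c.compile 0) 0 := fun i _ => by rw [zero_add]
  have r := h.run (P := c.compile 0) hw hdat 0 hc hz hb rfl
  unfold Reports
  rw [hinit, r.2]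
  refine ⟨?_, ?_⟩
  · simp [NS.toState, Cmd.length_compile]
  · simp only [NS.toState, List.map_map]
    conv_rhs => rw [← List.map_id σ'.out]
    refine List.map_congr_left fun x hx => ?_
    simp [Nat.mod_eq_of_lt (hout x hx)]

end Simulation

/-! ### The query program -/

/-- Copies the words at the addresses `reg 13, …, reg 14 - 1` of the table onto the stack in the
working memory, whose top is in register `18`. -/
def copyCmd : Cmd :=
  .loop (.blk [.bin .lt 16 13 14]) 16
    (.blk [.read 15 13, .store 18 15, .bin .add 18 18 3, .bin .add 13 13 3])

/-- Pushes all vertices of the chain of records that starts at the address in register `19`. -/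
def followCmd : Cmd :=
  .loop (.blk [.const 7 3, .bin .add 8 19 7, .read 8 8]) 8
    (.seq (.blk [.const 7 2, .bin .add 13 19 7, .read 13 13, .bin .add 14 13 8])
      (.seq copyCmd (.blk [.bin .add 19 19 3, .read 19 19])))

/-- Emits the cells `reg 13, …, reg 18 - 1` of the working memory. -/
def emitUpCmd : Cmd :=
  .loop (.blk [.bin .lt 16 13 18]) 16 (.blk [.load 12 13, .emit 12, .bin .add 13 13 3])

/-- Emits the cells `reg 13 - 1, …, reg 27` of the working memory, in this order. -/
def emitDownCmd : Cmd :=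
  .loop (.blk [.bin .lt 16 27 13]) 16 (.blk [.bin .sub 13 13 3, .load 12 13, .emit 12])

/-- Finds the first scale at which the two query vertices lie in a common cluster. -/
def scaleCmd : Cmd :=
  .loop (.blk [.const 7 2, .bin .add 24 20 7, .read 24 24, .bin .add 22 20 3, .read 22 22,
      .bin .add 22 22 24, .bin .add 23 21 3, .read 23 23, .bin .add 23 23 24, .read 16 22,
      .read 17 23, .bin .eq 16 16 17, .bin .sub 16 3 16]) 16
    (.blk [.const 7 3, .bin .add 20 20 7, .bin .add 21 21 7])

/-- Reports a path through the center of a common cluster. The walks of the second and of the first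
vertex to the center are pushed onto a stack, which starts in the working memory behind the search
tree and the queue; then the upper part is emitted forwards and the lower part backwards, without
the center. -/
def searchCmd : Cmd :=
  .seq (.blk [.const 7 4, .bin .add 20 5 7, .read 20 20, .bin .add 21 6 7, .read 21 21])
  (.seq scaleCmd
  (.seq (.blk [.bin .add 18 4 4, .store 18 1, .bin .add 18 18 3, .read 19 21])
  (.seq followCmd
  (.seq (.blk [.bin .add 19 23 2])
  (.seq followCmd
  (.seq (.blk [.bin .add 26 18 2, .store 18 0, .bin .add 18 18 3, .read 19 20])
  (.seq followCmd
  (.seq (.blk [.bin .add 19 22 2])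
  (.seq followCmd
  (.seq (.blk [.bin .add 13 26 2])
  (.seq emitUpCmd
  (.seq (.blk [.bin .add 27 4 4, .bin .sub 13 26 3])
    emitDownCmd))))))))))))

/-- Scans the neighbours of the vertex in register `12`, which are listed in the table between the
addresses in registers `13` and `14`, and appends those not found before to the queue. -/
def scanCmd : Cmd :=
  .loop (.blk [.bin .lt 16 13 14]) 16
    (.seq (.blk [.read 15 13, .bin .add 13 13 3, .load 17 15, .bin .eq 17 17 2])
      (.ite 17 (.blk [.bin .add 8 12 3, .store 15 8, .store 10 15, .bin .add 10 10 3]) (.blk [])))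

/-- Breadth-first search. Cell `x` of the working memory holds the parent of vertex `x` plus one,
or `0` if `x` has not been found; the queue is stored from cell `n` on, between the addresses in
registers `9` and `10`. The search stops when the head of the queue reaches register `11`. -/
def bfsCmd : Cmd :=
  .loop (.blk [.bin .lt 16 9 11]) 16
    (.seq (.blk [.load 12 9, .bin .add 9 9 3, .const 7 8, .bin .mul 7 12 7, .const 8 2,
      .bin .add 7 7 8, .read 13 7, .bin .add 7 7 3, .read 14 7]) scanCmd)

/-- Emits the path from the first query vertex to the root of the search tree. -/
def ascendCmd : Cmd :=
  .seq (.blk [.bin .add 12 0 2, .emit 12])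
    (.loop (.blk [.bin .eq 16 12 1, .bin .sub 16 3 16]) 16
      (.blk [.load 12 12, .bin .sub 12 12 3, .emit 12]))

/-- The query program for the vertices in registers `0` and `1`. It compares the components of the
two vertices, searches from the second one, and uses the stored clusters if the search has not
found the first one. The registers `2` and `3` hold the constants `0` and `1`, and register `4`
holds the number of vertices. -/
def queryCmd : Cmd :=
  .seq (.blk [.const 3 1, .const 7 8, .bin .mul 5 0 7, .bin .mul 6 1 7, .read 8 5, .read 9 6,
    .bin .eq 10 8 9])
  (.ite 10
    (.seq (.blk [.const 7 5, .bin .add 7 6 7, .read 4 7, .bin .add 7 6 3, .read 11 7,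
      .bin .add 11 4 11, .bin .add 8 1 3, .store 1 8, .store 4 1, .bin .add 9 4 2,
      .bin .add 10 4 3])
    (.seq bfsCmd
    (.seq (.blk [.load 16 0])
      (.ite 16 ascendCmd searchCmd))))
    (.blk []))

/-! ### Following chains of records -/

/-- The memory after writing the list `l` from address `p` on. -/
def writeList (m : ℕ → ℕ) (p : ℕ) : List ℕ → ℕ → ℕ
  | [] => m
  | x :: l => writeList (Function.update m p x) (p + 1) l

theorem writeList_append (m : ℕ → ℕ) (p : ℕ) (l l' : List ℕ) :
    writeList m p (l ++ l') = writeList (writeList m p l) (p + l.length) l' := by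
  induction l generalizing m p with
  | nil => rfl
  | cons x l ih =>
    rw [List.cons_append, writeList, ih, writeList, List.length_cons]
    congr 1
    omega

theorem writeList_of_lt (m : ℕ → ℕ) (p : ℕ) (l : List ℕ) {i : ℕ} (h : i < p) :
    writeList m p l i = m i := by
  induction l generalizing m p with
  | nil => rfl
  | cons x l ih => rw [writeList, ih _ _ (by omega), Function.update_of_ne (by omega)]

theorem writeList_getElem (m : ℕ → ℕ) (p : ℕ) (l : List ℕ) {i : ℕ} (h : i < l.length) :
    writeList m p l (p + i) = l[i] := by
  induction l generalizing m p i with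
  | nil => simp at h
  | cons x l ih =>
    rw [writeList]
    cases i with
    | zero => rw [writeList_of_lt _ _ _ (by omega)]; simp
    | succ i =>
      rw [show p + (i + 1) = p + 1 + i by omega, ih _ _ (by simpa using h)]
      simp

/-- A chain of records in the table. The record at address `a` consists of four words: a label, the
address of the next record, and the address and the length of a list of vertices. The chain ends at
the first record whose list is empty; the argument is the concatenation of the lists. -/
inductive Chain (dat : ℕ → ℕ) (W : ℕ) : ℕ → List ℕ → Prop
  | nil {a : ℕ} (ha : a + 3 < W) (h : dat (a + 3) = 0) : Chain dat W a []
  | cons {a : ℕ} {l rest : List ℕ} (ha : a + 3 < W) (hl : l ≠ []) (h : dat (a + 3) = l.length)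
      (hW : dat (a + 2) + l.length < W)
      (hp : ∀ i (hi : i < l.length), dat (dat (a + 2) + i) = l[i])
      (hr : Chain dat W (dat (a + 1)) rest) : Chain dat W a (l ++ rest)

section Specs

variable {dat : ℕ → ℕ} {sc W : ℕ}

theorem copy_spec (hsc : sc < W) (l : List ℕ) : ∀ (σ : NS) (p : ℕ), σ.reg 3 = 1 → σ.reg 13 = p →
    σ.reg 14 = p + l.length → p + l.length < W → (∀ i (hi : i < l.length), dat (p + i) = l[i]) →
    σ.reg 18 + l.length ≤ sc →
    ∃ t σ', Ex dat sc W copyCmd σ t σ' ∧ t ≤ 7 * l.length + 2 ∧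
      σ'.reg 18 = σ.reg 18 + l.length ∧ σ'.mem = writeList σ.mem (σ.reg 18) l := by
  induction l with
  | nil =>
    intro σ p h3 h13 h14 hW hd hs
    refine ⟨_, _, Ex.loop_done (Ex.blk _ _ ?_) ?_, ?_, ?_, ?_⟩
    · simp [Oks, Instr.Ok]
    · simp [nexecs, nexec, BinOp.nat, h13, h14]
    · simp
    · simp [nexecs, nexec]
    · simp [nexecs, nexec, writeList]
  | cons x l ih =>
    intro σ p h3 h13 h14 hW hd hs
    simp only [List.length_cons] at h14 hW hs
    have hx : dat p = x := hd 0 (by simp)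
    set σ₁ := nexecs dat sc [.bin .lt 16 13 14] σ with hσ₁
    have hA : Ex dat sc W (.blk [.bin .lt 16 13 14]) σ 1 σ₁ :=
      Ex.blk _ _ (by simp [Oks, Instr.Ok])
    have h₁ : σ₁.reg 16 ≠ 0 := by simp [hσ₁, nexecs, nexec, BinOp.nat, h13, h14]
    have g3 : σ₁.reg 3 = 1 := by simp [hσ₁, nexecs, nexec, h3]
    have g13 : σ₁.reg 13 = p := by simp [hσ₁, nexecs, nexec, h13]
    have g14 : σ₁.reg 14 = p + (l.length + 1) := by simp [hσ₁, nexecs, nexec, h14]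
    have g18 : σ₁.reg 18 = σ.reg 18 := by simp [hσ₁, nexecs, nexec]
    have gm : σ₁.mem = σ.mem := by simp [hσ₁, nexecs, nexec]
    set blk : List Instr := [.read 15 13, .store 18 15, .bin .add 18 18 3, .bin .add 13 13 3]
    set σ₂ := nexecs dat sc blk σ₁ with hσ₂
    have hB : Ex dat sc W (.blk blk) σ₁ 4 σ₂ := by
      refine Ex.blk _ _ ?_
      simp [blk, Oks, Instr.Ok, nexec, g3, g13, g18]
      omega
    obtain ⟨t, σ₃, hC, ht, h18, hm⟩ := ih σ₂ (p + 1)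
      (by simp [hσ₂, blk, nexecs, nexec, g3])
      (by simp [hσ₂, blk, nexecs, nexec, g13, g3, BinOp.nat])
      (by simp [hσ₂, blk, nexecs, nexec, g14]; omega)
      (by omega)
      (fun i hi => by
        have := hd (i + 1) (by simpa using hi)
        rw [show p + 1 + i = p + (i + 1) by omega, this]
        simp)
      (by simp [hσ₂, blk, nexecs, nexec, g18, g3, BinOp.nat]; omega)
    refine ⟨_, σ₃, Ex.loop_step hA h₁ hB hC, ?_, ?_, ?_⟩
    · simp only [List.length_cons]; omega
    · rw [h18]
      simp [hσ₂, blk, nexecs, nexec, g18, g3, BinOp.nat]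
      omega
    · rw [hm, writeList]
      simp [hσ₂, blk, nexecs, nexec, g18, g3, g13, BinOp.nat, hx, gm,
        show σ.reg 18 < sc by omega]

theorem follow_spec (hsc : sc < W) (hW : 4 < W) {a : ℕ} {l : List ℕ} (h : Chain dat W a l) :
    ∀ σ : NS, σ.reg 3 = 1 → σ.reg 19 = a → σ.reg 18 + l.length ≤ sc →
    ∃ t σ', Ex dat sc W followCmd σ t σ' ∧ t ≤ 20 * l.length + 4 ∧
      σ'.reg 18 = σ.reg 18 + l.length ∧ σ'.mem = writeList σ.mem (σ.reg 18) l := by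
  induction h with
  | @nil a ha h =>
    intro σ h3 h19 hs
    refine ⟨_, _, Ex.loop_done (Ex.blk _ _ ?_) ?_, ?_, ?_, ?_⟩
    · simp [Oks, Instr.Ok, nexec, h19]; omega
    · simp [nexecs, nexec, BinOp.nat, h19, h]
    · simp
    · simp [nexecs, nexec]
    · simp [nexecs, nexec, writeList]
  | @cons a l rest ha hl h hWl hp hr ih =>
    intro σ h3 h19 hs
    rw [List.length_append] at hs
    have hl0 : l.length ≠ 0 := by simpa using hl
    set blk₁ : List Instr := [.const 7 3, .bin .add 8 19 7, .read 8 8]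
    set σ₁ := nexecs dat sc blk₁ σ with hσ₁
    have hA : Ex dat sc W (.blk blk₁) σ 3 σ₁ :=
      Ex.blk _ _ (by simp [blk₁, Oks, Instr.Ok, nexec, h19]; omega)
    have g8 : σ₁.reg 8 = l.length := by simp [hσ₁, blk₁, nexecs, nexec, BinOp.nat, h19, h]
    have g3 : σ₁.reg 3 = 1 := by simp [hσ₁, blk₁, nexecs, nexec, h3]
    have g19 : σ₁.reg 19 = a := by simp [hσ₁, blk₁, nexecs, nexec, h19]
    have g18 : σ₁.reg 18 = σ.reg 18 := by simp [hσ₁, blk₁, nexecs, nexec]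
    have gm : σ₁.mem = σ.mem := by simp [hσ₁, blk₁, nexecs, nexec]
    set blk₂ : List Instr := [.const 7 2, .bin .add 13 19 7, .read 13 13, .bin .add 14 13 8]
    set σ₂ := nexecs dat sc blk₂ σ₁ with hσ₂
    have hB : Ex dat sc W (.blk blk₂) σ₁ 4 σ₂ :=
      Ex.blk _ _ (by simp [blk₂, Oks, Instr.Ok, nexec, BinOp.nat, g19, g8]; omega)
    obtain ⟨t, σ₃, hC, ht, h18, hm⟩ := copy_spec hsc l σ₂ (dat (a + 2))
      (by simp [hσ₂, blk₂, nexecs, nexec, g3])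
      (by simp [hσ₂, blk₂, nexecs, nexec, g19, BinOp.nat])
      (by simp [hσ₂, blk₂, nexecs, nexec, g19, g8, BinOp.nat])
      hWl hp (by simp [hσ₂, blk₂, nexecs, nexec, g18]; omega)
    have f3 : σ₃.reg 3 = 1 := by
      rw [hC.reg_eq (by decide), hB.reg_eq (by simp [blk₂, Cmd.writes, Instr.target]), g3]
    have f19 : σ₃.reg 19 = a := by
      rw [hC.reg_eq (by decide), hB.reg_eq (by simp [blk₂, Cmd.writes, Instr.target]), g19]
    have f18 : σ₂.reg 18 = σ.reg 18 := by
      rw [hB.reg_eq (by simp [blk₂, Cmd.writes, Instr.target]), g18]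
    have fm : σ₂.mem = σ.mem := by simp [hσ₂, blk₂, nexecs, nexec, gm]
    set blk₃ : List Instr := [.bin .add 19 19 3, .read 19 19]
    set σ₄ := nexecs dat sc blk₃ σ₃ with hσ₄
    have hD : Ex dat sc W (.blk blk₃) σ₃ 2 σ₄ :=
      Ex.blk _ _ (by simp [blk₃, Oks, Instr.Ok, f19, f3]; omega)
    have k18 : σ₄.reg 18 = σ.reg 18 + l.length := by
      simp [hσ₄, blk₃, nexecs, nexec, h18, f18]
    have km : σ₄.mem = writeList σ.mem (σ.reg 18) l := by
      simp [hσ₄, blk₃, nexecs, nexec, hm, f18, fm]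
    obtain ⟨t', σ₅, hE, ht', h18', hm'⟩ := ih σ₄
      (by simp [hσ₄, blk₃, nexecs, nexec, f3])
      (by simp [hσ₄, blk₃, nexecs, nexec, f3, f19, BinOp.nat]) (by omega)
    refine ⟨_, σ₅, Ex.loop_step hA (by rw [g8]; exact hl0) (Ex.seq hB (Ex.seq hC hD)) hE, ?_, ?_,
      ?_⟩
    · simp only [List.length_append]; omega
    · rw [h18', k18, List.length_append]; omega
    · rw [hm', k18, km, writeList_append]

theorem emitUp_spec (hsc : sc < W) (l : List ℕ) : ∀ (σ : NS) (p : ℕ), σ.reg 3 = 1 →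
    σ.reg 13 = p → σ.reg 18 = p + l.length → p + l.length ≤ sc →
    (∀ i (hi : i < l.length), σ.mem (p + i) = l[i]) →
    ∃ t σ', Ex dat sc W emitUpCmd σ t σ' ∧ t ≤ 6 * l.length + 2 ∧ σ'.out = σ.out ++ l := by
  induction l with
  | nil =>
    intro σ p h3 h13 h14 hW hd
    refine ⟨_, _, Ex.loop_done (Ex.blk _ _ ?_) ?_, ?_, ?_⟩
    · simp [Oks, Instr.Ok]
    · simp [nexecs, nexec, BinOp.nat, h13, h14]
    · simp
    · simp [nexecs, nexec]
  | cons x l ih =>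
    intro σ p h3 h13 h18 hW hd
    simp only [List.length_cons] at h18 hW
    have hx : σ.mem p = x := hd 0 (by simp)
    set σ₁ := nexecs dat sc [.bin .lt 16 13 18] σ with hσ₁
    have hA : Ex dat sc W (.blk [.bin .lt 16 13 18]) σ 1 σ₁ :=
      Ex.blk _ _ (by simp [Oks, Instr.Ok])
    have h₁ : σ₁.reg 16 ≠ 0 := by simp [hσ₁, nexecs, nexec, BinOp.nat, h13, h18]
    have g3 : σ₁.reg 3 = 1 := by simp [hσ₁, nexecs, nexec, h3]
    have g13 : σ₁.reg 13 = p := by simp [hσ₁, nexecs, nexec, h13]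
    have g18 : σ₁.reg 18 = p + (l.length + 1) := by simp [hσ₁, nexecs, nexec, h18]
    have gm : σ₁.mem = σ.mem := by simp [hσ₁, nexecs, nexec]
    have go : σ₁.out = σ.out := by simp [hσ₁, nexecs, nexec]
    set blk : List Instr := [.load 12 13, .emit 12, .bin .add 13 13 3]
    set σ₂ := nexecs dat sc blk σ₁ with hσ₂
    have hB : Ex dat sc W (.blk blk) σ₁ 3 σ₂ := by
      refine Ex.blk _ _ ?_
      simp [blk, Oks, Instr.Ok, nexec, g3, g13]
      omega
    obtain ⟨t, σ₃, hC, ht, hout⟩ := ih σ₂ (p + 1)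
      (by simp [hσ₂, blk, nexecs, nexec, g3])
      (by simp [hσ₂, blk, nexecs, nexec, g13, g3, BinOp.nat])
      (by simp [hσ₂, blk, nexecs, nexec, g18]; omega)
      (by omega)
      (fun i hi => by
        have := hd (i + 1) (by simpa using hi)
        simp only [hσ₂, blk, nexecs, nexec, gm]
        rw [show p + 1 + i = p + (i + 1) by omega, this]
        simp)
    refine ⟨_, σ₃, Ex.loop_step hA h₁ hB hC, ?_, ?_⟩
    · simp only [List.length_cons]; omega
    · rw [hout]
      simp [hσ₂, blk, nexecs, nexec, g13, gm, go, hx, show p < sc by omega]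

theorem emitDown_spec (l : List ℕ) : ∀ (σ : NS) (p : ℕ), σ.reg 3 = 1 →
    σ.reg 27 = p → σ.reg 13 = p + l.length → p + l.length ≤ sc →
    (∀ i (hi : i < l.length), σ.mem (p + i) = l[i]) →
    ∃ t σ', Ex dat sc W emitDownCmd σ t σ' ∧ t ≤ 6 * l.length + 2 ∧
      σ'.out = σ.out ++ l.reverse := by
  induction l using List.reverseRecOn with
  | nil =>
    intro σ p h3 h13 h14 hW hd
    refine ⟨_, _, Ex.loop_done (Ex.blk _ _ ?_) ?_, ?_, ?_⟩
    · simp [Oks, Instr.Ok]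
    · simp [nexecs, nexec, BinOp.nat, h13, h14]
    · simp
    · simp [nexecs, nexec]
  | append_singleton l x ih =>
    intro σ p h3 h27 h13 hW hd
    simp only [List.length_append, List.length_singleton] at h13 hW
    have hx : σ.mem (p + l.length) = x := by simpa using hd l.length (by simp)
    set σ₁ := nexecs dat sc [.bin .lt 16 27 13] σ with hσ₁
    have hA : Ex dat sc W (.blk [.bin .lt 16 27 13]) σ 1 σ₁ :=
      Ex.blk _ _ (by simp [Oks, Instr.Ok])
    have h₁ : σ₁.reg 16 ≠ 0 := by simp [hσ₁, nexecs, nexec, BinOp.nat, h13, h27]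
    have g3 : σ₁.reg 3 = 1 := by simp [hσ₁, nexecs, nexec, h3]
    have g13 : σ₁.reg 13 = p + l.length + 1 := by simp [hσ₁, nexecs, nexec, h13]; omega
    have g27 : σ₁.reg 27 = p := by simp [hσ₁, nexecs, nexec, h27]
    have gm : σ₁.mem = σ.mem := by simp [hσ₁, nexecs, nexec]
    have go : σ₁.out = σ.out := by simp [hσ₁, nexecs, nexec]
    set blk : List Instr := [.bin .sub 13 13 3, .load 12 13, .emit 12]
    set σ₂ := nexecs dat sc blk σ₁ with hσ₂
    have hB : Ex dat sc W (.blk blk) σ₁ 3 σ₂ := by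
      refine Ex.blk _ _ ?_
      simp [blk, Oks, Instr.Ok, g3, g13]
    obtain ⟨t, σ₃, hC, ht, hout⟩ := ih σ₂ p
      (by simp [hσ₂, blk, nexecs, nexec, g3])
      (by simp [hσ₂, blk, nexecs, nexec, g27])
      (by simp [hσ₂, blk, nexecs, nexec, g13, g3, BinOp.nat])
      (by omega)
      (fun i hi => by
        have := hd i (by simp; omega)
        simp only [hσ₂, blk, nexecs, nexec, gm]
        rw [this, List.getElem_append_left hi])
    refine ⟨_, σ₃, Ex.loop_step hA h₁ hB hC, ?_, ?_⟩
    · simp only [List.length_append, List.length_singleton]; omega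
    · rw [hout]
      simp [hσ₂, blk, nexecs, nexec, g13, g3, gm, go, hx, BinOp.nat,
        show p + l.length < sc by omega]

end Specs

/-! ### Reporting a path through a common cluster -/

section SearchSpec

variable {dat : ℕ → ℕ} {sc W : ℕ}

/-- The address, in the directories at `du` and `dv`, of the record of the second vertex in the
home slot which the first vertex has at scale `j`. -/
def slotAddr (dat : ℕ → ℕ) (du dv j : ℕ) : ℕ := dat (dv + 3 * j + 1) + dat (du + 3 * j + 2)

/-- Starting at scale `j = j₀ - r`, the loop stops at the first scale `j₀` at which the labels
agree. -/
theorem scale_spec (hW : 4 < W) {du dv j₀ : ℕ}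
    (hb : ∀ j ≤ j₀, du + 3 * j + 3 < W ∧ dv + 3 * j + 3 < W ∧ slotAddr dat du du j < W ∧
      slotAddr dat du dv j < W)
    (hne : ∀ j < j₀, dat (slotAddr dat du du j) ≠ dat (slotAddr dat du dv j))
    (heq : dat (slotAddr dat du du j₀) = dat (slotAddr dat du dv j₀)) (r : ℕ) :
    ∀ (σ : NS) (j : ℕ), j + r = j₀ → σ.reg 3 = 1 → σ.reg 20 = du + 3 * j →
      σ.reg 21 = dv + 3 * j →
    ∃ t σ', Ex dat sc W scaleCmd σ t σ' ∧ t ≤ 18 * r + 14 ∧ σ'.reg 20 = du + 3 * j₀ ∧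
      σ'.reg 21 = dv + 3 * j₀ ∧ σ'.reg 22 = slotAddr dat du du j₀ ∧
      σ'.reg 23 = slotAddr dat du dv j₀ := by
  induction r with
  | zero =>
    intro σ j hj h3 h20 h21
    obtain rfl : j = j₀ := by omega
    obtain ⟨b1, b2, b3, b4⟩ := hb j le_rfl
    simp only [slotAddr] at heq b3 b4
    refine ⟨_, _, Ex.loop_done (Ex.blk _ _ ?_) ?_, ?_, ?_, ?_, ?_, ?_⟩
    · simp [Oks, Instr.Ok, nexec, BinOp.nat, h20, h21, h3, heq]; omega
    · simp [nexecs, nexec, BinOp.nat, h20, h21, h3, heq]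
    · simp
    · simp [nexecs, nexec, h20]
    · simp [nexecs, nexec, h21]
    · simp [nexecs, nexec, BinOp.nat, h20, h3, slotAddr]
    · simp [nexecs, nexec, BinOp.nat, h20, h21, h3, slotAddr]
  | succ r ih =>
    intro σ j hj h3 h20 h21
    obtain ⟨b1, b2, b3, b4⟩ := hb j (by omega)
    have hn := hne j (by omega)
    simp only [slotAddr] at hn b3 b4
    set blk₁ : List Instr := [.const 7 2, .bin .add 24 20 7, .read 24 24, .bin .add 22 20 3,
      .read 22 22, .bin .add 22 22 24, .bin .add 23 21 3, .read 23 23, .bin .add 23 23 24,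
      .read 16 22, .read 17 23, .bin .eq 16 16 17, .bin .sub 16 3 16]
    set σ₁ := nexecs dat sc blk₁ σ with hσ₁
    have hA : Ex dat sc W (.blk blk₁) σ 13 σ₁ := Ex.blk _ _ (by
      simp [blk₁, Oks, Instr.Ok, nexec, BinOp.nat, h20, h21, h3, hn]; omega)
    have g16 : σ₁.reg 16 ≠ 0 := by
      simp [hσ₁, blk₁, nexecs, nexec, BinOp.nat, h20, h21, h3, hn]
    have g3 : σ₁.reg 3 = 1 := by simp [hσ₁, blk₁, nexecs, nexec, h3]
    have g20 : σ₁.reg 20 = du + 3 * j := by simp [hσ₁, blk₁, nexecs, nexec, h20]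
    have g21 : σ₁.reg 21 = dv + 3 * j := by simp [hσ₁, blk₁, nexecs, nexec, h21]
    set blk₂ : List Instr := [.const 7 3, .bin .add 20 20 7, .bin .add 21 21 7]
    set σ₂ := nexecs dat sc blk₂ σ₁ with hσ₂
    have hB : Ex dat sc W (.blk blk₂) σ₁ 3 σ₂ := Ex.blk _ _ (by
      simp [blk₂, Oks, Instr.Ok, nexec, g20, g21]; omega)
    obtain ⟨t, σ₃, hC, ht, h⟩ := ih σ₂ (j + 1) (by omega)
      (by simp [hσ₂, blk₂, nexecs, nexec, g3])
      (by simp [hσ₂, blk₂, nexecs, nexec, BinOp.nat, g20]; omega)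
      (by simp [hσ₂, blk₂, nexecs, nexec, BinOp.nat, g21]; omega)
    exact ⟨_, σ₃, Ex.loop_step hA g16 hB hC, by omega, h⟩

/-- Running `searchCmd` reports the walk of the first vertex to the common center, followed by the
reversed walk of the second vertex. -/
theorem search_spec (hsc : sc < W) (hW : 8 < W) {n u v du dv j₀ : ℕ} {pu qu pv qv : List ℕ}
    (hun : 8 * u + 8 < W) (hvn : 8 * v + 8 < W)
    (hdu : dat (8 * u + 4) = du) (hdv : dat (8 * v + 4) = dv)
    (hb : ∀ j ≤ j₀, du + 3 * j + 3 < W ∧ dv + 3 * j + 3 < W ∧ slotAddr dat du du j < W ∧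
      slotAddr dat du dv j < W)
    (hne : ∀ j < j₀, dat (slotAddr dat du du j) ≠ dat (slotAddr dat du dv j))
    (heq : dat (slotAddr dat du du j₀) = dat (slotAddr dat du dv j₀))
    (hpu : Chain dat W (dat (du + 3 * j₀)) pu) (hqu : Chain dat W (slotAddr dat du du j₀) qu)
    (hpv : Chain dat W (dat (dv + 3 * j₀)) pv) (hqv : Chain dat W (slotAddr dat du dv j₀) qv)
    (hs : 2 * n + 2 + pu.length + qu.length + pv.length + qv.length ≤ sc)
    {σ : NS} (h0 : σ.reg 0 = u) (h1 : σ.reg 1 = v) (h2 : σ.reg 2 = 0) (h3 : σ.reg 3 = 1)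
    (h4 : σ.reg 4 = n) (h5 : σ.reg 5 = 8 * u) (h6 : σ.reg 6 = 8 * v) :
    ∃ t σ', Ex dat sc W searchCmd σ t σ' ∧
      t ≤ 18 * j₀ + 30 * (pu.length + qu.length + pv.length + qv.length) + 100 ∧
      σ'.out = σ.out ++ ((u :: (pu ++ qu)) ++ (v :: (pv ++ qv)).dropLast.reverse) := by
  have hW4 : 4 < W := by omega
  -- directories
  obtain ⟨σ₁, hσ₁⟩ : ∃ σ₁, σ₁ = nexecs dat sc [.const 7 4, .bin .add 20 5 7, .read 20 20,
    .bin .add 21 6 7, .read 21 21] σ := ⟨_, rfl⟩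
  have e₁ : Ex dat sc W (.blk [.const 7 4, .bin .add 20 5 7, .read 20 20,
      .bin .add 21 6 7, .read 21 21]) σ 5 σ₁ := by
    rw [hσ₁]
    refine Ex.blk _ _ ?_
    simp [Oks, Instr.Ok, nexec, h5, h6]; omega
  have a3 : σ₁.reg 3 = 1 := by rw [e₁.reg_eq (by decide), h3]
  have a20 : σ₁.reg 20 = du := by simp [hσ₁, nexecs, nexec, BinOp.nat, h5, hdu]
  have a21 : σ₁.reg 21 = dv := by simp [hσ₁, nexecs, nexec, BinOp.nat, h6, hdv]
  -- common scale
  obtain ⟨t₂, σ₂, e₂, ht₂, b20, b21, b22, b23⟩ := scale_spec (sc := sc) hW4 hb hne heq j₀ σ₁ 0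
    (by omega) a3 (by omega) (by omega)
  have b0 : σ₂.reg 0 = u := by rw [e₂.reg_eq (by decide), e₁.reg_eq (by decide), h0]
  have b1 : σ₂.reg 1 = v := by rw [e₂.reg_eq (by decide), e₁.reg_eq (by decide), h1]
  have b2 : σ₂.reg 2 = 0 := by rw [e₂.reg_eq (by decide), e₁.reg_eq (by decide), h2]
  have b3 : σ₂.reg 3 = 1 := by rw [e₂.reg_eq (by decide), a3]
  have b4 : σ₂.reg 4 = n := by rw [e₂.reg_eq (by decide), e₁.reg_eq (by decide), h4]
  -- push the second query vertex
  obtain ⟨σ₃, hσ₃⟩ : ∃ σ₃, σ₃ = nexecs dat sc [.bin .add 18 4 4, .store 18 1, .bin .add 18 18 3,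
    .read 19 21] σ₂ := ⟨_, rfl⟩
  have e₃ : Ex dat sc W (.blk [.bin .add 18 4 4, .store 18 1, .bin .add 18 18 3,
    .read 19 21]) σ₂ 4 σ₃ := by
    rw [hσ₃]
    refine Ex.blk _ _ ?_
    simp [Oks, Instr.Ok, nexec, BinOp.nat, b4, b3]; omega
  have c3 : σ₃.reg 3 = 1 := by rw [e₃.reg_eq (by decide), b3]
  have c18 : σ₃.reg 18 = n + n + 1 := by simp [hσ₃, nexecs, nexec, BinOp.nat, b4, b3]
  have c19 : σ₃.reg 19 = dat (dv + 3 * j₀) := by simp [hσ₃, nexecs, nexec, b21]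
  have cm : σ₃.mem = writeList σ₂.mem (n + n) [v] := by
    simp [hσ₃, nexecs, nexec, BinOp.nat, b4, b1, writeList, show n + n < sc by omega]
  -- walk of the second query vertex
  obtain ⟨t₄, σ₄, e₄, ht₄, d18, dm⟩ := follow_spec hsc hW4 hpv σ₃ c3 c19 (by omega)
  have d3 : σ₄.reg 3 = 1 := by rw [e₄.reg_eq (by decide), c3]
  have d2 : σ₄.reg 2 = 0 := by rw [e₄.reg_eq (by decide), e₃.reg_eq (by decide), b2]
  have d23 : σ₄.reg 23 = slotAddr dat du dv j₀ := by
    rw [e₄.reg_eq (by decide), e₃.reg_eq (by decide), b23]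
  obtain ⟨σ₅, hσ₅⟩ : ∃ σ₅, σ₅ = nexecs dat sc [.bin .add 19 23 2] σ₄ := ⟨_, rfl⟩
  have hb₀ := hb j₀ le_rfl
  have e₅ : Ex dat sc W (.blk [.bin .add 19 23 2]) σ₄ 1 σ₅ := by
    rw [hσ₅]
    refine Ex.blk _ _ ?_
    simp [Oks, Instr.Ok, d23, d2]; omega
  obtain ⟨t₆, σ₆, e₆, ht₆, f18, fm⟩ := follow_spec hsc hW4 hqv σ₅
    (by rw [e₅.reg_eq (by decide), d3]) (by simp [hσ₅, nexecs, nexec, BinOp.nat, d23, d2])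
    (by rw [e₅.reg_eq (by decide)]; omega)
  rw [e₅.reg_eq (by decide), d18, c18] at f18
  rw [e₅.reg_eq (by decide), d18, c18, e₅.mem_eq (by decide), dm, c18, cm,
    show n + n + 1 = n + n + [v].length by rfl, ← writeList_append, ← writeList_append] at fm
  have g0 : σ₆.reg 0 = u := by
    rw [e₆.reg_eq (by decide), e₅.reg_eq (by decide), e₄.reg_eq (by decide),
      e₃.reg_eq (by decide), b0]
  have g2 : σ₆.reg 2 = 0 := by rw [e₆.reg_eq (by decide), e₅.reg_eq (by decide), d2]
  have g3 : σ₆.reg 3 = 1 := by rw [e₆.reg_eq (by decide), e₅.reg_eq (by decide), d3]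
  have g4 : σ₆.reg 4 = n := by
    rw [e₆.reg_eq (by decide), e₅.reg_eq (by decide), e₄.reg_eq (by decide),
      e₃.reg_eq (by decide), b4]
  have g20 : σ₆.reg 20 = du + 3 * j₀ := by
    rw [e₆.reg_eq (by decide), e₅.reg_eq (by decide), e₄.reg_eq (by decide),
      e₃.reg_eq (by decide), b20]
  have g22 : σ₆.reg 22 = slotAddr dat du du j₀ := by
    rw [e₆.reg_eq (by decide), e₅.reg_eq (by decide), e₄.reg_eq (by decide),
      e₃.reg_eq (by decide), b22]
  set lv := [v] ++ (pv ++ qv) with hlv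
  have hlvlen : lv.length = 1 + pv.length + qv.length := by simp [hlv]; omega
  have f18' : σ₆.reg 18 = n + n + lv.length := by omega
  -- push the first query vertex
  obtain ⟨σ₇, hσ₇⟩ : ∃ σ₇, σ₇ = nexecs dat sc [.bin .add 26 18 2, .store 18 0, .bin .add 18 18 3,
    .read 19 20] σ₆ := ⟨_, rfl⟩
  have e₇ : Ex dat sc W (.blk [.bin .add 26 18 2, .store 18 0, .bin .add 18 18 3,
    .read 19 20]) σ₆ 4 σ₇ := by
    rw [hσ₇]
    refine Ex.blk _ _ ?_
    simp [Oks, Instr.Ok, nexec, f18', g3, g2]; omega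
  have k18 : σ₇.reg 18 = n + n + lv.length + 1 := by
    simp [hσ₇, nexecs, nexec, BinOp.nat, f18', g3]
  have k26 : σ₇.reg 26 = n + n + lv.length := by
    simp [hσ₇, nexecs, nexec, BinOp.nat, f18', g2]
  have k19 : σ₇.reg 19 = dat (du + 3 * j₀) := by simp [hσ₇, nexecs, nexec, g20]
  have km : σ₇.mem = writeList σ₂.mem (n + n) (lv ++ [u]) := by
    rw [writeList_append, ← fm]
    simp [hσ₇, nexecs, nexec, f18', g0, writeList,
      show n + n + lv.length < sc by omega]
  have k2 : σ₇.reg 2 = 0 := by rw [e₇.reg_eq (by decide), g2]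
  have k3 : σ₇.reg 3 = 1 := by rw [e₇.reg_eq (by decide), g3]
  -- walk of the first query vertex
  obtain ⟨t₈, σ₈, e₈, ht₈, l18, lm⟩ := follow_spec hsc hW4 hpu σ₇ k3 k19 (by omega)
  have l22 : σ₈.reg 22 = slotAddr dat du du j₀ := by
    rw [e₈.reg_eq (by decide), e₇.reg_eq (by decide), g22]
  have l2 : σ₈.reg 2 = 0 := by rw [e₈.reg_eq (by decide), k2]
  obtain ⟨σ₉, hσ₉⟩ : ∃ σ₉, σ₉ = nexecs dat sc [.bin .add 19 22 2] σ₈ := ⟨_, rfl⟩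
  have e₉ : Ex dat sc W (.blk [.bin .add 19 22 2]) σ₈ 1 σ₉ := by
    rw [hσ₉]
    refine Ex.blk _ _ ?_
    simp [Oks, Instr.Ok, l22, l2]; omega
  obtain ⟨t₁₀, σ₁₀, e₁₀, ht₁₀, m18, mm⟩ := follow_spec hsc hW4 hqu σ₉
    (by rw [e₉.reg_eq (by decide), e₈.reg_eq (by decide), k3])
    (by simp [hσ₉, nexecs, nexec, BinOp.nat, l22, l2])
    (by rw [e₉.reg_eq (by decide)]; omega)
  rw [e₉.reg_eq (by decide), l18, k18] at m18
  rw [e₉.reg_eq (by decide), l18, k18, e₉.mem_eq (by decide), lm, k18, km,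
    show n + n + lv.length + 1 = n + n + (lv ++ [u]).length by simp; omega, ← writeList_append,
    ← writeList_append] at mm
  have m3 : σ₁₀.reg 3 = 1 := by
    rw [e₁₀.reg_eq (by decide), e₉.reg_eq (by decide), e₈.reg_eq (by decide), k3]
  have m2 : σ₁₀.reg 2 = 0 := by
    rw [e₁₀.reg_eq (by decide), e₉.reg_eq (by decide), l2]
  have m4 : σ₁₀.reg 4 = n := by
    rw [e₁₀.reg_eq (by decide), e₉.reg_eq (by decide), e₈.reg_eq (by decide),
      e₇.reg_eq (by decide), g4]
  have m26 : σ₁₀.reg 26 = n + n + lv.length := by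
    rw [e₁₀.reg_eq (by decide), e₉.reg_eq (by decide), e₈.reg_eq (by decide), k26]
  have mout : σ₁₀.out = σ.out := by
    rw [e₁₀.out_eq (by decide), e₉.out_eq (by decide), e₈.out_eq (by decide),
      e₇.out_eq (by decide), e₆.out_eq (by decide), e₅.out_eq (by decide),
      e₄.out_eq (by decide), e₃.out_eq (by decide), e₂.out_eq (by decide), e₁.out_eq (by decide)]
  set lu := u :: (pu ++ qu) with hlu
  have hlulen : lu.length = 1 + pu.length + qu.length := by simp [hlu]; omega
  have hall : lv ++ [u] ++ (pu ++ qu) = lv ++ lu := by simp [hlu]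
  rw [hall] at mm
  -- output of the walk of the first vertex
  obtain ⟨σ₁₁, hσ₁₁⟩ : ∃ σ₁₁, σ₁₁ = nexecs dat sc [.bin .add 13 26 2] σ₁₀ := ⟨_, rfl⟩
  have e₁₁ : Ex dat sc W (.blk [.bin .add 13 26 2]) σ₁₀ 1 σ₁₁ := by
    rw [hσ₁₁]
    refine Ex.blk _ _ ?_
    simp [Oks, Instr.Ok, m26, m2]; omega
  obtain ⟨t₁₂, σ₁₂, e₁₂, ht₁₂, out₁₂⟩ := emitUp_spec (dat := dat) hsc lu σ₁₁ (n + n + lv.length)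
    (by rw [e₁₁.reg_eq (by decide), m3]) (by simp [hσ₁₁, nexecs, nexec, BinOp.nat, m26, m2])
    (by rw [e₁₁.reg_eq (by decide), m18]; omega) (by omega)
    (fun i hi => by
      rw [e₁₁.mem_eq (by decide), mm, writeList_append, writeList_getElem])
  -- output of the reversed walk of the second vertex, without the center
  obtain ⟨σ₁₃, hσ₁₃⟩ : ∃ σ₁₃, σ₁₃ = nexecs dat sc [.bin .add 27 4 4, .bin .sub 13 26 3] σ₁₂ :=
    ⟨_, rfl⟩
  have n3 : σ₁₂.reg 3 = 1 := by rw [e₁₂.reg_eq (by decide), e₁₁.reg_eq (by decide), m3]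
  have n4 : σ₁₂.reg 4 = n := by rw [e₁₂.reg_eq (by decide), e₁₁.reg_eq (by decide), m4]
  have n26 : σ₁₂.reg 26 = n + n + lv.length := by
    rw [e₁₂.reg_eq (by decide), e₁₁.reg_eq (by decide), m26]
  have e₁₃ : Ex dat sc W (.blk [.bin .add 27 4 4, .bin .sub 13 26 3]) σ₁₂ 2 σ₁₃ := by
    rw [hσ₁₃]
    refine Ex.blk _ _ ?_
    simp [Oks, Instr.Ok, nexec, n26, n4, n3]; omega
  have hdl : lv.dropLast.length = lv.length - 1 := by simp
  obtain ⟨t₁₄, σ₁₄, e₁₄, ht₁₄, out₁₄⟩ := emitDown_spec (dat := dat) (sc := sc) (W := W)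
    lv.dropLast σ₁₃ (n + n)
    (by rw [e₁₃.reg_eq (by decide), n3]) (by simp [hσ₁₃, nexecs, nexec, BinOp.nat, n4])
    (by simp [hσ₁₃, nexecs, nexec, BinOp.nat, n26, n3]; omega) (by omega)
    (fun i hi => by
      rw [e₁₃.mem_eq (by decide), e₁₂.mem_eq (by decide), e₁₁.mem_eq (by decide), mm,
        writeList_getElem _ _ _ (by simp; omega), List.getElem_append_left (by omega)]
      simp)
  refine ⟨_, σ₁₄, Ex.seq e₁ (Ex.seq e₂ (Ex.seq e₃ (Ex.seq e₄ (Ex.seq e₅ (Ex.seq e₆ (Ex.seq e₇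
    (Ex.seq e₈ (Ex.seq e₉ (Ex.seq e₁₀ (Ex.seq e₁₁ (Ex.seq e₁₂ (Ex.seq e₁₃ e₁₄)))))))))))), ?_, ?_⟩
  · omega
  · rw [out₁₄, e₁₃.out_eq (by decide), out₁₂, e₁₁.out_eq (by decide), mout]
    simp [hlv]

end SearchSpec

/-! ### Breadth-first search -/

section BFS

variable {V : Type*} {H : SimpleGraph V} {v : V}

/-- Invariant of breadth-first search from `v`: `Q` lists the vertices found so far in the order of
their discovery, `par` gives their parents, and the first `h` vertices have been processed. -/
structure BFSInv (H : SimpleGraph V) (v : V) (Q : List V) (par : V → V) (h : ℕ) : Prop where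
  root : Q[0]? = some v
  nodup : Q.Nodup
  reach : ∀ x ∈ Q, H.Reachable v x
  mono : ∀ (i j : ℕ) (x y : V), i ≤ j → Q[i]? = some x → Q[j]? = some y → H.dist v x ≤ H.dist v y
  near : ∀ z ∈ Q, ∀ x, Q[h]? = some x → H.dist v z ≤ H.dist v x + 1
  parent : ∀ x ∈ Q, x ≠ v → par x ∈ Q ∧ H.Adj x (par x) ∧ H.dist v x = H.dist v (par x) + 1
  closed : ∀ i < h, ∀ x : V, Q[i]? = some x → ∀ y, H.Adj x y → y ∈ Q
  le : h ≤ Q.length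

theorem BFSInv.init : BFSInv H v [v] id 0 where
  root := rfl
  nodup := List.nodup_singleton v
  reach := by simp
  mono := by
    intro i j x y hij hx hy
    have hi := List.mem_of_getElem? hx
    have hj := List.mem_of_getElem? hy
    simp only [List.mem_singleton] at hi hj
    rw [hi, hj]
  near := by simp
  parent := by simp
  closed := by simp
  le := by simp

/-- A vertex at distance `d + 1` has a neighbour at distance `d`. -/
theorem exists_adj_dist {y : V} {d : ℕ} (hr : H.Reachable v y) (hd : H.dist v y = d + 1) :
    ∃ z, H.Adj z y ∧ H.Reachable v z ∧ H.dist v z = d := by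
  obtain ⟨p, hp⟩ := hr.symm.exists_walk_length_eq_dist
  rw [SimpleGraph.dist_comm, hd] at hp
  cases p with
  | nil => simp at hp
  | @cons _ z _ h q =>
    simp only [SimpleGraph.Walk.length_cons, Nat.add_right_cancel_iff] at hp
    refine ⟨z, h.symm, q.reachable.symm, le_antisymm ?_ ?_⟩
    · rw [SimpleGraph.dist_comm, ← hp]
      exact SimpleGraph.dist_le q
    · have h2 := hr.dist_triangle_left
      have h1 : H.dist v y ≤ H.dist v z + H.dist z y :=
        q.reachable.symm.dist_triangle_left y
      rw [SimpleGraph.dist_eq_one_iff_adj.mpr h.symm, hd] at h1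
      omega

variable {Q : List V} {par : V → V} {h : ℕ}

theorem BFSInv.root_mem (I : BFSInv H v Q par h) : v ∈ Q := List.mem_of_getElem? I.root

/-- All vertices that are not farther than the head of the queue have been found. -/
theorem BFSInv.complete (I : BFSInv H v Q par h) {x : V} (hx : Q[h]? = some x) :
    ∀ (d : ℕ) (y : V), H.Reachable v y → H.dist v y = d → d ≤ H.dist v x → y ∈ Q := by
  intro d
  induction d with
  | zero =>
    intro y hy hd _
    rw [hy.dist_eq_zero_iff] at hd
    exact hd ▸ I.root_mem
  | succ d ih =>
    intro y hy hd hle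
    obtain ⟨z, hzy, hz, hzd⟩ := exists_adj_dist hy hd
    have hzQ := ih z hz hzd (by omega)
    obtain ⟨i, hi⟩ := List.getElem?_of_mem hzQ
    have hih : i < h := by
      by_contra hcon
      have := I.mono h i x z (by omega) hx hi
      omega
    exact I.closed i hih z hi y hzy

theorem BFSInv.complete_of_length (I : BFSInv H v Q par Q.length) {y : V}
    (hy : H.Reachable v y) : y ∈ Q := by
  obtain ⟨p⟩ := hy.symm
  induction p with
  | nil => exact I.root_mem
  | @cons a b _ hadj q ih =>
    obtain ⟨i, hi⟩ := List.getElem?_of_mem (ih I q.reachable.symm)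
    have hlt : i < Q.length := by
      by_contra hcon
      rw [List.getElem?_eq_none (by omega)] at hi
      simp at hi
    exact I.closed i hlt _ hi _ hadj.symm

theorem BFSInv.push [DecidableEq V] (I : BFSInv H v Q par h) {x y : V} (hx : Q[h]? = some x)
    (hxy : H.Adj x y)
    (hy : y ∉ Q) : BFSInv H v (Q ++ [y]) (Function.update par y x) h := by
  have hxQ := List.mem_of_getElem? hx
  have hry : H.Reachable v y := (I.reach x hxQ).trans hxy.reachable
  have h1 : ¬ H.dist v y ≤ H.dist v x := fun hle => hy (I.complete hx _ y hry rfl hle)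
  have h2 : H.dist v y ≤ H.dist v x + H.dist x y := (I.reach x hxQ).dist_triangle_left y
  rw [SimpleGraph.dist_eq_one_iff_adj.mpr hxy] at h2
  have hd : H.dist v y = H.dist v x + 1 := by omega
  have hlt : h < Q.length := (List.getElem?_eq_some_iff.mp hx).1
  have hget : ∀ i z, (Q ++ [y])[i]? = some z →
      Q[i]? = some z ∨ (i = Q.length ∧ z = y) := by
    intro i z hi
    rcases lt_trichotomy i Q.length with hl | hl | hl
    · left; rwa [List.getElem?_append_left hl] at hi
    · right; subst hl; simp at hi; exact ⟨rfl, hi.symm⟩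
    · rw [List.getElem?_eq_none (by simp; omega)] at hi; simp at hi
  have hgh : ∀ z, (Q ++ [y])[h]? = some z → z = x := by
    intro z hz
    rw [List.getElem?_append_left hlt, hx] at hz
    exact (Option.some.inj hz).symm
  refine ⟨?_, ?_, ?_, ?_, ?_, ?_, ?_, ?_⟩
  · rw [List.getElem?_append_left (by omega), I.root]
  · exact List.nodup_append.mpr ⟨I.nodup, by simp, by
      intro a ha b hb
      rw [List.mem_singleton] at hb
      rintro rfl
      exact hy (hb ▸ ha)⟩
  · intro z hz
    rcases List.mem_append.mp hz with hz | hz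
    · exact I.reach z hz
    · rw [List.mem_singleton] at hz
      exact hz ▸ hry
  · intro i j a b hij ha hb
    rcases hget i a ha with ha' | ⟨hi', hay⟩ <;> rcases hget j b hb with hb' | ⟨hj', hby⟩
    · exact I.mono i j a b hij ha' hb'
    · rw [hby, hd]
      exact I.near a (List.mem_of_getElem? ha') x hx
    · have := (List.getElem?_eq_some_iff.mp hb').1
      omega
    · rw [hay, hby]
  · intro z hz a ha
    rw [hgh a ha]
    rcases List.mem_append.mp hz with hz | hz
    · exact I.near z hz x hx
    · rw [List.mem_singleton] at hz
      rw [hz, hd]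
  · intro z hz hzv
    by_cases hzy : z = y
    · subst hzy
      rw [Function.update_self]
      exact ⟨List.mem_append_left _ hxQ, hxy.symm, hd⟩
    · rw [Function.update_of_ne hzy]
      have hzQ : z ∈ Q := by
        rcases List.mem_append.mp hz with hz | hz
        · exact hz
        · exact absurd (List.mem_singleton.mp hz) hzy
      obtain ⟨a, b, c⟩ := I.parent z hzQ hzv
      exact ⟨List.mem_append_left _ a, b, c⟩
  · intro i hi a ha b hab
    rcases hget i a ha with ha | ⟨rfl, rfl⟩
    · exact List.mem_append_left _ (I.closed i hi a ha b hab)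
    · omega
  · simp only [List.length_append, List.length_singleton]
    omega

theorem BFSInv.next (I : BFSInv H v Q par h) {x : V} (hx : Q[h]? = some x)
    (hcl : ∀ y, H.Adj x y → y ∈ Q) : BFSInv H v Q par (h + 1) := by
  refine ⟨I.root, I.nodup, I.reach, I.mono, ?_, I.parent, ?_, ?_⟩
  · intro z hz y hy
    have h1 := I.near z hz x hx
    have h2 := I.mono h (h + 1) x y (by omega) hx hy
    omega
  · intro i hi a ha b hab
    rcases Nat.lt_succ_iff_lt_or_eq.mp hi with hi | rfl
    · exact I.closed i hi a ha b hab
    · rw [hx] at ha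
      exact hcl b (Option.some.inj ha ▸ hab)
  · exact (List.getElem?_eq_some_iff.mp hx).1

variable [DecidableEq V] {K : Finset V} {R : ℕ}

/-- As long as fewer vertices than the ball `K` of radius `R - 1` has are processed, the head of the
queue exists and lies in the ball. -/
theorem BFSInv.head_mem (I : BFSInv H v Q par h)
    (hK : ∀ x, x ∈ K ↔ H.Reachable v x ∧ H.dist v x < R) (hh : h < K.card) :
    ∃ x, Q[h]? = some x ∧ x ∈ K := by
  rcases I.le.lt_or_eq with hlt | heq
  · refine ⟨Q[h], List.getElem?_eq_getElem hlt, ?_⟩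
    by_contra hnot
    have hget : Q[h]? = some Q[h] := List.getElem?_eq_getElem hlt
    have hfar : R ≤ H.dist v Q[h] := by
      rw [hK] at hnot
      by_contra hcon
      exact hnot ⟨I.reach _ (List.getElem_mem hlt), by omega⟩
    have hsub : K ⊆ (Q.take h).toFinset := by
      intro y hy
      rw [hK] at hy
      have hyQ := I.complete hget _ y hy.1 rfl (by omega)
      obtain ⟨i, hi⟩ := List.getElem?_of_mem hyQ
      have hih : i < h := by
        by_contra hcon
        have := I.mono h i _ y (by omega) hget hi
        omega
      rw [List.mem_toFinset]
      refine List.mem_of_getElem? (i := i) ?_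
      rw [List.getElem?_take, if_pos hih, hi]
    have h1 := Finset.card_le_card hsub
    have h2 := List.toFinset_card_le (Q.take h)
    rw [List.length_take] at h2
    omega
  · subst heq
    have hsub : K ⊆ Q.toFinset := by
      intro y hy
      rw [List.mem_toFinset]
      exact I.complete_of_length ((hK y).mp hy).1
    have h1 := Finset.card_le_card hsub
    have h2 := List.toFinset_card_le Q
    omega

/-- After processing as many vertices as the ball of radius `R - 1` has, all vertices up to distance
`R` have been found. -/
theorem BFSInv.mem_of_dist_le (I : BFSInv H v Q par K.card)
    (hK : ∀ x, x ∈ K ↔ H.Reachable v x ∧ H.dist v x < R) {y : V} (hy : H.Reachable v y)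
    (hd : H.dist v y ≤ R) : y ∈ Q := by
  rcases I.le.lt_or_eq with hlt | heq
  · have hget : Q[K.card]? = some Q[K.card] := List.getElem?_eq_getElem hlt
    by_contra hnot
    have hfar : ¬ H.dist v y ≤ H.dist v Q[K.card] :=
      fun hle => hnot (I.complete hget _ y hy rfl hle)
    have hsub : (Q.take (K.card + 1)).toFinset ⊆ K := by
      intro z hz
      rw [List.mem_toFinset] at hz
      have hzQ := List.mem_of_mem_take hz
      obtain ⟨i, hi⟩ := List.getElem?_of_mem hz
      rw [List.getElem?_take] at hi
      split_ifs at hi with hlt'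
      have := I.mono i K.card z _ (by omega) hi hget
      exact (hK z).mpr ⟨I.reach z hzQ, by omega⟩
    have h1 := Finset.card_le_card hsub
    rw [List.toFinset_card_of_nodup (I.nodup.sublist (List.take_sublist _ _)),
      List.length_take] at h1
    omega
  · rw [heq] at I
    exact I.complete_of_length hy

end BFS

section BFSSpec

variable {dat : ℕ → ℕ} {sc W n : ℕ} {H : SimpleGraph (Fin n)} {v : Fin n}

/-- The working memory represents a state of breadth-first search. Parents are stored plus one, so
that `0` marks the vertices which have not been found. -/
structure BFSRep (m : ℕ → ℕ) (Q : List (Fin n)) (par : Fin n → Fin n) : Prop where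
  queue : ∀ (i : ℕ) (x : Fin n), Q[i]? = some x → m (n + i) = x
  unseen : ∀ x : Fin n, x ∉ Q → m x = 0
  seen : ∀ x ∈ Q, m x = par x + 1

theorem BFSRep.push {m : ℕ → ℕ} {Q : List (Fin n)} {par : Fin n → Fin n} (h : BFSRep m Q par)
    {x y : Fin n} (hy : y ∉ Q) :
    BFSRep (Function.update (Function.update m y (x + 1)) (n + Q.length) y) (Q ++ [y])
      (Function.update par y x) where
  queue := by
    intro i z hi
    rcases lt_trichotomy i Q.length with hl | hl | hl
    · rw [List.getElem?_append_left hl] at hi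
      rw [Function.update_of_ne (by omega), Function.update_of_ne (by omega), h.queue i z hi]
    · subst hl
      simp at hi
      rw [Function.update_self, hi]
    · rw [List.getElem?_eq_none (by simp; omega)] at hi; simp at hi
  unseen := by
    intro z hz
    simp only [List.mem_append, List.mem_singleton, not_or] at hz
    rw [Function.update_of_ne (by omega),
      Function.update_of_ne (fun hc => hz.2 (Fin.ext hc)), h.unseen z hz.1]
  seen := by
    intro z hz
    rw [Function.update_of_ne (by omega)]
    by_cases hzy : z = y
    · subst hzy
      rw [Function.update_self, Function.update_self]
    · rw [Function.update_of_ne (fun hc => hzy (Fin.ext hc)), Function.update_of_ne hzy]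
      rcases List.mem_append.mp hz with hz | hz
      · exact h.seen z hz
      · exact absurd (List.mem_singleton.mp hz) hzy

theorem scan_spec (hsc : 2 * n ≤ sc) (hscW : sc < W) {h : ℕ} {x : Fin n} (l : List (Fin n)) :
    ∀ (σ : NS) (p : ℕ) (Q : List (Fin n)) (par : Fin n → Fin n), BFSInv H v Q par h →
    BFSRep σ.mem Q par → Q[h]? = some x → (∀ y ∈ l, H.Adj x y) →
    σ.reg 2 = 0 → σ.reg 3 = 1 → σ.reg 10 = n + Q.length → σ.reg 12 = x → σ.reg 13 = p →
    σ.reg 14 = p + l.length → p + l.length < W →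
    (∀ i (hi : i < l.length), dat (p + i) = (l[i] : ℕ)) →
    ∃ t σ' Q' par', Ex dat sc W scanCmd σ t σ' ∧ t ≤ 13 * l.length + 2 ∧ BFSInv H v Q' par' h ∧
      BFSRep σ'.mem Q' par' ∧ σ'.reg 10 = n + Q'.length ∧ Q <+: Q' ∧ ∀ y ∈ l, y ∈ Q' := by
  induction l with
  | nil =>
    intro σ p Q par I hrep hx hl h2 h3 h10 h12 h13 h14 hW hd
    refine ⟨_, _, Q, par, Ex.loop_done (Ex.blk _ _ ?_) ?_, ?_, I, ?_, ?_, List.prefix_rfl, ?_⟩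
    · simp [Oks, Instr.Ok]
    · simp [nexecs, nexec, BinOp.nat, h13, h14]
    · simp
    · simpa [nexecs, nexec] using hrep
    · simp [nexecs, nexec, h10]
    · simp
  | cons y l ih =>
    intro σ p Q par I hrep hx hl h2 h3 h10 h12 h13 h14 hW hd
    simp only [List.length_cons] at h14 hW
    have hy : dat p = y := hd 0 (by simp)
    have hxy : H.Adj x y := hl y (by simp)
    have hyn := y.isLt
    have hxn := x.isLt
    obtain ⟨σ₁, hσ₁⟩ : ∃ σ₁, σ₁ = nexecs dat sc [.bin .lt 16 13 14] σ := ⟨_, rfl⟩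
    have hA : Ex dat sc W (.blk [.bin .lt 16 13 14]) σ 1 σ₁ := by
      rw [hσ₁]; exact Ex.blk _ _ (by simp [Oks, Instr.Ok])
    have h₁ : σ₁.reg 16 ≠ 0 := by simp [hσ₁, nexecs, nexec, BinOp.nat, h13, h14]
    have g : ∀ r, r ≠ 16 → σ₁.reg r = σ.reg r := by
      intro r hr
      rw [hA.reg_eq (by simpa [Cmd.writes, Instr.target] using hr)]
    have gm : σ₁.mem = σ.mem := hA.mem_eq (by decide)
    obtain ⟨σ₂, hσ₂⟩ : ∃ σ₂, σ₂ = nexecs dat sc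
      [.read 15 13, .bin .add 13 13 3, .load 17 15, .bin .eq 17 17 2] σ₁ := ⟨_, rfl⟩
    have hB : Ex dat sc W (.blk [.read 15 13, .bin .add 13 13 3, .load 17 15, .bin .eq 17 17 2])
        σ₁ 4 σ₂ := by
      rw [hσ₂]
      refine Ex.blk _ _ ?_
      simp [Oks, Instr.Ok, nexec, g, h3, h13]
      omega
    have k15 : σ₂.reg 15 = y := by simp [hσ₂, nexecs, nexec, g, h13, hy]
    have k13 : σ₂.reg 13 = p + 1 := by simp [hσ₂, nexecs, nexec, BinOp.nat, g, h13, h3]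
    have k17 : σ₂.reg 17 = if σ.mem y = 0 then 1 else 0 := by
      simp [hσ₂, nexecs, nexec, BinOp.nat, g, h13, hy, h2, gm, show (y : ℕ) < sc by omega]
    have km : σ₂.mem = σ.mem := by rw [hB.mem_eq (by decide), gm]
    have k : ∀ r, r ∉ [15, 13, 17, 16] → σ₂.reg r = σ.reg r := by
      intro r hr
      rw [hB.reg_eq (by simp [Cmd.writes, Instr.target] at hr ⊢; tauto), g r (by
        simp at hr; tauto)]
    by_cases hyQ : y ∈ Q
    · have hm : σ.mem y ≠ 0 := by rw [hrep.seen y hyQ]; omega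
      rw [if_neg hm] at k17
      have hC : Ex dat sc W (.ite 17 (.blk [.bin .add 8 12 3, .store 15 8, .store 10 15,
          .bin .add 10 10 3]) (.blk [])) σ₂ 1 σ₂ := Ex.ite_false k17 (Ex.blk [] σ₂ trivial)
      obtain ⟨t, σ₃, Q', par', hD, ht, I', hrep', h10', hpre, hall⟩ := ih σ₂ (p + 1) Q par I
        (km ▸ hrep) hx (fun z hz => hl z (by simp [hz])) (by rw [k 2 (by decide), h2])
        (by rw [k 3 (by decide), h3]) (by rw [k 10 (by decide), h10])
        (by rw [k 12 (by decide), h12]) k13 (by rw [k 14 (by decide), h14]; omega) (by omega)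
        (fun i hi => by
          rw [show p + 1 + i = p + (i + 1) by omega, hd (i + 1) (by simpa using hi)]; simp)
      refine ⟨_, σ₃, Q', par', Ex.loop_step hA h₁ (Ex.seq hB hC) hD, ?_, I', hrep', h10', hpre, ?_⟩
      · simp only [List.length_cons]; omega
      · intro z hz
        rcases List.mem_cons.mp hz with rfl | hz
        · exact hpre.subset hyQ
        · exact hall z hz
    · rw [if_pos (hrep.unseen y hyQ)] at k17
      have I₁ := I.push hx hxy hyQ
      have hlen : Q.length < n := by
        have := I₁.nodup.length_le_card
        simpa using this
      have hlt : h < Q.length := (List.getElem?_eq_some_iff.mp hx).1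
      have k3 : σ₂.reg 3 = 1 := by rw [k 3 (by decide), h3]
      have k10 : σ₂.reg 10 = n + Q.length := by rw [k 10 (by decide), h10]
      have k12 : σ₂.reg 12 = x := by rw [k 12 (by decide), h12]
      obtain ⟨σ₃, hσ₃⟩ : ∃ σ₃, σ₃ = nexecs dat sc
        [.bin .add 8 12 3, .store 15 8, .store 10 15, .bin .add 10 10 3] σ₂ := ⟨_, rfl⟩
      have hC₀ : Ex dat sc W (.blk [.bin .add 8 12 3, .store 15 8, .store 10 15,
          .bin .add 10 10 3]) σ₂ 4 σ₃ := by
        rw [hσ₃]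
        refine Ex.blk _ _ ?_
        simp [Oks, Instr.Ok, nexec, k3, k12, k10]
        omega
      have hC : Ex dat sc W (.ite 17 (.blk [.bin .add 8 12 3, .store 15 8, .store 10 15,
          .bin .add 10 10 3]) (.blk [])) σ₂ 6 σ₃ := Ex.ite_true (by rw [k17]; simp) hC₀
      have q : ∀ r, r ∉ [8, 10] → σ₃.reg r = σ₂.reg r := by
        intro r hr
        rw [hC₀.reg_eq (by simp [Cmd.writes, Instr.target] at hr ⊢; tauto)]
      have q10 : σ₃.reg 10 = n + (Q ++ [y]).length := by
        simp [hσ₃, nexecs, nexec, BinOp.nat, k10, k3]; omega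
      have qm : σ₃.mem =
          Function.update (Function.update σ.mem y (x + 1)) (n + Q.length) y := by
        simp [hσ₃, nexecs, nexec, BinOp.nat, k10, k3, k12, k15, km,
          show (y : ℕ) < sc by omega, show n + Q.length < sc by omega]
      obtain ⟨t, σ₄, Q', par', hD, ht, I', hrep', h10', hpre, hall⟩ := ih σ₃ (p + 1) (Q ++ [y])
        _ I₁ (qm ▸ hrep.push hyQ) (by rw [List.getElem?_append_left hlt, hx])
        (fun z hz => hl z (by simp [hz])) (by rw [q 2 (by decide), k 2 (by decide), h2])
        (by rw [q 3 (by decide), k3]) q10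
        (by rw [q 12 (by decide), k12]) (by rw [q 13 (by decide), k13])
        (by rw [q 14 (by decide), k 14 (by decide), h14]; omega) (by omega)
        (fun i hi => by
          rw [show p + 1 + i = p + (i + 1) by omega, hd (i + 1) (by simpa using hi)]; simp)
      refine ⟨_, σ₄, Q', par', Ex.loop_step hA h₁ (Ex.seq hB hC) hD, ?_, I', hrep', h10',
        (List.prefix_append _ _).trans hpre, ?_⟩
      · simp only [List.length_cons]; omega
      · intro z hz
        rcases List.mem_cons.mp hz with rfl | hz
        · exact hpre.subset (by simp)
        · exact hall z hz

end BFSSpec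

/-! ### Correctness of queries -/

section QuerySpec

variable {dat : ℕ → ℕ} {sc W n : ℕ} {H : SimpleGraph (Fin n)} {v : Fin n}

/-- The part of the table which describes the graph `H`. The record of vertex `x` starts at address
`8 * x` and contains the name `comp x` of the component, the number `cnt x` of vertices which a
search from `x` processes, the bounds of the adjacency list, the address `dir x` of the directory
of scales, and the number of vertices. -/
structure GraphLayout (H : SimpleGraph (Fin n)) (dat : ℕ → ℕ) (W : ℕ) (comp cnt : Fin n → ℕ)
    (adj : Fin n → List (Fin n)) (adr dir : Fin n → ℕ) : Prop where
  comp : ∀ x : Fin n, dat (8 * x) = comp x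
  cnt : ∀ x : Fin n, dat (8 * x + 1) = cnt x
  lo : ∀ x : Fin n, dat (8 * x + 2) = adr x
  hi : ∀ x : Fin n, dat (8 * x + 3) = adr x + (adj x).length
  dir : ∀ x : Fin n, dat (8 * x + 4) = dir x
  num : ∀ x : Fin n, dat (8 * x + 5) = n
  lt : ∀ x : Fin n, adr x + (adj x).length < W
  get : ∀ x i (h : i < (adj x).length), dat (adr x + i) = ((adj x)[i] : ℕ)
  mem : ∀ x y, y ∈ adj x ↔ H.Adj x y

variable {comp cnt : Fin n → ℕ} {adj : Fin n → List (Fin n)} {adr dir : Fin n → ℕ}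

theorem bfs_spec (hsc : 2 * n ≤ sc) (hscW : sc < W) (hnW : 8 * n + 8 < W)
    (Ly : GraphLayout H dat W comp cnt adj adr dir) {K : Finset (Fin n)} {R : ℕ}
    (hK : ∀ x, x ∈ K ↔ H.Reachable v x ∧ H.dist v x < R) (r : ℕ) :
    ∀ (σ : NS) (Q : List (Fin n)) (par : Fin n → Fin n) (h : ℕ), h + r = K.card →
    BFSInv H v Q par h → BFSRep σ.mem Q par → σ.reg 2 = 0 → σ.reg 3 = 1 → σ.reg 9 = n + h →
    σ.reg 10 = n + Q.length → σ.reg 11 = n + K.card →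
    ∃ t σ' Q' par', Ex dat sc W bfsCmd σ t σ' ∧
      t ≤ ∑ x ∈ K with x ∉ Q.take h, (13 * (adj x).length + 20) + 2 ∧
      BFSInv H v Q' par' K.card ∧ BFSRep σ'.mem Q' par' := by
  induction r with
  | zero =>
    intro σ Q par h hr I hrep h2 h3 h9 h10 h11
    obtain rfl : h = K.card := by omega
    refine ⟨_, _, Q, par, Ex.loop_done (Ex.blk _ _ ?_) ?_, ?_, I, ?_⟩
    · simp [Oks, Instr.Ok]
    · simp [nexecs, nexec, BinOp.nat, h9, h11]
    · simp
    · simpa [nexecs, nexec] using hrep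
  | succ r ih =>
    intro σ Q par h hr I hrep h2 h3 h9 h10 h11
    obtain ⟨x, hx, hxK⟩ := I.head_mem hK (by omega)
    have hlt : h < Q.length := (List.getElem?_eq_some_iff.mp hx).1
    have hQn : Q.length ≤ n := by simpa using I.nodup.length_le_card
    have hxn := x.isLt
    obtain ⟨σ₁, hσ₁⟩ : ∃ σ₁, σ₁ = nexecs dat sc [.bin .lt 16 9 11] σ := ⟨_, rfl⟩
    have hA : Ex dat sc W (.blk [.bin .lt 16 9 11]) σ 1 σ₁ := by
      rw [hσ₁]; exact Ex.blk _ _ (by simp [Oks, Instr.Ok])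
    have h₁ : σ₁.reg 16 ≠ 0 := by simp [hσ₁, nexecs, nexec, BinOp.nat, h9, h11]; omega
    have g : ∀ r, r ≠ 16 → σ₁.reg r = σ.reg r := by
      intro r hr
      rw [hA.reg_eq (by simpa [Cmd.writes, Instr.target] using hr)]
    have gm : σ₁.mem = σ.mem := hA.mem_eq (by decide)
    have gx : σ.mem (n + h) = x := hrep.queue h x hx
    obtain ⟨σ₂, hσ₂⟩ : ∃ σ₂, σ₂ = nexecs dat sc [.load 12 9, .bin .add 9 9 3, .const 7 8,
      .bin .mul 7 12 7, .const 8 2, .bin .add 7 7 8, .read 13 7, .bin .add 7 7 3, .read 14 7]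
      σ₁ := ⟨_, rfl⟩
    have hB : Ex dat sc W (.blk [.load 12 9, .bin .add 9 9 3, .const 7 8,
      .bin .mul 7 12 7, .const 8 2, .bin .add 7 7 8, .read 13 7, .bin .add 7 7 3, .read 14 7])
        σ₁ 9 σ₂ := by
      rw [hσ₂]
      refine Ex.blk _ _ ?_
      simp [Oks, Instr.Ok, nexec, BinOp.nat, g, h3, h9, gm, gx, show n + h < sc by omega]
      omega
    have k12 : σ₂.reg 12 = x := by
      simp [hσ₂, nexecs, nexec, g, h9, gm, gx, show n + h < sc by omega]
    have k9 : σ₂.reg 9 = n + (h + 1) := by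
      simp [hσ₂, nexecs, nexec, BinOp.nat, g, h9, h3]; omega
    have k13 : σ₂.reg 13 = adr x := by
      simp [hσ₂, nexecs, nexec, BinOp.nat, g, h9, gm, gx, show n + h < sc by omega]
      rw [mul_comm, Ly.lo]
    have k14 : σ₂.reg 14 = adr x + (adj x).length := by
      simp [hσ₂, nexecs, nexec, BinOp.nat, g, h9, h3, gm, gx, show n + h < sc by omega]
      rw [mul_comm, add_assoc, Ly.hi]
    have km : σ₂.mem = σ.mem := by rw [hB.mem_eq (by decide), gm]
    have k : ∀ r, r ∉ [12, 9, 7, 8, 13, 14, 16] → σ₂.reg r = σ.reg r := by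
      intro r hr
      rw [hB.reg_eq (by simp [Cmd.writes, Instr.target] at hr ⊢; tauto), g r (by
        simp at hr; tauto)]
    obtain ⟨t, σ₃, Q₁, par₁, hC, ht, I₁, hrep₁, q10, hpre, hall⟩ := scan_spec hsc hscW (adj x)
      σ₂ (adr x) Q par I (km ▸ hrep) hx (fun y hy => (Ly.mem x y).mp hy)
      (by rw [k 2 (by decide), h2]) (by rw [k 3 (by decide), h3]) (by rw [k 10 (by decide), h10])
      k12 k13 k14 (Ly.lt x) (Ly.get x)
    have hx₁ : Q₁[h]? = some x := by
      obtain ⟨s, rfl⟩ := hpre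
      rw [List.getElem?_append_left hlt, hx]
    have htake : Q₁.take (h + 1) = Q.take h ++ [x] := by
      obtain ⟨s, rfl⟩ := hpre
      rw [List.take_append_of_le_length (by omega), List.take_add_one, hx]
      rfl
    obtain ⟨t', σ₄, Q₂, par₂, hD, ht', I₂, hrep₂⟩ := ih σ₃ Q₁ par₁ (h + 1) (by omega)
      (I₁.next hx₁ fun y hy => hall y ((Ly.mem x y).mpr hy)) hrep₁
      (by rw [hC.reg_eq (by decide), k 2 (by decide), h2])
      (by rw [hC.reg_eq (by decide), k 3 (by decide), h3])
      (by rw [hC.reg_eq (by decide), k9]) q10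
      (by rw [hC.reg_eq (by decide), k 11 (by decide), h11])
    refine ⟨_, σ₄, Q₂, par₂, Ex.loop_step hA h₁ (Ex.seq hB hC) hD, ?_, I₂, hrep₂⟩
    have hxt : x ∉ Q.take h := by
      intro hmem
      have hnd := I₁.nodup.sublist (List.take_sublist (h + 1) Q₁)
      rw [htake] at hnd
      exact (List.nodup_append.mp hnd).2.2 x hmem x (by simp) rfl
    have hset : ({y ∈ K | y ∉ Q.take h} : Finset (Fin n)).erase x =
        {y ∈ K | y ∉ Q₁.take (h + 1)} := by
      ext y
      rw [htake]
      simp only [Finset.mem_erase, Finset.mem_filter, List.mem_append, List.mem_singleton]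
      tauto
    have hsum := Finset.add_sum_erase ({y ∈ K | y ∉ Q.take h} : Finset (Fin n))
      (fun x => 13 * (adj x).length + 20) (a := x) (by simp [hxK, hxt])
    rw [hset] at hsum
    omega

theorem ascend_loop_spec (hsc : 2 * n ≤ sc) {Q : List (Fin n)}
    {par : Fin n → Fin n} {h : ℕ} (I : BFSInv H v Q par h) (d : ℕ) :
    ∀ (σ : NS) (x : Fin n), x ∈ Q → H.dist v x = d → BFSRep σ.mem Q par → σ.reg 1 = v →
    σ.reg 3 = 1 → σ.reg 12 = x →
    ∃ t σ' , ∃ p : H.Walk x v, Ex dat sc W (.loop (.blk [.bin .eq 16 12 1, .bin .sub 16 3 16]) 16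
      (.blk [.load 12 12, .bin .sub 12 12 3, .emit 12])) σ t σ' ∧ p.length = d ∧
      t ≤ 7 * d + 3 ∧ σ'.out = σ.out ++ p.support.tail.map Fin.val := by
  induction d with
  | zero =>
    intro σ x hxQ hd hrep h1 h3 h12
    rw [(I.reach x hxQ).dist_eq_zero_iff] at hd
    subst hd
    refine ⟨_, _, .nil, Ex.loop_done (Ex.blk _ _ ?_) ?_, ?_, ?_, ?_⟩
    · simp [Oks, Instr.Ok, nexec, BinOp.nat, h1, h3, h12]
    · simp [nexecs, nexec, BinOp.nat, h1, h3, h12]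
    · simp
    · simp
    · simp [nexecs, nexec]
  | succ d ih =>
    intro σ x hxQ hd hrep h1 h3 h12
    have hxv : x ≠ v := by
      rintro rfl
      simp at hd
    obtain ⟨hpQ, hadj, hpd⟩ := I.parent x hxQ hxv
    have hxn := x.isLt
    have hne : (x : ℕ) ≠ v := fun hc => hxv (Fin.ext hc)
    obtain ⟨σ₁, hσ₁⟩ : ∃ σ₁, σ₁ = nexecs dat sc [.bin .eq 16 12 1, .bin .sub 16 3 16] σ :=
      ⟨_, rfl⟩
    have hA : Ex dat sc W (.blk [.bin .eq 16 12 1, .bin .sub 16 3 16]) σ 2 σ₁ := by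
      rw [hσ₁]
      refine Ex.blk _ _ ?_
      simp [Oks, Instr.Ok, nexec, BinOp.nat, h1, h3, h12, hne]
    have g16 : σ₁.reg 16 ≠ 0 := by simp [hσ₁, nexecs, nexec, BinOp.nat, h1, h3, h12, hne]
    have g : ∀ r, r ≠ 16 → σ₁.reg r = σ.reg r := by
      intro r hr
      rw [hA.reg_eq (by simpa [Cmd.writes, Instr.target] using hr)]
    have gm : σ₁.mem = σ.mem := hA.mem_eq (by decide)
    have go : σ₁.out = σ.out := hA.out_eq (by decide)
    have hs := hrep.seen x hxQ
    obtain ⟨σ₂, hσ₂⟩ : ∃ σ₂, σ₂ = nexecs dat sc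
      [.load 12 12, .bin .sub 12 12 3, .emit 12] σ₁ := ⟨_, rfl⟩
    have hB : Ex dat sc W (.blk [.load 12 12, .bin .sub 12 12 3, .emit 12]) σ₁ 3 σ₂ := by
      rw [hσ₂]
      refine Ex.blk _ _ ?_
      simp [Oks, Instr.Ok, nexec, g, h12, h3, gm, hs, show (x : ℕ) < sc by omega]
    have km : σ₂.mem = σ.mem := by rw [hB.mem_eq (by decide), gm]
    have k12 : σ₂.reg 12 = par x := by
      simp [hσ₂, nexecs, nexec, BinOp.nat, g, h12, h3, gm, hs, show (x : ℕ) < sc by omega]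
    have ko : σ₂.out = σ.out ++ [(par x : ℕ)] := by
      simp [hσ₂, nexecs, nexec, BinOp.nat, g, h12, h3, gm, hs, go, show (x : ℕ) < sc by omega]
    obtain ⟨t, σ₃, p, hC, hp, ht, hout⟩ := ih σ₂ (par x) hpQ (by omega) (km ▸ hrep)
      (by rw [hB.reg_eq (by decide), g 1 (by decide), h1])
      (by rw [hB.reg_eq (by decide), g 3 (by decide), h3]) k12
    refine ⟨_, σ₃, .cons hadj p, Ex.loop_step hA g16 hB hC, ?_, ?_, ?_⟩
    · simp [hp]
    · omega
    · rw [hout, ko, SimpleGraph.Walk.support_cons, List.tail_cons, List.append_assoc,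
        List.singleton_append, ← List.map_cons, SimpleGraph.Walk.cons_tail_support]

theorem ascend_spec (hsc : 2 * n ≤ sc) (hscW : sc < W) {Q : List (Fin n)}
    {par : Fin n → Fin n} {h : ℕ} (I : BFSInv H v Q par h) {σ : NS} {u : Fin n} (hu : u ∈ Q)
    (hrep : BFSRep σ.mem Q par) (h0 : σ.reg 0 = u) (h1 : σ.reg 1 = v) (h2 : σ.reg 2 = 0)
    (h3 : σ.reg 3 = 1) :
    ∃ t σ', ∃ p : H.Walk u v, Ex dat sc W ascendCmd σ t σ' ∧ p.length = H.dist v u ∧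
      t ≤ 7 * p.length + 5 ∧ σ'.out = σ.out ++ p.support.map Fin.val := by
  have hun := u.isLt
  obtain ⟨σ₁, hσ₁⟩ : ∃ σ₁, σ₁ = nexecs dat sc [.bin .add 12 0 2, .emit 12] σ := ⟨_, rfl⟩
  have hA : Ex dat sc W (.blk [.bin .add 12 0 2, .emit 12]) σ 2 σ₁ := by
    rw [hσ₁]
    refine Ex.blk _ _ ?_
    simp [Oks, Instr.Ok, h0, h2]; omega
  obtain ⟨t, σ₂, p, hB, hp, ht, hout⟩ := ascend_loop_spec (dat := dat) (W := W) hsc I _ σ₁ u hu rfl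
    (by rwa [hA.mem_eq (by decide)]) (by rw [hA.reg_eq (by decide), h1])
    (by rw [hA.reg_eq (by decide), h3]) (by simp [hσ₁, nexecs, nexec, BinOp.nat, h0, h2])
  refine ⟨_, σ₂, p, Ex.seq hA hB, hp, by omega, ?_⟩
  rw [hout, show σ₁.out = σ.out ++ [(u : ℕ)] by
    simp [hσ₁, nexecs, nexec, BinOp.nat, h0, h2], List.append_assoc, List.singleton_append,
    ← List.map_cons, SimpleGraph.Walk.cons_tail_support]

/-- The data that `searchCmd` uses for the query `(u, v)`: a first scale `j₀` at which `u` and `v`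
have the same cluster, and walks to its center, via pivots, that are stored as chains. -/
def HasMeeting (H : SimpleGraph (Fin n)) (dat : ℕ → ℕ) (W : ℕ) (dir : Fin n → ℕ) (u v : Fin n)
    (bound : ℕ) : Prop :=
  ∃ (j₀ : ℕ) (s s' z : Fin n) (pu : H.Walk u s) (qu : H.Walk s z) (pv : H.Walk v s')
    (qv : H.Walk s' z),
    (∀ j ≤ j₀, dir u + 3 * j + 3 < W ∧ dir v + 3 * j + 3 < W ∧
      slotAddr dat (dir u) (dir u) j < W ∧ slotAddr dat (dir u) (dir v) j < W) ∧
    (∀ j < j₀, dat (slotAddr dat (dir u) (dir u) j) ≠ dat (slotAddr dat (dir u) (dir v) j)) ∧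
    dat (slotAddr dat (dir u) (dir u) j₀) = dat (slotAddr dat (dir u) (dir v) j₀) ∧
    Chain dat W (dat (dir u + 3 * j₀)) (pu.support.tail.map Fin.val) ∧
    Chain dat W (slotAddr dat (dir u) (dir u) j₀) (qu.support.tail.map Fin.val) ∧
    Chain dat W (dat (dir v + 3 * j₀)) (pv.support.tail.map Fin.val) ∧
    Chain dat W (slotAddr dat (dir u) (dir v) j₀) (qv.support.tail.map Fin.val) ∧
    pu.length + qu.length + pv.length + qv.length ≤ bound ∧ j₀ ≤ H.dist v u

/-- Correctness and running time of the query program. The search processes the ball `K` of the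
vertices at distance less than `R` from `v`, and so finds all vertices at distance at most `R`;
clusters are needed only for the other ones. -/
theorem query_spec (hscW : sc < W) (hnW : 8 * n + 8 < W)
    (Ly : GraphLayout H dat W comp cnt adj adr dir)
    {K : Finset (Fin n)} {R D bound : ℕ}
    (hK : ∀ x, x ∈ K ↔ H.Reachable v x ∧ H.dist v x < R) (hcnt : cnt v = K.card)
    (hvol : ∑ x ∈ K, (adj x).length ≤ D) {u : Fin n} (hcomp : comp u = comp v ↔ H.Reachable v u)
    (hs : 2 * n + 2 + bound ≤ sc)
    (hmeet : H.Reachable v u → R < H.dist v u → HasMeeting H dat W dir u v bound)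
    (hbd : H.Reachable v u → H.dist v u ≤ bound) :
    (¬ H.Reachable v u →
      ∃ t σ', Ex dat sc W queryCmd (startNS u v) t σ' ∧ σ'.out = [] ∧ t ≤ 20) ∧
    (H.Reachable v u → ∃ t σ', ∃ p : H.Walk u v, Ex dat sc W queryCmd (startNS u v) t σ' ∧
      σ'.out = p.support.map Fin.val ∧ p.length ≤ bound ∧
      t ≤ 13 * D + 20 * K.card + 48 * p.length + 200) := by
  have hun := u.isLt
  have hvn := v.isLt
  obtain ⟨σ₁, hσ₁⟩ : ∃ σ₁, σ₁ = nexecs dat sc [.const 3 1, .const 7 8, .bin .mul 5 0 7,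
    .bin .mul 6 1 7, .read 8 5, .read 9 6, .bin .eq 10 8 9] (startNS u v) := ⟨_, rfl⟩
  have e₁ : Ex dat sc W (.blk [.const 3 1, .const 7 8, .bin .mul 5 0 7,
      .bin .mul 6 1 7, .read 8 5, .read 9 6, .bin .eq 10 8 9]) (startNS u v) 7 σ₁ := by
    rw [hσ₁]
    refine Ex.blk _ _ ?_
    simp [Oks, Instr.Ok, nexec, startNS]; omega
  have a10 : σ₁.reg 10 = if comp u = comp v then 1 else 0 := by
    simp [hσ₁, nexecs, nexec, BinOp.nat, startNS, mul_comm _ 8, Ly.comp]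
  have aout : σ₁.out = [] := by simp [hσ₁, nexecs, nexec, startNS]
  constructor
  · intro hr
    rw [if_neg (mt hcomp.mp hr)] at a10
    exact ⟨_, σ₁, Ex.seq e₁ (Ex.ite_false a10 (Ex.blk [] σ₁ trivial)), aout, by simp⟩
  intro hr
  rw [if_pos (hcomp.mpr hr)] at a10
  have a0 : σ₁.reg 0 = u := by simp [hσ₁, nexecs, nexec, startNS]
  have a1 : σ₁.reg 1 = v := by simp [hσ₁, nexecs, nexec, startNS]
  have a2 : σ₁.reg 2 = 0 := by simp [hσ₁, nexecs, nexec, startNS]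
  have a3 : σ₁.reg 3 = 1 := by simp [hσ₁, nexecs, nexec]
  have a5 : σ₁.reg 5 = 8 * u := by simp [hσ₁, nexecs, nexec, BinOp.nat, startNS, mul_comm]
  have a6 : σ₁.reg 6 = 8 * v := by simp [hσ₁, nexecs, nexec, BinOp.nat, startNS, mul_comm]
  have am : σ₁.mem = fun _ => 0 := by simp [hσ₁, nexecs, nexec, startNS]
  have hKn : K.card ≤ n := by simpa using K.card_le_univ
  -- start of the search
  obtain ⟨σ₂, hσ₂⟩ : ∃ σ₂, σ₂ = nexecs dat sc [.const 7 5, .bin .add 7 6 7, .read 4 7,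
    .bin .add 7 6 3, .read 11 7, .bin .add 11 4 11, .bin .add 8 1 3, .store 1 8, .store 4 1,
    .bin .add 9 4 2, .bin .add 10 4 3] σ₁ := ⟨_, rfl⟩
  have e₂ : Ex dat sc W (.blk [.const 7 5, .bin .add 7 6 7, .read 4 7,
    .bin .add 7 6 3, .read 11 7, .bin .add 11 4 11, .bin .add 8 1 3, .store 1 8, .store 4 1,
    .bin .add 9 4 2, .bin .add 10 4 3]) σ₁ 11 σ₂ := by
    rw [hσ₂]
    refine Ex.blk _ _ ?_
    simp [Oks, Instr.Ok, nexec, BinOp.nat, a1, a2, a3, a6, Ly.cnt, Ly.num, hcnt]; omega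
  have b : ∀ r, r ∉ [7, 4, 11, 8, 9, 10] → σ₂.reg r = σ₁.reg r := by
    intro r hr
    rw [e₂.reg_eq (by simp [Cmd.writes, Instr.target] at hr ⊢; tauto)]
  have b4 : σ₂.reg 4 = n := by simp [hσ₂, nexecs, nexec, BinOp.nat, a6, Ly.num]
  have b9 : σ₂.reg 9 = n + 0 := by simp [hσ₂, nexecs, nexec, BinOp.nat, a2, a6, Ly.num]
  have b10 : σ₂.reg 10 = n + [v].length := by
    simp [hσ₂, nexecs, nexec, BinOp.nat, a3, a6, Ly.num]
  have b11 : σ₂.reg 11 = n + K.card := by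
    simp [hσ₂, nexecs, nexec, BinOp.nat, a3, a6, Ly.num, Ly.cnt, hcnt]
  have bm : σ₂.mem =
      Function.update (Function.update (fun _ : ℕ => (0 : ℕ)) (v : ℕ) ((v : ℕ) + 1)) n (v : ℕ) := by
    simp [hσ₂, nexecs, nexec, BinOp.nat, a1, a3, a6, am, Ly.num, show (v : ℕ) < sc by omega,
      show n < sc by omega]
  have brep : BFSRep σ₂.mem [v] id := by
    rw [bm]
    refine ⟨?_, ?_, ?_⟩
    · intro i x hi
      have hx : x = v := by simpa using List.mem_of_getElem? hi
      have hi0 : i = 0 := by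
        have := (List.getElem?_eq_some_iff.mp hi).1
        simpa using this
      subst hi0 hx
      simp
    · intro x hx
      rw [List.mem_singleton] at hx
      have := x.isLt
      rw [Function.update_of_ne (by omega), Function.update_of_ne (fun hc => hx (Fin.ext hc))]
    · intro x hx
      rw [List.mem_singleton] at hx
      subst hx
      rw [Function.update_of_ne (by omega), Function.update_self, id]
  obtain ⟨t₃, σ₃, Q, par, e₃, ht₃, I, crep⟩ := bfs_spec (by omega) hscW hnW Ly hK K.card σ₂ [v] id 0
    (by omega) BFSInv.init brep (by rw [b 2 (by decide), a2]) (by rw [b 3 (by decide), a3]) b9 b10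
    b11
  have ht₃' : t₃ ≤ 13 * D + 20 * K.card + 2 := by
    simp only [List.take_zero, List.not_mem_nil, not_false_eq_true, Finset.filter_true,
      Finset.sum_add_distrib, ← Finset.mul_sum, Finset.sum_const, smul_eq_mul] at ht₃
    nlinarith
  have c : ∀ r, r ∉ [7, 4, 11, 8, 9, 10, 16, 12, 13, 14, 15, 17] → σ₃.reg r = σ₁.reg r := by
    intro r hr
    rw [e₃.reg_eq (by simp [bfsCmd, scanCmd, Cmd.writes, Instr.target] at hr ⊢; tauto),
      b r (by simp at hr ⊢; tauto)]
  obtain ⟨σ₄, hσ₄⟩ : ∃ σ₄, σ₄ = nexecs dat sc [.load 16 0] σ₃ := ⟨_, rfl⟩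
  have e₄ : Ex dat sc W (.blk [.load 16 0]) σ₃ 1 σ₄ := by
    rw [hσ₄]
    exact Ex.blk _ _ (by simp [Oks, Instr.Ok])
  have d16 : σ₄.reg 16 = σ₃.mem u := by
    simp [hσ₄, nexecs, nexec, c 0 (by decide), a0, show (u : ℕ) < sc by omega]
  have d : ∀ r, r ∉ [7, 4, 11, 8, 9, 10, 16, 12, 13, 14, 15, 17] → σ₄.reg r = σ₁.reg r := by
    intro r hr
    rw [e₄.reg_eq (by simp [Cmd.writes, Instr.target] at hr ⊢; tauto), c r hr]
  have d4 : σ₄.reg 4 = n := by rw [e₄.reg_eq (by decide), e₃.reg_eq (by decide), b4]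
  have dm : σ₄.mem = σ₃.mem := e₄.mem_eq (by decide)
  have dout : σ₄.out = [] := by
    rw [e₄.out_eq (by decide), e₃.out_eq (by decide), e₂.out_eq (by decide), aout]
  have d0 : σ₄.reg 0 = u := by rw [d 0 (by decide), a0]
  have d1 : σ₄.reg 1 = v := by rw [d 1 (by decide), a1]
  have d2 : σ₄.reg 2 = 0 := by rw [d 2 (by decide), a2]
  have d3 : σ₄.reg 3 = 1 := by rw [d 3 (by decide), a3]
  by_cases hu : u ∈ Q
  · -- the search has found the first query vertex
    obtain ⟨t₅, σ₅, p, e₅, hp, ht₅, hout⟩ := ascend_spec (dat := dat) (by omega) hscW I hu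
      (dm ▸ crep) d0 d1 d2 d3
    refine ⟨_, σ₅, p, Ex.seq e₁ (Ex.ite_true (by omega) (Ex.seq e₂ (Ex.seq e₃ (Ex.seq e₄
      (Ex.ite_true ?_ e₅))))), ?_, ?_, ?_⟩
    · rw [d16, crep.seen u hu]; omega
    · rw [hout, dout, List.nil_append]
    · rw [hp]; exact hbd hr
    · omega
  · have hfar : R < H.dist v u := by
      by_contra hcon
      exact hu (I.mem_of_dist_le hK hr (by omega))
    obtain ⟨j₀, s, s', z, pu, qu, pv, qv, hb, hne, heq, c1, c2, c3, c4, hlen, hj₀⟩ := hmeet hr hfar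
    have hl : ∀ {x y : Fin n} (p : H.Walk x y),
        (p.support.tail.map Fin.val).length = p.length := by
      intro x y p
      simp
    obtain ⟨t₅, σ₅, e₅, ht₅, hout⟩ := search_spec hscW (by omega) (n := n)
      (by omega) (by omega) (Ly.dir u) (Ly.dir v) hb hne heq c1 c2 c3 c4
      (by simp only [hl]; omega) d0 d1 d2 d3 d4 (by rw [d 5 (by decide), a5])
      (by rw [d 6 (by decide), a6])
    simp only [hl] at ht₅
    have hplen : ((pu.append qu).append (pv.append qv).reverse).length =
        pu.length + qu.length + pv.length + qv.length := by
      simp; omega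
    refine ⟨_, σ₅, (pu.append qu).append (pv.append qv).reverse, Ex.seq e₁ (Ex.ite_true (by omega)
      (Ex.seq e₂ (Ex.seq e₃ (Ex.seq e₄ (Ex.ite_false ?_ e₅))))), ?_, ?_, ?_⟩
    · rw [d16, crep.unseen u hu]
    · have hap : ∀ {x y z : Fin n} (p : H.Walk x y) (q : H.Walk y z),
          (x : ℕ) :: (p.support.tail.map Fin.val ++ q.support.tail.map Fin.val) =
            (p.append q).support.map Fin.val := by
        intro x y z p q
        rw [← List.cons_append, ← List.map_cons, SimpleGraph.Walk.cons_tail_support,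
          SimpleGraph.Walk.support_append, List.map_append]
      rw [hout, dout, List.nil_append, hap, hap, SimpleGraph.Walk.support_append (pu.append qu),
        SimpleGraph.Walk.support_reverse, List.tail_reverse, List.map_append, ← List.map_dropLast,
        List.map_reverse]
    · omega
    · have : H.dist v u ≤ pu.length + qu.length + pv.length + qv.length := by
        rw [SimpleGraph.dist_comm, ← hplen]
        exact SimpleGraph.dist_le _
      omega

end QuerySpec

/-! ### Bounded distance -/

section Near

variable {V : Type*} {G H : SimpleGraph V} {u v w : V} {d e : ℕ}

/-- There is a walk of length at most `d` from `u` to `v`. -/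
def Near (G : SimpleGraph V) (d : ℕ) (u v : V) : Prop := ∃ p : G.Walk u v, p.length ≤ d

theorem Near.refl (G : SimpleGraph V) (d : ℕ) (u : V) : Near G d u u := ⟨.nil, by simp⟩

theorem Near.symm (h : Near G d u v) : Near G d v u := by
  obtain ⟨p, hp⟩ := h
  exact ⟨p.reverse, by simpa using hp⟩

theorem Near.trans (h : Near G d u v) (h' : Near G e v w) : Near G (d + e) u w := by
  obtain ⟨p, hp⟩ := h
  obtain ⟨q, hq⟩ := h'
  exact ⟨p.append q, by rw [SimpleGraph.Walk.length_append]; omega⟩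

theorem Near.mono (h : Near G d u v) (hde : d ≤ e) : Near G e u v := by
  obtain ⟨p, hp⟩ := h
  exact ⟨p, hp.trans hde⟩

theorem Near.mono_graph (h : Near G d u v) (hGH : G ≤ H) : Near H d u v := by
  obtain ⟨p, hp⟩ := h
  exact ⟨p.mapLe hGH, by simpa using hp⟩

theorem Near.of_adj (h : G.Adj u v) : Near G 1 u v := ⟨.cons h .nil, by simp⟩

theorem Near.reachable (h : Near G d u v) : G.Reachable u v := h.choose.reachable

theorem Near.dist_le (h : Near G d u v) : G.dist u v ≤ d := by
  obtain ⟨p, hp⟩ := h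
  exact (SimpleGraph.dist_le p).trans hp

theorem near_dist (h : G.Reachable u v) : Near G (G.dist u v) u v := by
  obtain ⟨p, hp⟩ := h.exists_walk_length_eq_dist
  exact ⟨p, hp.le⟩

theorem near_iff : Near G d u v ↔ G.Reachable u v ∧ G.dist u v ≤ d :=
  ⟨fun h => ⟨h.reachable, h.dist_le⟩, fun h => (near_dist h.1).mono h.2⟩

theorem Near.split (h : Near G (d + e) u v) : ∃ x, Near G d u x ∧ Near G e x v := by
  obtain ⟨p, hp⟩ := h
  refine ⟨p.getVert d, ⟨p.take d, ?_⟩, ⟨p.drop d, ?_⟩⟩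
  · rw [SimpleGraph.Walk.take_length]; omega
  · rw [SimpleGraph.Walk.drop_length]; omega

end Near

/-! ### Near-additive spanners -/

/-- Greedy packing: among the elements of `s`, ordered by `f`, there is a family `t` without
conflicts such that each element of `s` is in conflict with one of `t` that does not come later. -/
theorem exists_packing {α : Type*} (f : α → ℕ) (R : α → α → Prop)
    (hR : ∀ a b, R a b → R b a) (s : Finset α) :
    ∃ t ⊆ s, (∀ a ∈ t, ∀ b ∈ t, a ≠ b → ¬ R a b) ∧
      ∀ a ∈ s, ∃ b ∈ t, (a = b ∨ R a b) ∧ f b ≤ f a := by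
  classical
  induction s using Finset.strongInduction with
  | H s ih =>
    rcases s.eq_empty_or_nonempty with rfl | hs
    · exact ⟨∅, by simp⟩
    obtain ⟨a, ha, hmin⟩ := s.exists_min_image f hs
    have hlt : s.filter (fun b => b ≠ a ∧ ¬ R b a) ⊂ s :=
      Finset.filter_ssubset.mpr ⟨a, ha, by simp⟩
    obtain ⟨t, hts, hind, hcov⟩ := ih _ hlt
    refine ⟨insert a t, ?_, ?_, ?_⟩
    · exact Finset.insert_subset ha (hts.trans (Finset.filter_subset _ _))
    · intro b hb c hc hbc
      rw [Finset.mem_insert] at hb hc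
      rcases hb with rfl | hb <;> rcases hc with rfl | hc
      · exact absurd rfl hbc
      · exact fun h => (Finset.mem_filter.mp (hts hc)).2.2 (hR _ _ h)
      · exact (Finset.mem_filter.mp (hts hb)).2.2
      · exact hind b hb c hc hbc
    · intro b hb
      by_cases hba : b = a ∨ R b a
      · exact ⟨a, Finset.mem_insert_self _ _, hba, hmin b hb⟩
      · rw [not_or] at hba
        obtain ⟨c, hc, h⟩ := hcov b (Finset.mem_filter.mpr ⟨hb, hba⟩)
        exact ⟨c, Finset.mem_insert_of_mem hc, h⟩

section Spanner

variable {V : Type*} {G : SimpleGraph V}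

theorem ncard_edgeSet_sup_le (G H : SimpleGraph V) :
    (G ⊔ H).edgeSet.ncard ≤ G.edgeSet.ncard + H.edgeSet.ncard := by
  rw [SimpleGraph.edgeSet_sup]
  exact Set.ncard_union_le _ _

/-- Shortest paths between the pairs of `P` form a subgraph with few edges. -/
theorem exists_union_paths (P : Finset (V × V)) {ρ : ℕ} (hP : ∀ p ∈ P, Near G ρ p.1 p.2) :
    ∃ H ≤ G, H.edgeSet.ncard ≤ P.card * ρ ∧
      ∀ p ∈ P, ∀ d, Near G d p.1 p.2 → Near H d p.1 p.2 := by
  classical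
  induction P using Finset.induction_on with
  | empty => exact ⟨⊥, bot_le, by simp⟩
  | insert p P hp ih =>
    obtain ⟨H, hHG, hcard, hH⟩ := ih fun q hq => hP q (Finset.mem_insert_of_mem hq)
    obtain ⟨q, hq⟩ := (hP p (Finset.mem_insert_self _ _)).reachable.exists_walk_length_eq_dist
    have hqe : (SimpleGraph.fromEdgeSet {e | e ∈ q.edges}).edgeSet = {e | e ∈ q.edges} := by
      rw [SimpleGraph.edgeSet_fromEdgeSet, sdiff_eq_left, Set.disjoint_left]
      exact fun e he => G.not_isDiag_of_mem_edgeSet (q.edges_subset_edgeSet he)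
    refine ⟨H ⊔ SimpleGraph.fromEdgeSet {e | e ∈ q.edges}, sup_le hHG ?_, ?_, ?_⟩
    · rw [← SimpleGraph.edgeSet_subset_edgeSet, hqe]
      exact fun e he => q.edges_subset_edgeSet he
    · refine (ncard_edgeSet_sup_le _ _).trans ?_
      rw [Finset.card_insert_of_notMem hp, add_mul, one_mul, hqe]
      refine Nat.add_le_add hcard ?_
      have h1 : {e | e ∈ q.edges} = (q.edges.toFinset : Set (Sym2 V)) := by ext; simp
      rw [h1, Set.ncard_coe_finset]
      refine (List.toFinset_card_le _).trans ?_
      rw [SimpleGraph.Walk.length_edges, hq]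
      exact (hP p (Finset.mem_insert_self _ _)).dist_le
    · intro r hr d hd
      rcases Finset.mem_insert.mp hr with rfl | hr
      · refine ⟨(q.transfer (SimpleGraph.fromEdgeSet {e | e ∈ q.edges}) ?_).mapLe le_sup_right, ?_⟩
        · intro e he
          rw [hqe]
          exact he
        · simp only [SimpleGraph.Walk.length_map, SimpleGraph.Walk.length_transfer, hq]
          exact hd.dist_le
      · exact (hH r hr d hd).mono_graph le_sup_left

/-- One level of the spanner. A vertex of `A` is popular if at least `b` vertices of `A` lie within
distance `ρ` of it. Unpopular vertices are joined with all these vertices, and popular vertices with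
a vertex of a sparse subset `A'`. -/
theorem exists_level [Finite V] (A : Finset V) (b ρ : ℕ) :
    ∃ A' : Finset V, ∃ H ≤ G, A'.card * b ≤ A.card ∧
      H.edgeSet.ncard ≤ A.card * (b * ρ + 2 * ρ) ∧
      ∀ w ∈ A, ∀ w' ∈ A, Near G ρ w w' → (∀ d, Near G d w w' → Near H d w w') ∨
        ((∃ p ∈ A', Near H (2 * ρ) w p) ∧ ∃ p ∈ A', Near H (2 * ρ) w' p) := by
  classical
  set X : V → Finset V := fun w => A.filter (Near G ρ w) with hX
  obtain ⟨A', hA', hind, hcov⟩ := exists_packing (fun _ => 0)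
    (fun a c => ¬ Disjoint (X a) (X c)) (fun a c h hd => h hd.symm)
    (A.filter fun w => b ≤ (X w).card)
  have hrep : ∀ w ∈ A, b ≤ (X w).card → ∃ p ∈ A', Near G (2 * ρ) w p := by
    intro w hw hb
    obtain ⟨p, hp, hwp, -⟩ := hcov w (Finset.mem_filter.mpr ⟨hw, hb⟩)
    refine ⟨p, hp, ?_⟩
    rcases hwp with rfl | hwp
    · exact Near.refl _ _ _
    · obtain ⟨x, hx, hx'⟩ := Finset.not_disjoint_iff.mp hwp
      have h := (Finset.mem_filter.mp hx).2.trans (Finset.mem_filter.mp hx').2.symm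
      rwa [← two_mul] at h
  have hrep' : ∀ w, ∃ p, w ∈ A → b ≤ (X w).card → p ∈ A' ∧ Near G (2 * ρ) w p := by
    intro w
    by_cases hw : w ∈ A ∧ b ≤ (X w).card
    · obtain ⟨p, hp⟩ := hrep w hw.1 hw.2
      exact ⟨p, fun _ _ => hp⟩
    · exact ⟨w, fun h1 h2 => absurd ⟨h1, h2⟩ hw⟩
  choose rep hrep'' using hrep'
  obtain ⟨H₁, hH₁, hc₁, hn₁⟩ := exists_union_paths (G := G) (ρ := ρ)
    ((A.filter fun w => ¬ b ≤ (X w).card).biUnion fun w => (X w).image (Prod.mk w)) (by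
      intro p hp
      obtain ⟨w, -, hw⟩ := Finset.mem_biUnion.mp hp
      obtain ⟨x, hx, rfl⟩ := Finset.mem_image.mp hw
      exact (Finset.mem_filter.mp hx).2)
  obtain ⟨H₂, hH₂, hc₂, hn₂⟩ := exists_union_paths (G := G) (ρ := 2 * ρ)
    ((A.filter fun w => b ≤ (X w).card).image fun w => (w, rep w)) (by
      intro p hp
      obtain ⟨w, hw, rfl⟩ := Finset.mem_image.mp hp
      rw [Finset.mem_filter] at hw
      exact (hrep'' w hw.1 hw.2).2)
  refine ⟨A', H₁ ⊔ H₂, sup_le hH₁ hH₂, ?_, ?_, ?_⟩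
  · have hdisj : (A'.biUnion X).card = ∑ a ∈ A', (X a).card := by
      refine Finset.card_biUnion fun a ha c hc hac => ?_
      have := hind a ha c hc hac
      rwa [not_not] at this
    calc A'.card * b = ∑ _a ∈ A', b := by rw [Finset.sum_const, smul_eq_mul]
      _ ≤ ∑ a ∈ A', (X a).card :=
        Finset.sum_le_sum fun a ha => (Finset.mem_filter.mp (hA' ha)).2
      _ = (A'.biUnion X).card := hdisj.symm
      _ ≤ A.card := by
        refine Finset.card_le_card fun x hx => ?_
        obtain ⟨a, -, ha⟩ := Finset.mem_biUnion.mp hx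
        exact (Finset.mem_filter.mp ha).1
  · refine (ncard_edgeSet_sup_le _ _).trans ?_
    rw [mul_add, ← mul_assoc]
    refine Nat.add_le_add (hc₁.trans (Nat.mul_le_mul_right _ ?_))
      (hc₂.trans (Nat.mul_le_mul_right _ ?_))
    · refine (Finset.card_biUnion_le_card_mul _ _ b fun w hw => ?_).trans
        (Nat.mul_le_mul_right _ (Finset.card_le_card (Finset.filter_subset _ _)))
      have := (Finset.mem_filter.mp hw).2
      exact Finset.card_image_le.trans (by omega)
    · exact Finset.card_image_le.trans (Finset.card_le_card (Finset.filter_subset _ _))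
  · have hun : ∀ w ∈ A, ∀ w' ∈ A, Near G ρ w w' → ¬ b ≤ (X w).card →
        ∀ d, Near G d w w' → Near (H₁ ⊔ H₂) d w w' := by
      intro w hw w' hw' hww' hb d hd
      refine (hn₁ (w, w') ?_ d hd).mono_graph le_sup_left
      refine Finset.mem_biUnion.mpr ⟨w, Finset.mem_filter.mpr ⟨hw, hb⟩, ?_⟩
      exact Finset.mem_image.mpr ⟨w', Finset.mem_filter.mpr ⟨hw', hww'⟩, rfl⟩
    have hpop : ∀ w ∈ A, b ≤ (X w).card → ∃ p ∈ A', Near (H₁ ⊔ H₂) (2 * ρ) w p := by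
      intro w hw hb
      refine ⟨rep w, (hrep'' w hw hb).1, (hn₂ (w, rep w) ?_ _ (hrep'' w hw hb).2).mono_graph
        le_sup_right⟩
      exact Finset.mem_image.mpr ⟨w, Finset.mem_filter.mpr ⟨hw, hb⟩, rfl⟩
    intro w hw w' hw' hww'
    by_cases hb : b ≤ (X w).card
    · by_cases hb' : b ≤ (X w').card
      · exact Or.inr ⟨hpop w hw hb, hpop w' hw' hb'⟩
      · exact Or.inl fun d hd => (hun w' hw' w hw hww'.symm hb' d hd.symm).symm
    · exact Or.inl (hun w hw w' hw' hww' hb)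

/-- A path of `m` segments of length `s`, each of which is replaced by a walk of length `g` of `H`
or else has both ends close to `A`, is replaced as a whole or contains a first and a last segment
end that is close to `A`. -/
theorem segments_dichotomy {H : SimpleGraph V} {A : Finset V} {s g c : ℕ}
    (hseg : ∀ x y, Near G s x y → Near H g x y ∨
      ((∃ p ∈ A, Near H c x p) ∧ ∃ p ∈ A, Near H c y p)) (m : ℕ) :
    ∀ u v, Near G (m * s) u v → Near H (m * g) u v ∨
      ∃ m₁ m₂ m₃ x y, m₁ + m₂ + m₃ = m ∧ Near G (m₁ * s) u x ∧ Near H (m₁ * g) u x ∧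
        (∃ p ∈ A, Near H c x p) ∧ Near G (m₂ * s) x y ∧ (∃ p ∈ A, Near H c y p) ∧
        Near H (m₃ * g) y v := by
  induction m with
  | zero =>
    intro u v h
    left
    rw [zero_mul] at h ⊢
    have : u = v := by
      obtain ⟨p, hp⟩ := h
      exact SimpleGraph.Walk.eq_of_length_eq_zero (p := p) (by omega)
    exact this ▸ Near.refl _ _ _
  | succ m ih =>
    intro u v h
    rw [add_mul, one_mul, add_comm] at h
    obtain ⟨a, hua, hav⟩ := h.split
    rcases hseg u a hua with hgood | ⟨hu, ha⟩
    · rcases ih a v hav with h | ⟨m₁, m₂, m₃, x, y, hm, h1, h2, h3, h4, h5, h6⟩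
      · left
        rw [add_mul, one_mul, add_comm]
        exact hgood.trans h
      · right
        refine ⟨m₁ + 1, m₂, m₃, x, y, by omega, ?_, ?_, h3, h4, h5, h6⟩
        · rw [add_mul, one_mul, add_comm]; exact hua.trans h1
        · rw [add_mul, one_mul, add_comm]; exact hgood.trans h2
    · right
      rcases ih a v hav with h | ⟨m₁, m₂, m₃, x, y, hm, h1, h2, h3, h4, h5, h6⟩
      · refine ⟨0, 1, m, u, a, by omega, Near.refl _ _ _, Near.refl _ _ _, hu, ?_, ha, h⟩
        rwa [one_mul]
      · refine ⟨0, m₁ + m₂ + 1, m₃, u, y, by omega, Near.refl _ _ _, Near.refl _ _ _, hu, ?_,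
          h5, h6⟩
        rw [add_mul, add_mul, one_mul, add_comm]
        exact hua.trans (h1.trans h4)

/-- The ladder of levels. At level `i` every pair at distance `r ^ i` is either joined by a walk of
`H` of length `g ≤ (1 + 32 * i / r) * r ^ i`, or both its vertices are close to the sparse set `A`.
For the next level, a path of `r` segments either is replaced segment by segment, or has a first and
a last vertex close to `A`; representatives of these two in `A` are at distance at most
`2 * r ^ (i + 1)`, so that `exists_level` applies to them. The detour over the representatives costs
`32 * r ^ i`. -/
theorem exists_ladder [Finite V] {b L r : ℕ} (hb : 1 ≤ b) (hr : 16 * (L + 1) ≤ r) :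
    ∀ i ≤ L, ∃ (A : Finset V) (H : SimpleGraph V) (g : ℕ), H ≤ G ∧
      A.card * b ^ (2 ^ i - 1) ≤ Nat.card V ∧
      H.edgeSet.ncard ≤ i * (6 * r ^ L * (Nat.card V * b)) ∧
      r ^ i ≤ g ∧ r * g ≤ r ^ i * (r + 32 * i) ∧
      ∀ u v, Near G (r ^ i) u v → Near H g u v ∨
        ((∃ p ∈ A, Near H (8 * r ^ i) u p) ∧ ∃ p ∈ A, Near H (8 * r ^ i) v p) := by
  classical
  have := Fintype.ofFinite V
  intro i
  induction i with
  | zero =>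
    intro _
    refine ⟨Finset.univ, ⊥, 1, bot_le, ?_, by simp, by simp, by simp, ?_⟩
    · simp
    · exact fun u v _ => Or.inr ⟨⟨u, Finset.mem_univ _, Near.refl _ _ _⟩,
        ⟨v, Finset.mem_univ _, Near.refl _ _ _⟩⟩
  | succ i ih =>
    intro hi
    obtain ⟨A, H, g, hHG, hA, hE, hgr, hg, hH⟩ := ih (by omega)
    obtain ⟨A', H', hH'G, hA', hE', hH'⟩ := exists_level (G := G) A (b ^ 2 ^ i) (2 * r ^ (i + 1))
    have hr16 : 16 ≤ r := by omega
    have hri : r ^ (i + 1) = r * r ^ i := pow_succ' r i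
    have hrg : r * g ≤ 3 * r ^ (i + 1) := by
      refine hg.trans ?_
      rw [hri]
      have : r + 32 * i ≤ 3 * r := by omega
      nlinarith [Nat.mul_le_mul_left (r ^ i) this]
    have h16 : 16 * r ^ i ≤ r ^ (i + 1) := by
      rw [hri]; exact Nat.mul_le_mul_right _ hr16
    refine ⟨A', H ⊔ H', r * g + 32 * r ^ i, sup_le hHG hH'G, ?_, ?_, ?_, ?_, ?_⟩
    · have h2 : 2 ^ (i + 1) - 1 = 2 ^ i + (2 ^ i - 1) := by
        have := Nat.one_le_two_pow (n := i)
        rw [pow_succ]; omega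
      rw [h2, pow_add, ← mul_assoc]
      exact (Nat.mul_le_mul_right _ hA').trans hA
    · refine (ncard_edgeSet_sup_le _ _).trans ?_
      rw [add_mul, one_mul]
      refine Nat.add_le_add hE (hE'.trans ?_)
      have hb1 : 1 ≤ b ^ 2 ^ i := Nat.one_le_pow _ _ hb
      have hAb : A.card * b ^ 2 ^ i ≤ Nat.card V * b := by
        have h2 : 2 ^ i = (2 ^ i - 1) + 1 := by
          have := Nat.one_le_two_pow (n := i)
          omega
        rw [h2, pow_succ, ← mul_assoc]
        exact Nat.mul_le_mul_right _ hA
      have hrL : r ^ (i + 1) ≤ r ^ L := Nat.pow_le_pow_right (by omega) hi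
      calc A.card * (b ^ 2 ^ i * (2 * r ^ (i + 1)) + 2 * (2 * r ^ (i + 1)))
          ≤ A.card * (b ^ 2 ^ i * (2 * r ^ (i + 1)) + 2 * (b ^ 2 ^ i * (2 * r ^ (i + 1)))) := by
            exact Nat.mul_le_mul_left _ (Nat.add_le_add_left (Nat.mul_le_mul_left _
              (Nat.le_mul_of_pos_left _ hb1)) _)
        _ = 6 * r ^ (i + 1) * (A.card * b ^ 2 ^ i) := by ring
        _ ≤ 6 * r ^ L * (Nat.card V * b) := by gcongr
    · rw [hri]
      nlinarith
    · calc r * (r * g + 32 * r ^ i) = r * (r * g) + 32 * (r * r ^ i) := by ring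
        _ ≤ r * (r ^ i * (r + 32 * i)) + 32 * (r * r ^ i) := by gcongr
        _ = r ^ (i + 1) * (r + 32 * (i + 1)) := by ring
    · intro u v huv
      rw [hri] at huv
      have hle : ∀ {d : ℕ} {x y : V}, Near H d x y → Near (H ⊔ H') d x y :=
        fun h => h.mono_graph le_sup_left
      rcases segments_dichotomy hH r u v huv with h |
        ⟨m₁, m₂, m₃, x, y, hm, h1, h2, ⟨p, hp, hxp⟩, h4, ⟨q, hq, hyq⟩, h6⟩
      · exact Or.inl ((hle h).mono (by omega))
      · have hm₂ : m₂ * r ^ i ≤ r ^ (i + 1) := by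
          rw [hri]; exact Nat.mul_le_mul_right _ (by omega)
        have hpq : Near G (8 * r ^ i + m₂ * r ^ i + 8 * r ^ i) p q :=
          ((hxp.symm.mono_graph hHG).trans h4).trans (hyq.mono_graph hHG)
        rcases hH' p hp q hq (hpq.mono (by omega)) with hgood | ⟨⟨p', hp', hpp'⟩, q', hq', hqq'⟩
        · left
          have hw := ((((hle h2).trans (hle hxp)).trans
            ((hgood _ hpq).mono_graph le_sup_right)).trans (hle hyq.symm)).trans (hle h6)
          refine hw.mono ?_
          have hm₂g : m₂ * r ^ i ≤ m₂ * g := Nat.mul_le_mul_left _ hgr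
          have hsum : m₁ * g + m₂ * g + m₃ * g = r * g := by rw [← hm]; ring
          omega
        · right
          have hm₁ : m₁ * g ≤ r * g := Nat.mul_le_mul_right _ (by omega)
          have hm₃ : m₃ * g ≤ r * g := Nat.mul_le_mul_right _ (by omega)
          refine ⟨⟨p', hp', (((hle h2).trans (hle hxp)).trans (hpp'.mono_graph le_sup_right)).mono
            ?_⟩, ⟨q', hq', (((hle h6).symm.trans (hle hyq)).trans
            (hqq'.mono_graph le_sup_right)).mono ?_⟩⟩
          · omega
          · omega

/-- A near-additive spanner: a sparse subgraph in which distances grow at most by a factor `3` and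
an additive term. -/
theorem exists_spanner [Finite V] (G : SimpleGraph V) {b L r : ℕ} (hb : 1 ≤ b)
    (hr : 16 * (L + 1) ≤ r) (hL : Nat.card V < b ^ (2 ^ L - 1)) :
    ∃ H ≤ G, H.edgeSet.ncard ≤ L * (6 * r ^ L * (Nat.card V * b)) ∧
      ∀ d u v, Near G d u v → Near H (3 * d + 3 * r ^ L) u v := by
  obtain ⟨A, H, g, hHG, hA, hE, -, hg, hH⟩ := exists_ladder (G := G) hb hr L le_rfl
  refine ⟨H, hHG, hE, ?_⟩
  have hA0 : A = ∅ := by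
    rw [← Finset.card_eq_zero]
    by_contra hne
    have := Nat.mul_le_mul_right (b ^ (2 ^ L - 1)) (Nat.one_le_iff_ne_zero.mpr hne)
    omega
  subst hA0
  have hr0 : 0 < r := by omega
  have hg3 : g ≤ 3 * r ^ L := by
    have h1 : r ^ L * (r + 32 * L) ≤ r ^ L * (3 * r) := Nat.mul_le_mul_left _ (by omega)
    refine Nat.le_of_mul_le_mul_left (c := r) ?_ hr0
    calc r * g ≤ r ^ L * (3 * r) := hg.trans h1
      _ = r * (3 * r ^ L) := by ring
  intro d u v h
  have hseg := segments_dichotomy hH (d / r ^ L + 1) u v (h.mono (by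
    rw [mul_comm]
    exact (Nat.lt_mul_div_succ d (pow_pos hr0 L)).le))
  rcases hseg with h | ⟨-, -, -, -, -, -, -, -, ⟨p, hp, -⟩, -⟩
  · refine h.mono ?_
    have h2 := Nat.div_mul_le_self d (r ^ L)
    calc (d / r ^ L + 1) * g ≤ (d / r ^ L + 1) * (3 * r ^ L) := Nat.mul_le_mul_left _ hg3
      _ = 3 * (d / r ^ L * r ^ L) + 3 * r ^ L := by ring
      _ ≤ 3 * d + 3 * r ^ L := by omega
  · simp at hp

end Spanner

/-! ### Padded clusterings -/

section Clustering

variable {S : Type*} {F : SimpleGraph S}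

/-- Disjoint clusters of radius at most `ρ`: `ctr x` is the center of the cluster of `x`, if there
is one, and each cluster is spanned by a tree of `F` along whose parents the rank decreases. -/
structure Clustering (F : SimpleGraph S) (ρ : ℕ) where
  ctr : S → Option S
  rank : S → ℕ
  rank_le : ∀ x v, ctr x = some v → rank x ≤ ρ
  tree : ∀ x v, ctr x = some v → x = v ∨ ∃ y, F.Adj x y ∧ ctr y = some v ∧ rank y < rank x

/-- The graph `F` without the edges that leave `Y`. -/
def restr (F : SimpleGraph S) (Y : Set S) : SimpleGraph S where
  Adj x y := F.Adj x y ∧ x ∈ Y ∧ y ∈ Y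
  symm := ⟨fun _ _ h => ⟨h.1.symm, h.2.2, h.2.1⟩⟩
  loopless := ⟨fun x h => F.loopless.irrefl x h.1⟩

theorem near_restr_of_walk {Y : Set S} {x y : S} (p : F.Walk x y) (hp : ∀ z ∈ p.support, z ∈ Y) :
    Near (restr F Y) p.length x y := by
  induction p with
  | nil => exact Near.refl _ _ _
  | @cons a b c h p ih =>
    have h1 : (restr F Y).Adj a b := ⟨h, hp a (by simp), hp b (by simp)⟩
    have h2 := ih fun z hz => hp z (by simp [hz])
    rw [SimpleGraph.Walk.length_cons, add_comm]
    exact (Near.of_adj h1).trans h2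

theorem near_restr_of_ball {Y : Set S} {x y : S} {σ : ℕ} (h : Near F σ x y)
    (hY : ∀ z, Near F σ x z → z ∈ Y) : Near (restr F Y) σ x y := by
  classical
  obtain ⟨p, hp⟩ := h
  refine (near_restr_of_walk p fun z hz => hY z ⟨p.takeUntil z hz, ?_⟩).mono hp
  exact (p.length_takeUntil_le_length hz).trans hp

theorem Near.mem_of_restr {Y : Set S} {v x : S} {d : ℕ} (h : Near (restr F Y) d v x)
    (hv : v ∈ Y) : x ∈ Y := by
  obtain ⟨p, -⟩ := h
  induction p with
  | nil => exact hv
  | cons h p ih => exact ih h.2.2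

/-- Ball growing: for some radius, the ball whose radius is larger by two steps contains at most `B`
times as many vertices of `R`. -/
theorem exists_growth_index {B κ N : ℕ} (hκ : 1 ≤ κ) (hN : N ≤ B ^ κ) (f : ℕ → ℕ) (h0 : 1 ≤ f 0)
    (hf : ∀ i, f i ≤ N) : ∃ i < κ, f (i + 1) ≤ B * f i := by
  by_contra! hcon
  have h : ∀ i ≤ κ, B ^ i ≤ f i := by
    intro i
    induction i with
    | zero => simpa using h0
    | succ i ih =>
      intro hi
      rw [pow_succ, mul_comm]
      exact (Nat.mul_le_mul_left _ (ih (by omega))).trans (hcon i (by omega)).le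
  obtain ⟨j, rfl⟩ : ∃ j, κ = j + 1 := ⟨κ - 1, by omega⟩
  have h1 := hcon j (by omega)
  have h2 := Nat.mul_le_mul_left B (h j (by omega))
  have h3 := hf (j + 1)
  rw [pow_succ, mul_comm] at hN
  omega

/-- One clustering in which a fraction `1 / B` of the vertices of `R` is padded, that is, has its
whole ball of radius `σ` in its cluster. The clusters are cut out of `Y` one after another. -/
theorem exists_clustering [Finite S] {B κ σ : ℕ} (hκ : 1 ≤ κ) (hN : Nat.card S ≤ B ^ κ)
    (R : Finset S) : ∀ Y : Set S, (∀ x ∈ R, ∀ y, Near F σ x y → y ∈ Y) →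
    ∃ (C : Clustering F (2 * κ * σ)) (K : Finset S), K ⊆ R ∧ R.card ≤ B * K.card ∧
      (∀ x v, C.ctr x = some v → x ∈ Y) ∧
      ∀ x ∈ K, ∃ v, ∀ y, Near F σ x y → C.ctr y = some v := by
  classical
  have := Fintype.ofFinite S
  induction R using Finset.strongInduction with
  | H R ih =>
    intro Y hY
    rcases R.eq_empty_or_nonempty with rfl | ⟨v, hv⟩
    · exact ⟨⟨fun _ => none, fun _ => 0, by simp, by simp⟩, ∅, by simp⟩
    have hvY : v ∈ Y := hY v hv v (Near.refl _ _ _)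
    set b : ℕ → Finset S := fun i => R.filter (Near (restr F Y) (2 * i * σ) v) with hb
    obtain ⟨i, hi, hgrow⟩ := exists_growth_index hκ hN (fun i => (b i).card)
      (Finset.card_pos.mpr ⟨v, Finset.mem_filter.mpr ⟨hv, Near.refl _ _ _⟩⟩)
      (fun i => by rw [Nat.card_eq_fintype_card]; exact Finset.card_le_univ _)
    have hbb : b i ⊆ b (i + 1) := by
      intro x hx
      rw [Finset.mem_filter] at hx ⊢
      exact ⟨hx.1, hx.2.mono (Nat.mul_le_mul_right _ (by omega))⟩
    set C₀ : Set S := {x | Near (restr F Y) ((2 * i + 1) * σ) v x} with hC₀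
    have hC₀Y : ∀ x ∈ C₀, x ∈ Y := fun x hx => Near.mem_of_restr hx hvY
    have hlt : R \ b (i + 1) ⊂ R := by
      refine Finset.ssubset_iff_subset_ne.mpr ⟨Finset.sdiff_subset, fun h => ?_⟩
      have : v ∈ R \ b (i + 1) := (Finset.ext_iff.mp h v).mpr hv
      exact (Finset.mem_sdiff.mp this).2 (Finset.mem_filter.mpr ⟨hv, Near.refl _ _ _⟩)
    obtain ⟨C, K, hKR, hcard, hCY, hpad⟩ := ih _ hlt (Y \ C₀) (by
      intro x hx y hxy
      rw [Finset.mem_sdiff] at hx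
      refine ⟨hY x hx.1 y hxy, fun hy => hx.2 (Finset.mem_filter.mpr ⟨hx.1, ?_⟩)⟩
      have h1 := near_restr_of_ball hxy (hY x hx.1)
      exact (Near.trans hy h1.symm).mono (by apply le_of_eq; ring))
    have hKC : ∀ y w, C.ctr y = some w → y ∉ C₀ := fun y w hy => (hCY y w hy).2
    refine ⟨⟨fun x => if x ∈ C₀ then some v else C.ctr x,
      fun x => if x ∈ C₀ then (restr F Y).dist v x else C.rank x, ?_, ?_⟩, K ∪ b i, ?_, ?_, ?_, ?_⟩
    · intro x w hx
      split_ifs at hx ⊢ with hxC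
      · refine hxC.dist_le.trans (Nat.mul_le_mul_right _ (by omega))
      · exact C.rank_le x w hx
    · intro x w hx
      by_cases hxC : x ∈ C₀
      · rw [if_pos hxC] at hx
        obtain rfl := Option.some.inj hx
        rcases hd : (restr F Y).dist v x with _ | d
        · left
          exact ((hxC.reachable.dist_eq_zero_iff).mp hd).symm
        · right
          obtain ⟨z, hzx, hz, hzd⟩ := exists_adj_dist hxC.reachable hd
          have hzC : z ∈ C₀ := near_iff.mpr ⟨hz, by have := hxC.dist_le; omega⟩
          refine ⟨z, hzx.1.symm, if_pos hzC, ?_⟩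
          rw [if_pos hzC, if_pos hxC, hzd]
          exact Nat.lt_succ_self d
      · rw [if_neg hxC] at hx
        rcases C.tree x w hx with h | ⟨y, hxy, hy, hr⟩
        · exact Or.inl h
        · refine Or.inr ⟨y, hxy, ?_, ?_⟩
          · rw [if_neg (hKC y w hy), hy]
          · rwa [if_neg (hKC y w hy), if_neg hxC]
    · exact Finset.union_subset (hKR.trans Finset.sdiff_subset) (Finset.filter_subset _ _)
    · have hdis : Disjoint K (b i) := by
        rw [Finset.disjoint_left]
        exact fun x hx hx' => (Finset.mem_sdiff.mp (hKR hx)).2 (hbb hx')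
      rw [Finset.card_union_of_disjoint hdis]
      have h1 := Finset.card_sdiff_add_card_eq_card
        (Finset.filter_subset (Near (restr F Y) (2 * (i + 1) * σ) v) R)
      have h2 : (b (i + 1)).card = (R.filter (Near (restr F Y) (2 * (i + 1) * σ) v)).card := rfl
      have h3 : (R \ b (i + 1)).card =
        (R \ R.filter (Near (restr F Y) (2 * (i + 1) * σ) v)).card := rfl
      rw [mul_add]
      omega
    · intro x w hx
      simp only at hx
      split_ifs at hx with hxC
      · exact hC₀Y x hxC
      · exact (hCY x w hx).1
    · intro x hx
      simp only
      rcases Finset.mem_union.mp hx with hx | hx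
      · obtain ⟨w, hw⟩ := hpad x hx
        exact ⟨w, fun y hy => by rw [if_neg (hKC y w (hw y hy)), hw y hy]⟩
      · rw [Finset.mem_filter] at hx
        refine ⟨v, fun y hy => if_pos ?_⟩
        have h1 := near_restr_of_ball hy (hY x hx.1)
        exact (hx.2.trans h1).mono (by apply le_of_eq; ring)

/-- With `B = m + 1`, this says that `(1 - 1 / B) ^ B ≤ 1 / 2`. -/
theorem two_mul_pow_le (m : ℕ) : 2 * m ^ (m + 1) ≤ (m + 1) ^ (m + 1) := by
  have h : ∀ j, m ^ (j + 1) + (j + 1) * m ^ j ≤ (m + 1) ^ (j + 1) := by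
    intro j
    induction j with
    | zero => simp
    | succ j ih =>
      calc m ^ (j + 1 + 1) + (j + 1 + 1) * m ^ (j + 1)
          ≤ (m ^ (j + 1) + (j + 1) * m ^ j) * (m + 1) := by
            have : (m ^ (j + 1) + (j + 1) * m ^ j) * (m + 1) =
              m ^ (j + 1 + 1) + (j + 1 + 1) * m ^ (j + 1) + (j + 1) * m ^ j := by ring
            omega
        _ ≤ (m + 1) ^ (j + 1) * (m + 1) := Nat.mul_le_mul_right _ ih
        _ = (m + 1) ^ (j + 1 + 1) := (pow_succ _ _).symm
  refine le_trans ?_ (h m)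
  rw [two_mul, pow_succ]
  nlinarith [Nat.zero_le (m ^ m)]

/-- A family of few clusterings such that each vertex is padded in one of them, its home. Each
clustering pads a fraction `1 / B` of the vertices that remain, and `B` of them halve their
number. -/
theorem exists_clusterings [Finite S] {B κ σ : ℕ} (hB : 1 ≤ B) (hκ : 1 ≤ κ)
    (hN : Nat.card S ≤ B ^ κ) :
    ∃ (C : ℕ → Clustering F (2 * κ * σ)) (home : S → ℕ),
      (∀ x, home x < B * (Nat.card S).size) ∧
      ∀ x, ∃ v, ∀ y, Near F σ x y → (C (home x)).ctr y = some v := by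
  classical
  have := Fintype.ofFinite S
  have key : ∀ t : ℕ, ∃ (C : ℕ → Clustering F (2 * κ * σ)) (U : Finset S),
      B ^ t * U.card ≤ (B - 1) ^ t * Nat.card S ∧
      ∀ x ∉ U, ∃ g < t, ∃ v, ∀ y, Near F σ x y → (C g).ctr y = some v := by
    intro t
    induction t with
    | zero =>
      refine ⟨fun _ => ⟨fun _ => none, fun _ => 0, by simp, by simp⟩, Finset.univ, ?_, by simp⟩
      simp
    | succ t ih =>
      obtain ⟨C, U, hU, hC⟩ := ih
      obtain ⟨C', K, hKU, hcard, -, hpad⟩ := exists_clustering (F := F) (σ := σ) hκ hN U Set.univ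
        (by simp)
      refine ⟨Function.update C t C', U \ K, ?_, ?_⟩
      · have h1 := Finset.card_sdiff_add_card_eq_card hKU
        have h2 : B * (U \ K).card ≤ (B - 1) * U.card := by
          obtain ⟨m, rfl⟩ : ∃ m, B = m + 1 := ⟨B - 1, by omega⟩
          rw [Nat.add_sub_cancel]
          nlinarith
        calc B ^ (t + 1) * (U \ K).card = B ^ t * (B * (U \ K).card) := by ring
          _ ≤ B ^ t * ((B - 1) * U.card) := Nat.mul_le_mul_left _ h2
          _ = (B - 1) * (B ^ t * U.card) := by ring
          _ ≤ (B - 1) * ((B - 1) ^ t * Nat.card S) := Nat.mul_le_mul_left _ hU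
          _ = (B - 1) ^ (t + 1) * Nat.card S := by ring
      · intro x hx
        by_cases hxU : x ∈ U
        · have hxK : x ∈ K := by
            by_contra h
            exact hx (Finset.mem_sdiff.mpr ⟨hxU, h⟩)
          exact ⟨t, by omega, by rw [Function.update_self]; exact hpad x hxK⟩
        · obtain ⟨g, hg, h⟩ := hC x hxU
          exact ⟨g, by omega, by rw [Function.update_of_ne (by omega)]; exact h⟩
  obtain ⟨C, U, hU, hC⟩ := key (B * (Nat.card S).size)
  have hU0 : U = ∅ := by
    rw [← Finset.card_eq_zero]
    by_contra hne
    obtain ⟨m, rfl⟩ : ∃ m, B = m + 1 := ⟨B - 1, by omega⟩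
    rw [Nat.add_sub_cancel, pow_mul, pow_mul] at hU
    set s := (Nat.card S).size
    have h1 : Nat.card S < 2 ^ s := Nat.lt_size_self _
    have h2 : 2 ^ s * (m ^ (m + 1)) ^ s ≤ ((m + 1) ^ (m + 1)) ^ s := by
      rw [← mul_pow]
      exact Nat.pow_le_pow_left (two_mul_pow_le m) s
    have h3 : ((m + 1) ^ (m + 1)) ^ s ≤ ((m + 1) ^ (m + 1)) ^ s * U.card :=
      Nat.le_mul_of_pos_right _ (Nat.pos_of_ne_zero hne)
    have h4 : 0 < ((m + 1) ^ (m + 1)) ^ s := by positivity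
    rcases Nat.eq_zero_or_pos ((m ^ (m + 1)) ^ s) with h5 | h5
    · rw [h5, zero_mul] at hU
      omega
    · have h6 := Nat.mul_lt_mul_of_pos_left h1 h5
      rw [mul_comm (2 ^ s)] at h2
      omega
  subst hU0
  choose home hhome hpad using fun x => hC x (by simp)
  exact ⟨C, home, hhome, hpad⟩

end Clustering

/-! ### Nets and pivots -/

section Pivots

variable {V : Type*} {H : SimpleGraph V}

/-- Shortest path trees towards a set `A`: each vertex `x` from which `A` can be reached has a pivot
`piv x` in `A`, a next vertex `nxt x` on a shortest path to `A`, and a distance `ht x` to `A`. -/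
structure PivotForest (H : SimpleGraph V) (A : Finset V) where
  piv : V → V
  nxt : V → V
  ht : V → ℕ
  piv_mem : ∀ x, (∃ a ∈ A, H.Reachable x a) → piv x ∈ A
  piv_self : ∀ x ∈ A, piv x = x
  ht_self : ∀ x ∈ A, ht x = 0
  adj_nxt : ∀ x, (∃ a ∈ A, H.Reachable x a) → x ∉ A → H.Adj x (nxt x)
  piv_nxt : ∀ x, (∃ a ∈ A, H.Reachable x a) → x ∉ A → piv (nxt x) = piv x
  ht_nxt : ∀ x, (∃ a ∈ A, H.Reachable x a) → x ∉ A → ht x = ht (nxt x) + 1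
  ht_le : ∀ x, ∀ a ∈ A, ∀ d, Near H d x a → ht x ≤ d

theorem exists_pivotForest (H : SimpleGraph V) (A : Finset V) : Nonempty (PivotForest H A) := by
  classical
  set ht : V → ℕ := fun x => sInf {d | ∃ a ∈ A, Near H d x a} with hht
  have hle : ∀ x, ∀ a ∈ A, ∀ d, Near H d x a → ht x ≤ d :=
    fun x a ha d hd => Nat.sInf_le ⟨a, ha, hd⟩
  have hex : ∀ x, (∃ a ∈ A, H.Reachable x a) → ∃ a ∈ A, Near H (ht x) x a := by
    rintro x ⟨a, ha, hr⟩
    exact Nat.sInf_mem (s := {d | ∃ a ∈ A, Near H d x a}) ⟨_, a, ha, near_dist hr⟩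
  have hself : ∀ x ∈ A, ht x = 0 := fun x hx => Nat.le_zero.mp (hle x x hx 0 (Near.refl _ _ _))
  have hstep : ∀ x, ∃ y, (∃ a ∈ A, H.Reachable x a) → x ∉ A → H.Adj x y ∧ ht x = ht y + 1 := by
    intro x
    by_cases hx : (∃ a ∈ A, H.Reachable x a) ∧ x ∉ A
    · obtain ⟨a, ha, p, hp⟩ := hex x hx.1
      cases p with
      | nil => exact absurd ha hx.2
      | @cons _ y _ h p =>
        rw [SimpleGraph.Walk.length_cons] at hp
        refine ⟨y, fun _ _ => ⟨h, le_antisymm ?_ ?_⟩⟩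
        · obtain ⟨a', ha', hn⟩ := hex y ⟨a, ha, p.reachable⟩
          have := hle x a' ha' _ ((Near.of_adj h).trans hn)
          omega
        · have := hle y a ha p.length ⟨p, le_rfl⟩
          omega
    · exact ⟨x, fun h1 h2 => absurd ⟨h1, h2⟩ hx⟩
  choose nxt hnxt using hstep
  have hmem : ∀ d x, (∃ a ∈ A, H.Reachable x a) → ht x = d → nxt^[d] x ∈ A := by
    intro d
    induction d with
    | zero =>
      intro x hx hd
      obtain ⟨a, ha, p, hp⟩ := hex x hx
      rw [hd] at hp
      have := SimpleGraph.Walk.eq_of_length_eq_zero (p := p) (by omega)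
      rw [Function.iterate_zero, id, this]
      exact ha
    | succ d ih =>
      intro x hx hd
      have hxA : x ∉ A := fun h => by have := hself x h; omega
      obtain ⟨h1, h2⟩ := hnxt x hx hxA
      obtain ⟨a, ha, hr⟩ := hx
      rw [Function.iterate_succ_apply]
      exact ih (nxt x) ⟨a, ha, h1.symm.reachable.trans hr⟩ (by omega)
  refine ⟨⟨fun x => nxt^[ht x] x, nxt, ht, fun x hx => hmem _ x hx rfl, ?_, hself,
    fun x hx hxA => (hnxt x hx hxA).1, ?_, fun x hx hxA => (hnxt x hx hxA).2, hle⟩⟩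
  · intro x hx
    simp only [hself x hx, Function.iterate_zero, id]
  · intro x hx hxA
    rw [(hnxt x hx hxA).2, Function.iterate_succ_apply]

theorem PivotForest.reachable_nxt {A : Finset V} (P : PivotForest H A) {x : V}
    (hx : ∃ a ∈ A, H.Reachable x a) (hxA : x ∉ A) : ∃ a ∈ A, H.Reachable (P.nxt x) a := by
  have h := P.adj_nxt x hx hxA
  obtain ⟨a, ha, hr⟩ := hx
  exact ⟨a, ha, h.symm.reachable.trans hr⟩

theorem PivotForest.near {A : Finset V} (P : PivotForest H A) (d : ℕ) :
    ∀ x, (∃ a ∈ A, H.Reachable x a) → P.ht x = d → Near H d x (P.piv x) := by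
  induction d with
  | zero =>
    intro x hx hd
    have hxA : x ∈ A := by
      by_contra h
      have := P.ht_nxt x hx h
      omega
    rw [P.piv_self x hxA]
    exact Near.refl _ _ _
  | succ d ih =>
    intro x hx hd
    have hxA : x ∉ A := fun h => by have := P.ht_self x h; omega
    rw [← P.piv_nxt x hx hxA, add_comm]
    exact (Near.of_adj (P.adj_nxt x hx hxA)).trans
      (ih _ (P.reachable_nxt hx hxA) (by have := P.ht_nxt x hx hxA; omega))

end Pivots

section Nets

open Classical in
/-- The vertices at distance less than `R` from `v`. -/
noncomputable def ballF {V : Type*} [Fintype V] (H : SimpleGraph V) (v : V) (R : ℕ) : Finset V :=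
  Finset.univ.filter fun x => H.Reachable v x ∧ H.dist v x < R

open Classical in
/-- The sum of the degrees of a set of vertices. -/
noncomputable def vol {V : Type*} [Fintype V] (H : SimpleGraph V) (K : Finset V) : ℕ :=
  ∑ x ∈ K, H.degree x

variable {V : Type*} [Fintype V] {H : SimpleGraph V}

theorem mem_ballF {v x : V} {R : ℕ} : x ∈ ballF H v R ↔ H.Reachable v x ∧ H.dist v x < R := by
  simp [ballF]

theorem vol_mono {K K' : Finset V} (h : K ⊆ K') : vol H K ≤ vol H K' :=
  Finset.sum_le_sum_of_subset h

theorem vol_univ : vol H Finset.univ = 2 * H.edgeSet.ncard := by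
  classical
  rw [vol, SimpleGraph.sum_degrees_eq_twice_card_edges, ← SimpleGraph.coe_edgeFinset,
    Set.ncard_coe_finset]

theorem card_ballF_le (v : V) (R : ℕ) : (ballF H v R).card ≤ vol H (ballF H v R) + 1 := by
  classical
  have h1 : ((ballF H v R).erase v).card ≤ vol H (ballF H v R) := by
    rw [Finset.card_eq_sum_ones]
    refine (Finset.sum_le_sum fun x hx => ?_).trans
      (vol_mono (H := H) (Finset.erase_subset v (ballF H v R)))
    rw [Finset.mem_erase, mem_ballF] at hx
    obtain ⟨p⟩ := hx.2.1.symm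
    cases p with
    | nil => exact absurd rfl hx.1
    | cons h _ => exact (SimpleGraph.degree_pos_iff_exists_adj _ _).mpr ⟨_, h⟩
  have h2 := Finset.pred_card_le_card_erase (s := ballF H v R) (a := v)
  omega

/-- The radius up to which a local search can go: either one more step would exceed the volume `D`,
or the search exhausts the component. -/
theorem exists_radius (H : SimpleGraph V) (D : ℕ) (v : V) : ∃ R, vol H (ballF H v R) ≤ D ∧
    (D < vol H (ballF H v (R + 1)) ∨ ∀ x, H.Reachable v x → H.dist v x < R) := by
  classical
  by_cases h : ∃ R, D < vol H (ballF H v R)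
  · have hpos : Nat.find h ≠ 0 := by
      intro h0
      have := Nat.find_spec h
      rw [h0] at this
      have h1 : ballF H v 0 = ∅ := by ext x; simp [mem_ballF]
      rw [h1] at this
      simp [vol] at this
    refine ⟨Nat.find h - 1, ?_, Or.inl ?_⟩
    · have := Nat.find_min h (m := Nat.find h - 1) (by omega)
      omega
    · rw [Nat.sub_add_cancel (by omega)]
      exact Nat.find_spec h
  · rw [not_exists] at h
    refine ⟨Finset.univ.sup (H.dist v) + 1, not_lt.mp (h _), Or.inr fun x _ => ?_⟩
    exact Nat.lt_succ_of_le (Finset.le_sup (f := H.dist v) (Finset.mem_univ x))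

/-- A net with respect to volume: few vertices such that each vertex whose search is stopped at
radius `Rad v` because of the volume has one within distance `2 * Rad v`. -/
theorem exists_volume_net (H : SimpleGraph V) (D : ℕ) (Rad : V → ℕ) :
    ∃ A : Finset V, A.card * (D + 1) ≤ 2 * H.edgeSet.ncard ∧
      ∀ v, D < vol H (ballF H v (Rad v + 1)) → ∃ a ∈ A, Near H (2 * Rad v) v a := by
  classical
  obtain ⟨A, hA, hind, hcov⟩ := exists_packing Rad
    (fun a c => ¬ Disjoint (ballF H a (Rad a + 1)) (ballF H c (Rad c + 1)))
    (fun a c h hd => h hd.symm)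
    (Finset.univ.filter fun v => D < vol H (ballF H v (Rad v + 1)))
  refine ⟨A, ?_, ?_⟩
  · have h1 : vol H (A.biUnion fun a => ballF H a (Rad a + 1)) =
        ∑ a ∈ A, vol H (ballF H a (Rad a + 1)) := by
      refine Finset.sum_biUnion fun a ha c hc hac => ?_
      have := hind a ha c hc hac
      rwa [not_not] at this
    calc A.card * (D + 1) = ∑ _a ∈ A, (D + 1) := by rw [Finset.sum_const, smul_eq_mul]
      _ ≤ ∑ a ∈ A, vol H (ballF H a (Rad a + 1)) :=
        Finset.sum_le_sum fun a ha => (Finset.mem_filter.mp (hA ha)).2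
      _ ≤ vol H Finset.univ := by
        rw [← h1]
        exact vol_mono (Finset.subset_univ _)
      _ = _ := vol_univ
  · intro v hv
    obtain ⟨a, ha, hva, hR⟩ := hcov v (by simpa using hv)
    refine ⟨a, ha, ?_⟩
    rcases hva with rfl | hva
    · exact Near.refl _ _ _
    · obtain ⟨x, hx, hx'⟩ := Finset.not_disjoint_iff.mp hva
      rw [mem_ballF] at hx hx'
      have h1 : Near H (Rad v) v x := near_iff.mpr ⟨hx.1, by omega⟩
      have h2 : Near H (Rad v) a x := near_iff.mpr ⟨hx'.1, by omega⟩
      have := h1.trans h2.symm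
      rwa [← two_mul] at this

open Classical in
/-- The component of a vertex. -/
noncomputable def compF (H : SimpleGraph V) (v : V) : Finset V :=
  Finset.univ.filter fun x => H.Reachable v x

theorem mem_compF {v x : V} : x ∈ compF H v ↔ H.Reachable v x := by simp [compF]

theorem compF_eq {u v : V} (h : H.Reachable u v) : compF H u = compF H v := by
  ext x
  rw [mem_compF, mem_compF]
  exact ⟨fun h' => h.symm.trans h', fun h' => h.trans h'⟩

open Classical in
/-- In a component with more than `l` vertices, balls of radius `l` have more than `l` vertices. -/
theorem lt_card_ball {l : ℕ} {x : V} (h : l < (compF H x).card) :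
    l < (Finset.univ.filter fun y => Near H l x y).card := by
  have key : ∀ i ≤ l, i < (Finset.univ.filter fun y => Near H i x y).card := by
    intro i
    induction i with
    | zero =>
      intro _
      exact Finset.card_pos.mpr ⟨x, by simpa using Near.refl _ _ _⟩
    | succ i ih =>
      intro hi
      have h1 := ih (by omega)
      have hsub : (Finset.univ.filter fun y => Near H i x y) ⊆
          Finset.univ.filter fun y => Near H (i + 1) x y := by
        intro y hy
        simp only [Finset.mem_filter, Finset.mem_univ, true_and] at hy ⊢
        exact hy.mono (by omega)
      by_contra hcon
      have heq := Finset.eq_of_subset_of_card_le hsub (by omega)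
      have hall : ∀ (d : ℕ) (y : V), Near H d x y → Near H i x y := by
        intro d
        induction d with
        | zero => exact fun y hy => hy.mono (by omega)
        | succ d ihd =>
          intro y hy
          obtain ⟨z, hz, hzy⟩ := hy.split
          have h2 := (ihd z hz).trans hzy
          have h3 : y ∈ Finset.univ.filter fun y => Near H (i + 1) x y := by simpa using h2
          rw [← heq] at h3
          simpa using h3
      have hcomp : compF H x ⊆ Finset.univ.filter fun y => Near H i x y := by
        intro y hy
        rw [mem_compF] at hy
        simpa using hall _ y (near_dist hy)
      have := Finset.card_le_card hcomp
      rw [heq] at this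
      omega
  exact key l le_rfl

/-- A net with respect to distance for the vertices in components with more than `l` vertices. -/
theorem exists_distance_net (H : SimpleGraph V) (l : ℕ) :
    ∃ A : Finset V, A.card * (l + 1) ≤ Fintype.card V ∧
      ∀ v, l < (compF H v).card → ∃ a ∈ A, Near H (2 * l) v a := by
  classical
  obtain ⟨A, hA, hind, hcov⟩ := exists_packing (fun _ => 0)
    (fun a c => ¬ Disjoint (Finset.univ.filter fun y => Near H l a y)
      (Finset.univ.filter fun y => Near H l c y))
    (fun a c h hd => h hd.symm) (Finset.univ.filter fun v => l < (compF H v).card)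
  refine ⟨A, ?_, ?_⟩
  · have h1 : (A.biUnion fun a => Finset.univ.filter fun y => Near H l a y).card =
        ∑ a ∈ A, (Finset.univ.filter fun y => Near H l a y).card := by
      refine Finset.card_biUnion fun a ha c hc hac => ?_
      have := hind a ha c hc hac
      rwa [not_not] at this
    calc A.card * (l + 1) = ∑ _a ∈ A, (l + 1) := by rw [Finset.sum_const, smul_eq_mul]
      _ ≤ ∑ a ∈ A, (Finset.univ.filter fun y => Near H l a y).card :=
        Finset.sum_le_sum fun a ha => lt_card_ball (Finset.mem_filter.mp (hA ha)).2
      _ ≤ Fintype.card V := by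
        rw [← h1]
        exact Finset.card_le_univ _
  · intro v hv
    obtain ⟨a, ha, hva, -⟩ := hcov v (by simpa using hv)
    refine ⟨a, ha, ?_⟩
    rcases hva with rfl | hva
    · exact Near.refl _ _ _
    · obtain ⟨x, hx, hx'⟩ := Finset.not_disjoint_iff.mp hva
      simp only [Finset.mem_filter, Finset.mem_univ, true_and] at hx hx'
      have := hx.trans hx'.symm
      rwa [← two_mul] at this

/-- A component with at most `l` vertices has volume at most `l ^ 2`. -/
theorem lt_card_compF {l D R : ℕ} {v : V} (hl : l * l ≤ D) (h : D < vol H (ballF H v R)) :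
    l < (compF H v).card := by
  classical
  by_contra hcon
  have hsub : ballF H v R ⊆ compF H v := fun x hx => mem_compF.mpr (mem_ballF.mp hx).1
  have h1 : vol H (compF H v) ≤ (compF H v).card * l := by
    rw [← smul_eq_mul]
    refine Finset.sum_le_card_nsmul _ _ _ fun x hx => ?_
    rw [mem_compF] at hx
    rw [← SimpleGraph.card_neighborFinset_eq_degree]
    refine (Finset.card_le_card fun y hy => ?_).trans (not_lt.mp hcon)
    rw [SimpleGraph.mem_neighborFinset] at hy
    exact mem_compF.mpr (hx.trans hy.reachable)
  have h2 := vol_mono (H := H) hsub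
  have h3 : (compF H v).card * l ≤ l * l := Nat.mul_le_mul_right _ (not_lt.mp hcon)
  omega

end Nets

/-! ### Clusters of net points at one scale -/

/-- A clustering of the net `A` in `m` slots. In slot `g`, the point `x` belongs to the cluster with
center `ctr g x`, which is spanned by a tree with parent function `par g`; the pairs of a point
and its parent are collected in `used` and have distance at most `len` in `H`. -/
structure SlotClusters {V : Type*} (H : SimpleGraph V) (A : Finset V) (m ρ len : ℕ) where
  ctr : ℕ → V → Option V
  par : ℕ → V → V
  rank : ℕ → V → ℕ
  home : V → ℕ
  used : Finset (V × V)
  home_lt : ∀ x, home x < m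
  mem_net : ∀ g x v, ctr g x = some v → x ∈ A
  rank_le : ∀ g x v, ctr g x = some v → rank g x ≤ ρ
  tree : ∀ g < m, ∀ x v, ctr g x = some v → x = v ∨
    ((x, par g x) ∈ used ∧ ctr g (par g x) = some v ∧ rank g (par g x) < rank g x)
  used_near : ∀ p ∈ used, p.1 ≠ p.2 ∧ Near H len p.1 p.2
  home_ctr : ∀ x ∈ A, ctr (home x) x ≠ none

section Scales

variable {V : Type*} {H : SimpleGraph V}

/-- Padded clusterings of a graph `F` on the net whose edges join points at distance at most `len`.
The used pairs are counted in two ways: at most one for each point and slot, and at most two for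
each edge of `F`. -/
theorem exists_slotClusters {A : Finset V} {F : SimpleGraph A} {len B κ σ m : ℕ}
    (hF : ∀ x y, F.Adj x y → Near H len x y) (hB : 1 ≤ B) (hκ : 1 ≤ κ) (hA : A.card ≤ B ^ κ)
    (hm : B * A.card.size ≤ m) (hm1 : 1 ≤ m) :
    ∃ C : SlotClusters H A m (2 * κ * σ) len, C.used.card ≤ A.card * m ∧
      C.used.card ≤ 2 * F.edgeSet.ncard ∧
      ∀ x y : A, Near F σ x y → C.ctr (C.home x) x = C.ctr (C.home x) y := by
  classical
  obtain ⟨C, home, hhome, hpad⟩ := exists_clusterings (F := F) (σ := σ) hB hκ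
    (by rwa [Nat.card_eq_fintype_card, Fintype.card_coe])
  rw [Nat.card_eq_fintype_card, Fintype.card_coe] at hhome
  have htree : ∀ g (x : A), ∃ y : A, ∀ v, (C g).ctr x = some v → x = v ∨
      (F.Adj x y ∧ (C g).ctr y = some v ∧ (C g).rank y < (C g).rank x) := by
    intro g x
    rcases hc : (C g).ctr x with _ | v
    · exact ⟨x, fun v h => by simp at h⟩
    · rcases (C g).tree x v hc with h | ⟨y, hy⟩
      · refine ⟨x, fun w hw => Or.inl ?_⟩
        rw [h]
        exact Option.some.inj hw
      · refine ⟨y, fun w hw => Or.inr ?_⟩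
        rw [← Option.some.inj hw]
        exact hy
  choose par hpar using htree
  -- the pairs of a point and its parent, over all slots
  set U : Finset (A × A) := ((Finset.univ ×ˢ Finset.range m).image fun p : A × ℕ =>
    (p.1, par p.2 p.1)).filter fun p => F.Adj p.1 p.2 with hU
  have hUcard : (U.map (Function.Embedding.prodMap (Function.Embedding.subtype _)
      (Function.Embedding.subtype _))).card = U.card := Finset.card_map _
  set e : A × A ↪ V × V := Function.Embedding.prodMap (Function.Embedding.subtype _)
      (Function.Embedding.subtype _) with he
  refine ⟨{
    ctr := fun g x => if h : x ∈ A then ((C g).ctr ⟨x, h⟩).map Subtype.val else none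
    par := fun g x => if h : x ∈ A then par g ⟨x, h⟩ else x
    rank := fun g x => if h : x ∈ A then (C g).rank ⟨x, h⟩ else 0
    home := fun x => if h : x ∈ A then home ⟨x, h⟩ else 0
    used := U.map e
    home_lt := ?_
    mem_net := ?_
    rank_le := ?_
    tree := ?_
    used_near := ?_
    home_ctr := ?_ }, ?_, ?_, ?_⟩
  · intro x
    by_cases h : x ∈ A
    · simp only [h, dif_pos]
      exact (hhome _).trans_le hm
    · simp only [h, dif_neg, not_false_eq_true]
      exact hm1
  · intro g x v h
    by_contra hx
    simp [hx] at h
  · intro g x v h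
    by_cases hx : x ∈ A
    · simp only [hx, dif_pos, Option.map_eq_some_iff] at h ⊢
      obtain ⟨w, hw, -⟩ := h
      exact (C g).rank_le _ _ hw
    · simp [hx] at h
  · intro g hg x v h
    by_cases hx : x ∈ A
    · simp only [hx, dif_pos, Option.map_eq_some_iff] at h ⊢
      obtain ⟨w, hw, rfl⟩ := h
      rcases hpar g ⟨x, hx⟩ w hw with h1 | ⟨h1, h2, h3⟩
      · exact Or.inl (by rw [← h1])
      · refine Or.inr ⟨?_, ?_, ?_⟩
        · rw [Finset.mem_map]
          refine ⟨(⟨x, hx⟩, par g ⟨x, hx⟩), ?_, rfl⟩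
          rw [hU, Finset.mem_filter, Finset.mem_image]
          exact ⟨⟨(⟨x, hx⟩, g), by simpa using hg, rfl⟩, h1⟩
        · simp [h2]
        · simpa using h3
    · simp [hx] at h
  · intro p hp
    rw [Finset.mem_map] at hp
    obtain ⟨q, hq, rfl⟩ := hp
    have h1 := (Finset.mem_filter.mp hq).2
    exact ⟨fun h => h1.ne (Subtype.ext h), hF _ _ h1⟩
  · intro x hx
    obtain ⟨v, hv⟩ := hpad ⟨x, hx⟩
    simp [hx, hv _ (Near.refl _ _ _)]
  · refine (Finset.card_map _).le.trans ((Finset.card_filter_le _ _).trans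
      (Finset.card_image_le.trans ?_))
    simp
  · refine (Finset.card_map _).le.trans ?_
    rw [← SimpleGraph.coe_edgeFinset, Set.ncard_coe_finset,
      ← SimpleGraph.dart_card_eq_twice_card_edges, ← Finset.card_univ]
    refine (Finset.card_le_card fun p hp => ?_).trans
      (Finset.card_image_le (f := SimpleGraph.Dart.toProd))
    rw [Finset.mem_image]
    exact ⟨⟨p, (Finset.mem_filter.mp hp).2⟩, Finset.mem_univ _, rfl⟩
  · intro x y h
    obtain ⟨v, hv⟩ := hpad x
    simp [hv _ h, hv _ (Near.refl _ _ _)]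

/-- What is stored for one scale `t = 2 ^ j`: a net with pivots and a clustering of the net such
that, for pairs of vertices of distance `d > Rad v`, the pivots are close if `t ≤ 2 * d`, and they
share the home cluster of the first one if `d ≤ t`. -/
structure Scale (H : SimpleGraph V) (Rad : V → ℕ) (m κ t : ℕ) where
  net : Finset V
  forest : PivotForest H net
  ρ : ℕ
  len : ℕ
  clusters : SlotClusters H net m ρ len
  cover : ∀ u v, H.Reachable v u → Rad v < H.dist v u →
    (∃ a ∈ net, H.Reachable u a) ∧ ∃ a ∈ net, H.Reachable v a
  meet : ∀ u v, H.Reachable v u → Rad v < H.dist v u → H.dist v u ≤ t →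
    clusters.ctr (clusters.home (forest.piv u)) (forest.piv u) =
      clusters.ctr (clusters.home (forest.piv u)) (forest.piv v)
  ht_le : ∀ u v, H.Reachable v u → Rad v < H.dist v u → t ≤ 2 * H.dist v u →
    forest.ht u ≤ 4 * H.dist v u ∧ forest.ht v ≤ 4 * H.dist v u
  radius_le : ρ * len ≤ 90 * κ * t

/-- At small scales, the net is the one with respect to volume. Pivots of vertices at distance
`d ≤ t` are at distance at most `6 * t`, since `Rad v < d`. -/
theorem exists_scale_of_lt [Fintype V] {Rad : V → ℕ} {D B κ Y t s : ℕ} (hB : 1 ≤ B) (hκ : 1 ≤ κ)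
    (hRad : ∀ v, D < vol H (ballF H v (Rad v + 1)) ∨ ∀ x, H.Reachable v x → H.dist v x < Rad v)
    (hD : B * B ≤ D) (hn : Fintype.card V ≤ B ^ κ) (hs : (Fintype.card V).size ≤ s) (hs1 : 1 ≤ s)
    (hY : 1 ≤ Y) (ht : t < Y * B) :
    ∃ S : Scale H Rad (B * s) κ t, S.len ≤ 6 * t + 5 * B ∧
      4 * (B * s) * S.net.card + S.clusters.used.card * S.len ≤
        20 * H.edgeSet.ncard * Y * s := by
  classical
  obtain ⟨A, hA, hcov⟩ := exists_volume_net H D Rad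
  have hfar : ∀ u v, H.Reachable v u → Rad v < H.dist v u →
      ∃ a ∈ A, Near H (2 * Rad v) v a := by
    intro u v hr hd
    refine hcov v ((hRad v).resolve_right fun h => ?_)
    have := h u hr
    omega
  obtain ⟨P⟩ := exists_pivotForest H A
  have hht : ∀ u v, H.Reachable v u → Rad v < H.dist v u →
      P.ht u ≤ 3 * H.dist v u ∧ P.ht v ≤ 2 * H.dist v u := by
    intro u v hr hd
    obtain ⟨a, ha, h⟩ := hfar u v hr hd
    have h1 := P.ht_le v a ha _ h
    have h2 := P.ht_le u a ha _ ((near_dist hr).symm.trans h)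
    omega
  have hcover : ∀ u v, H.Reachable v u → Rad v < H.dist v u →
      (∃ a ∈ A, H.Reachable u a) ∧ ∃ a ∈ A, H.Reachable v a := by
    intro u v hr hd
    obtain ⟨a, ha, h⟩ := hfar u v hr hd
    exact ⟨⟨a, ha, hr.symm.trans h.reachable⟩, ⟨a, ha, h.reachable⟩⟩
  let F : SimpleGraph A :=
    { Adj := fun x y => x ≠ y ∧ Near H (6 * t) x y
      symm := ⟨fun _ _ h => ⟨h.1.symm, h.2.symm⟩⟩
      loopless := ⟨fun _ h => h.1 rfl⟩ }
  have hcard : A.card ≤ Fintype.card V := A.card_le_univ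
  obtain ⟨C, hC1, -, hC⟩ := exists_slotClusters (H := H) (F := F) (len := 6 * t) (σ := 1)
    (m := B * s) (fun _ _ h => h.2) hB hκ (hcard.trans hn)
    (Nat.mul_le_mul_left _ ((Nat.size_le_size hcard).trans hs)) (Nat.mul_pos hB hs1)
  refine ⟨⟨A, P, _, _, C, hcover, ?_, ?_, ?_⟩, ?_, ?_⟩
  · intro u v hr hd hdt
    obtain ⟨h1, h2⟩ := hcover u v hr hd
    obtain ⟨h3, h4⟩ := hht u v hr hd
    refine hC ⟨_, P.piv_mem u h1⟩ ⟨_, P.piv_mem v h2⟩ ?_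
    by_cases heq : P.piv u = P.piv v
    · have : (⟨_, P.piv_mem u h1⟩ : A) = ⟨_, P.piv_mem v h2⟩ := Subtype.ext heq
      rw [this]
      exact Near.refl _ _ _
    · refine Near.of_adj ⟨fun h => heq (congrArg Subtype.val h), ?_⟩
      refine (((P.near _ u h1 rfl).symm.trans (near_dist hr).symm).trans
        (P.near _ v h2 rfl)).mono ?_
      omega
  · intro u v hr hd _
    have := hht u v hr hd
    omega
  · nlinarith [Nat.zero_le (κ * t)]
  · exact Nat.le_add_right _ _
  · have h1 : A.card * B * B ≤ 2 * H.edgeSet.ncard := by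
      calc A.card * B * B = A.card * (B * B) := by ring
        _ ≤ A.card * (D + 1) := Nat.mul_le_mul_left _ (by omega)
        _ ≤ _ := hA
    have h2 : A.card * B ≤ 2 * H.edgeSet.ncard := by nlinarith
    calc 4 * (B * s) * A.card + C.used.card * (6 * t)
        ≤ 4 * (B * s) * A.card + A.card * (B * s) * (6 * (Y * B)) := by gcongr
      _ = 4 * s * (A.card * B) + 6 * s * Y * (A.card * B * B) := by ring
      _ ≤ 4 * s * (2 * H.edgeSet.ncard) + 6 * s * Y * (2 * H.edgeSet.ncard) := by gcongr
      _ ≤ 4 * s * (2 * H.edgeSet.ncard) * Y + 6 * s * Y * (2 * H.edgeSet.ncard) := by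
        exact Nat.add_le_add_right (Nat.le_mul_of_pos_right _ hY) _
      _ = _ := by ring

/-- Pivots of the vertices of a walk form a walk in the graph which joins net points that are close
to each other. -/
theorem near_pivots {A : Finset V} (P : PivotForest H A) {B h : ℕ} {x : V}
    (hx : ∃ a ∈ A, H.Reachable x a) (hht : ∀ w, H.Reachable x w → P.ht w ≤ h)
    {G' : SimpleGraph A} (hG' : ∀ x y : A, x ≠ y → Near H (2 * h + B) x y → G'.Adj x y) (i : ℕ) :
    ∀ {y} (_ : Near H (i * B) x y) (hy : ∃ a ∈ A, H.Reachable y a),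
      Near G' i ⟨P.piv x, P.piv_mem x hx⟩ ⟨P.piv y, P.piv_mem y hy⟩ := by
  induction i with
  | zero =>
    intro y hxy hy
    rw [zero_mul] at hxy
    obtain ⟨p, hp⟩ := hxy
    obtain rfl := SimpleGraph.Walk.eq_of_length_eq_zero (p := p) (by omega)
    exact Near.refl _ _ _
  | succ i ih =>
    intro y hxy hy
    rw [Nat.succ_mul] at hxy
    obtain ⟨z, hz, hzy⟩ := hxy.split
    have hz' : ∃ a ∈ A, H.Reachable z a := by
      obtain ⟨a, ha, hr⟩ := hx
      exact ⟨a, ha, hz.symm.reachable.trans hr⟩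
    refine (ih hz hz').trans ?_
    by_cases heq : P.piv z = P.piv y
    · have : (⟨_, P.piv_mem z hz'⟩ : A) = ⟨_, P.piv_mem y hy⟩ := Subtype.ext heq
      rw [this]
      exact Near.refl _ _ _
    · refine Near.of_adj (hG' _ _ (fun h => heq (congrArg Subtype.val h)) ?_)
      refine (((P.near _ z hz' rfl).symm.trans hzy).trans (P.near _ y hy rfl)).mono ?_
      have h1 := hht z hz.reachable
      have h2 := hht y hxy.reachable
      omega

/-- At large scales, the net is the one with respect to distance, and the clusters are those of a
spanner of the graph which joins net points that are close to each other. -/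
theorem exists_scale_of_le [Fintype V] {Rad : V → ℕ} {D B κ b L r t s : ℕ} (hB : 1 ≤ B)
    (hκ : 1 ≤ κ)
    (hRad : ∀ v, D < vol H (ballF H v (Rad v + 1)) ∨ ∀ x, H.Reachable v x → H.dist v x < Rad v)
    (hD : B * B ≤ D) (hn : Fintype.card V ≤ B ^ κ) (hs : (Fintype.card V).size ≤ s) (hs1 : 1 ≤ s)
    (hb : 1 ≤ b) (hL1 : 1 ≤ L) (hr : 16 * (L + 1) ≤ r) (hL : Fintype.card V < b ^ (2 ^ L - 1))
    (ht : r ^ L * B ≤ t) :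
    ∃ S : Scale H Rad (B * s) κ t, S.len ≤ 6 * t + 5 * B ∧
      4 * (B * s) * S.net.card + S.clusters.used.card * S.len ≤
        64 * L * r ^ L * b * Fintype.card V * s := by
  classical
  obtain ⟨A, hA, hcov⟩ := exists_distance_net H B
  have hfar : ∀ u v, H.Reachable v u → Rad v < H.dist v u → ∀ w, H.Reachable v w →
      ∃ a ∈ A, Near H (2 * B) w a := by
    intro u v hr hd w hw
    refine hcov w ?_
    rw [← compF_eq hw]
    refine lt_card_compF hD ((hRad v).resolve_right fun h => ?_)
    have := h u hr
    omega
  obtain ⟨P⟩ := exists_pivotForest H A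
  have hht : ∀ u v, H.Reachable v u → Rad v < H.dist v u → ∀ w, H.Reachable v w →
      P.ht w ≤ 2 * B := by
    intro u v hr hd w hw
    obtain ⟨a, ha, h⟩ := hfar u v hr hd w hw
    exact P.ht_le w a ha _ h
  have hreach : ∀ u v, H.Reachable v u → Rad v < H.dist v u → ∀ w, H.Reachable v w →
      ∃ a ∈ A, H.Reachable w a := by
    intro u v hr hd w hw
    obtain ⟨a, ha, h⟩ := hfar u v hr hd w hw
    exact ⟨a, ha, h.reachable⟩
  let G' : SimpleGraph A :=
    { Adj := fun x y => x ≠ y ∧ Near H (5 * B) x y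
      symm := ⟨fun _ _ h => ⟨h.1.symm, h.2.symm⟩⟩
      loopless := ⟨fun _ h => h.1 rfl⟩ }
  have hcard : A.card ≤ Fintype.card V := A.card_le_univ
  have hY : 1 ≤ r ^ L := Nat.pos_of_ne_zero (pow_ne_zero _ (by omega))
  obtain ⟨F, hFG, hF1, hF⟩ := exists_spanner G' hb hr (by
    rw [Nat.card_eq_fintype_card, Fintype.card_coe]
    exact hcard.trans_lt hL)
  rw [Nat.card_eq_fintype_card, Fintype.card_coe] at hF1
  obtain ⟨C, -, hC2, hC⟩ := exists_slotClusters (H := H) (F := F) (len := 5 * B)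
    (σ := 3 * (t / B + 1) + 3 * r ^ L)
    (m := B * s) (fun _ _ h => (hFG h).2) hB hκ (hcard.trans hn)
    (Nat.mul_le_mul_left _ ((Nat.size_le_size hcard).trans hs)) (Nat.mul_pos hB hs1)
  have hBt : B ≤ t := (Nat.le_mul_of_pos_left _ hY).trans ht
  refine ⟨⟨A, P, _, _, C, ?_, ?_, ?_, ?_⟩, ?_, ?_⟩
  · intro u v hr hd
    exact ⟨hreach u v hr hd u hr, hreach u v hr hd v (SimpleGraph.Reachable.refl _)⟩
  · intro u v hr hd hdt
    have h1 := hreach u v hr hd u hr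
    have h2 := hreach u v hr hd v (SimpleGraph.Reachable.refl _)
    refine hC ⟨_, P.piv_mem u h1⟩ ⟨_, P.piv_mem v h2⟩ (hF _ _ _ ?_)
    refine near_pivots (G' := G') P h1 (fun w hw => hht u v hr hd w (hr.trans hw)) (B := B)
      (h := 2 * B) (fun x y hxy h => ⟨hxy, h.mono (by omega)⟩) _ ?_ h2
    refine (near_dist hr).symm.mono (hdt.trans ?_)
    have := Nat.div_add_mod t B
    have := Nat.mod_lt t hB
    nlinarith
  · intro u v hr hd h
    have h1 := hht u v hr hd u hr
    have h2 := hht u v hr hd v (SimpleGraph.Reachable.refl _)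
    omega
  · have h1 : t / B * B ≤ t := Nat.div_mul_le_self t B
    calc 2 * κ * (3 * (t / B + 1) + 3 * r ^ L) * (5 * B)
        = κ * (30 * (t / B * B) + 30 * B + 30 * (r ^ L * B)) := by ring
      _ ≤ κ * (30 * t + 30 * t + 30 * t) := by gcongr
      _ = _ := by ring
  · exact Nat.le_add_left _ _
  · calc 4 * (B * s) * A.card + C.used.card * (5 * B)
        ≤ 4 * (B * s) * A.card + 2 * (L * (6 * r ^ L * (A.card * b))) * (5 * B) := by
          gcongr
          exact hC2.trans (Nat.mul_le_mul_left _ hF1)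
      _ = (4 * s + 60 * L * r ^ L * b) * (A.card * B) := by ring
      _ ≤ (4 * s * (L * r ^ L * b) + 60 * L * r ^ L * b * s) * Fintype.card V := by
          refine Nat.mul_le_mul (Nat.add_le_add ?_ ?_)
            ((Nat.mul_le_mul_left _ (Nat.le_succ B)).trans hA)
          · exact Nat.le_mul_of_pos_right _ (Nat.mul_pos (Nat.mul_pos hL1 hY) hb)
          · exact Nat.le_mul_of_pos_right _ hs1
      _ = _ := by ring

theorem SlotClusters.card_used_le [Fintype V] {A : Finset V} {m ρ len : ℕ}
    (C : SlotClusters H A m ρ len) : C.used.card ≤ Fintype.card V * Fintype.card V := by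
  rw [← Fintype.card_prod]
  exact C.used.card_le_univ

end Scales

/-! ### Layout of the scales in the table -/

/-- Encoding of the name of a cluster. -/
def label {n : ℕ} : Option (Fin n) → ℕ
  | none => 0
  | some v => v + 1

theorem label_injective {n : ℕ} : Function.Injective (label (n := n)) := by
  rintro (_ | x) (_ | y) h
  · rfl
  · simp [label] at h
  · simp [label] at h
  · simp only [label, Nat.add_right_cancel_iff] at h
    rw [Fin.ext h]

theorem label_le {n : ℕ} (o : Option (Fin n)) : label o ≤ n := by
  rcases o with _ | x
  · exact Nat.zero_le _
  · exact x.isLt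

section Layout

variable {n : ℕ} {H : SimpleGraph (Fin n)} {Rad : Fin n → ℕ} {m κ : ℕ}

/-- How the first `J` scales are stored. At scale `j`, the vertex `x` has a record at `rec j x`,
which leads towards its pivot, and a net point `x` has a table at `tab j x` with one record for
each slot, which leads towards the center of its cluster. The directory of `x` has three entries
for each scale: its record, the table of its pivot, and the home slot of its pivot. -/
structure ScaleLayout (S : ∀ j : ℕ, Scale H Rad m κ (2 ^ j)) (dat : ℕ → ℕ) (W J : ℕ)
    (dir : Fin n → ℕ) (rec tab : ℕ → Fin n → ℕ) : Prop where
  dir_rec : ∀ j < J, ∀ x, dat (dir x + 3 * j) = rec j x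
  dir_tab : ∀ j < J, ∀ x, dat (dir x + 3 * j + 1) = tab j ((S j).forest.piv x)
  dir_home : ∀ j < J, ∀ x,
    dat (dir x + 3 * j + 2) = 4 * (S j).clusters.home ((S j).forest.piv x)
  dir_lt : ∀ j < J, ∀ x, dir x + 3 * j + 3 < W
  rec_lt : ∀ j < J, ∀ x, rec j x + 3 < W
  rec_root : ∀ j < J, ∀ x ∈ (S j).net, dat (rec j x + 3) = 0
  rec_step : ∀ j < J, ∀ x ∉ (S j).net, dat (rec j x + 3) = 1 ∧
    dat (rec j x + 1) = rec j ((S j).forest.nxt x) ∧ dat (rec j x + 2) + 1 < W ∧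
    dat (dat (rec j x + 2)) = (S j).forest.nxt x
  tab_lt : ∀ j < J, ∀ x ∈ (S j).net, ∀ g < m, tab j x + 4 * g + 3 < W
  tab_label : ∀ j < J, ∀ x ∈ (S j).net, ∀ g < m,
    dat (tab j x + 4 * g) = label ((S j).clusters.ctr g x)
  tab_root : ∀ j < J, ∀ x ∈ (S j).net, ∀ g < m, (S j).clusters.ctr g x = some x →
    dat (tab j x + 4 * g + 3) = 0
  tab_step : ∀ j < J, ∀ x ∈ (S j).net, ∀ g < m, (S j).clusters.ctr g x ≠ some x →
    (x, (S j).clusters.par g x) ∈ (S j).clusters.used →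
    ∃ p : H.Walk x ((S j).clusters.par g x), p.length ≤ (S j).len ∧
      dat (tab j x + 4 * g + 1) = tab j ((S j).clusters.par g x) + 4 * g ∧
      dat (tab j x + 4 * g + 3) = p.length ∧ dat (tab j x + 4 * g + 2) + p.length < W ∧
      ∀ i (hi : i < (p.support.tail.map Fin.val).length),
        dat (dat (tab j x + 4 * g + 2) + i) = (p.support.tail.map Fin.val)[i]

variable {S : ∀ j : ℕ, Scale H Rad m κ (2 ^ j)} {dat : ℕ → ℕ} {W J : ℕ}
  {dir : Fin n → ℕ} {rec tab : ℕ → Fin n → ℕ}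

theorem map_tail_support_append {x y z : Fin n} (p : H.Walk x y) (q : H.Walk y z) :
    (p.append q).support.tail.map Fin.val =
      p.support.tail.map Fin.val ++ q.support.tail.map Fin.val := by
  rw [SimpleGraph.Walk.tail_support_append, List.map_append]

/-- The records of a vertex and its successors are a chain for a walk to the pivot. -/
theorem ScaleLayout.chain_rec (Ly : ScaleLayout S dat W J dir rec tab) {j : ℕ} (hj : j < J)
    (d : ℕ) : ∀ x, (∃ a ∈ (S j).net, H.Reachable x a) → (S j).forest.ht x = d →
      ∃ p : H.Walk x ((S j).forest.piv x), p.length = d ∧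
        Chain dat W (rec j x) (p.support.tail.map Fin.val) := by
  induction d with
  | zero =>
    intro x hx hd
    have hxA : x ∈ (S j).net := by
      by_contra h
      have := (S j).forest.ht_nxt x hx h
      omega
    rw [(S j).forest.piv_self x hxA]
    exact ⟨.nil, rfl, .nil (Ly.rec_lt j hj x) (Ly.rec_root j hj x hxA)⟩
  | succ d ih =>
    intro x hx hd
    have hxA : x ∉ (S j).net := fun h => by have := (S j).forest.ht_self x h; omega
    obtain ⟨p, hp, hc⟩ := ih _ ((S j).forest.reachable_nxt hx hxA)
      (by have := (S j).forest.ht_nxt x hx hxA; omega)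
    obtain ⟨h3, h1, h2, h4⟩ := Ly.rec_step j hj x hxA
    rw [← (S j).forest.piv_nxt x hx hxA]
    refine ⟨.cons ((S j).forest.adj_nxt x hx hxA) p, by simp [hp], ?_⟩
    have : (SimpleGraph.Walk.cons ((S j).forest.adj_nxt x hx hxA) p).support.tail.map Fin.val =
        [((S j).forest.nxt x : ℕ)] ++ p.support.tail.map Fin.val := by
      rw [SimpleGraph.Walk.support_cons, List.tail_cons]
      conv_lhs => rw [← p.cons_tail_support]
      rfl
    rw [this]
    refine .cons (Ly.rec_lt j hj x) (by simp) (by simpa using h3) (by simpa using h2) ?_ (h1 ▸ hc)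
    intro i hi
    obtain rfl : i = 0 := by simpa using hi
    simpa using h4

/-- The records of a net point and its ancestors in a slot are a chain for a walk to the center. -/
theorem ScaleLayout.chain_tab (Ly : ScaleLayout S dat W J dir rec tab) {j : ℕ} (hj : j < J)
    {g : ℕ} (hg : g < m) {v : Fin n} (r : ℕ) : ∀ x, (S j).clusters.ctr g x = some v →
      (S j).clusters.rank g x ≤ r →
      ∃ p : H.Walk x v, p.length ≤ r * (S j).len ∧
        Chain dat W (tab j x + 4 * g) (p.support.tail.map Fin.val) := by
  induction r with
  | zero =>
    intro x hx hr
    have hxA := (S j).clusters.mem_net g x v hx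
    rcases (S j).clusters.tree g hg x v hx with rfl | ⟨-, -, h⟩
    · exact ⟨.nil, by simp, .nil (Ly.tab_lt j hj x hxA g hg) (Ly.tab_root j hj x hxA g hg hx)⟩
    · omega
  | succ r ih =>
    intro x hx hr
    have hxA := (S j).clusters.mem_net g x v hx
    by_cases hxv : x = v
    · subst hxv
      exact ⟨.nil, by simp, .nil (Ly.tab_lt j hj x hxA g hg) (Ly.tab_root j hj x hxA g hg hx)⟩
    · obtain ⟨hu, hc, hlt⟩ := ((S j).clusters.tree g hg x v hx).resolve_left hxv
      obtain ⟨p, hp, hch⟩ := ih _ hc (by omega)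
      obtain ⟨q, hq, h1, h3, h2, h4⟩ := Ly.tab_step j hj x hxA g hg
        (by rw [hx]; exact fun h => hxv (Option.some.inj h).symm) hu
      have hl : (q.support.tail.map Fin.val).length = q.length := by simp
      have hq0 : q.length ≠ 0 := fun h0 =>
        ((S j).clusters.used_near _ hu).1 (SimpleGraph.Walk.eq_of_length_eq_zero h0)
      refine ⟨q.append p, ?_, ?_⟩
      · rw [SimpleGraph.Walk.length_append, Nat.succ_mul]
        omega
      · rw [map_tail_support_append]
        refine .cons (Ly.tab_lt j hj x hxA g hg) ?_ (by rw [h3, hl]) (by rwa [hl]) h4 (h1 ▸ hch)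
        rw [← List.length_pos_iff, hl]
        omega

theorem dist_lt_of_reachable {u v : Fin n} (h : H.Reachable v u) : H.dist v u < n := by
  obtain ⟨p, hp, hl⟩ := h.exists_path_of_dist
  have := hp.length_lt
  rw [Fintype.card_fin] at this
  omega

/-- The labels agree at some scale `j₀` with `2 ^ j₀ ≤ 2 * d(v, u)`: the label of `u` in the home
slot of its pivot is never that of an empty cluster, and at scales above the distance it is shared by
the pivot of `v`. -/
theorem ScaleLayout.hasMeeting (Ly : ScaleLayout S dat W J dir rec tab) (hJ : n.size < J)
    (hκ : 1 ≤ κ) {u v : Fin n} (hr : H.Reachable v u) (hd : Rad v < H.dist v u) :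
    HasMeeting H dat W dir u v (368 * κ * H.dist v u) := by
  classical
  set t := H.dist v u with ht
  have htn : t < n := dist_lt_of_reachable hr
  have hcov := fun j => (S j).cover u v hr hd
  have hpu := fun j => (S j).forest.piv_mem u (hcov j).1
  have hpv := fun j => (S j).forest.piv_mem v (hcov j).2
  set home : ℕ → ℕ := fun j => (S j).clusters.home ((S j).forest.piv u) with hhome
  have hhlt : ∀ j, home j < m := fun j => (S j).clusters.home_lt _
  have sau : ∀ j < J, slotAddr dat (dir u) (dir u) j = tab j ((S j).forest.piv u) + 4 * home j :=
    fun j hj => by rw [slotAddr, Ly.dir_tab j hj, Ly.dir_home j hj]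
  have sav : ∀ j < J, slotAddr dat (dir u) (dir v) j = tab j ((S j).forest.piv v) + 4 * home j :=
    fun j hj => by rw [slotAddr, Ly.dir_tab j hj, Ly.dir_home j hj]
  have hex : ∃ j, (S j).clusters.ctr (home j) ((S j).forest.piv u) =
      (S j).clusters.ctr (home j) ((S j).forest.piv v) :=
    ⟨n.size, (S n.size).meet u v hr hd (htn.le.trans n.lt_size_self.le)⟩
  set j₀ := Nat.find hex with hj₀
  have heq := Nat.find_spec hex
  rw [← hj₀] at heq
  have hpow : 2 ^ j₀ ≤ 2 * t := by
    by_contra hcon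
    have h1 : j₀ ≠ 0 := by
      intro h0
      rw [h0] at hcon
      simp at hcon
      omega
    obtain ⟨i, hi⟩ := Nat.exists_eq_succ_of_ne_zero h1
    rw [hi, pow_succ] at hcon
    have := Nat.find_min' hex ((S i).meet u v hr hd (by omega))
    omega
  have hj₀t : j₀ ≤ t := by
    have h1 : 2 ^ j₀ ≤ 2 ^ t := by
      refine hpow.trans ?_
      have h2 : t - 1 < 2 ^ (t - 1) := Nat.lt_two_pow_self
      have h3 : 2 ^ t = 2 * 2 ^ (t - 1) := by
        rw [← pow_succ']
        congr 1
        omega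
      omega
    exact (Nat.pow_le_pow_iff_right (by norm_num)).mp h1
  have hj₀J : j₀ < J := by
    refine lt_of_le_of_lt ?_ hJ
    exact Nat.find_min' hex ((S n.size).meet u v hr hd (htn.le.trans n.lt_size_self.le))
  obtain ⟨z, hz⟩ := Option.ne_none_iff_exists'.mp ((S j₀).clusters.home_ctr _ (hpu j₀))
  obtain ⟨pu, hpul, cpu⟩ := Ly.chain_rec hj₀J _ u (hcov j₀).1 rfl
  obtain ⟨pv, hpvl, cpv⟩ := Ly.chain_rec hj₀J _ v (hcov j₀).2 rfl
  obtain ⟨qu, hqul, cqu⟩ := Ly.chain_tab hj₀J (hhlt j₀) _ _ hz ((S j₀).clusters.rank_le _ _ _ hz)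
  have hz' := hz
  rw [show (S j₀).clusters.home ((S j₀).forest.piv u) = home j₀ from rfl, heq] at hz'
  obtain ⟨qv, hqvl, cqv⟩ := Ly.chain_tab hj₀J (hhlt j₀) _ _ hz' ((S j₀).clusters.rank_le _ _ _ hz')
  refine ⟨j₀, _, _, z, pu, qu, pv, qv, ?_, ?_, ?_, ?_, ?_, ?_, ?_, ?_, hj₀t⟩
  · intro j hj
    have hjJ := hj.trans_lt hj₀J
    have h1 := Ly.tab_lt j hjJ _ (hpu j) _ (hhlt j)
    have h2 := Ly.tab_lt j hjJ _ (hpv j) _ (hhlt j)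
    rw [sau j hjJ, sav j hjJ]
    exact ⟨Ly.dir_lt j hjJ u, Ly.dir_lt j hjJ v, by omega, by omega⟩
  · intro j hj
    have hjJ := hj.trans hj₀J
    rw [sau j hjJ, sav j hjJ, Ly.tab_label j hjJ _ (hpu j) _ (hhlt j),
      Ly.tab_label j hjJ _ (hpv j) _ (hhlt j)]
    exact fun h => Nat.find_min hex hj (label_injective h)
  · rw [sau j₀ hj₀J, sav j₀ hj₀J, Ly.tab_label j₀ hj₀J _ (hpu j₀) _ (hhlt j₀),
      Ly.tab_label j₀ hj₀J _ (hpv j₀) _ (hhlt j₀), heq]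
  · rw [Ly.dir_rec j₀ hj₀J]
    exact cpu
  · rw [sau j₀ hj₀J]
    exact cqu
  · rw [Ly.dir_rec j₀ hj₀J]
    exact cpv
  · rw [sav j₀ hj₀J]
    exact cqv
  · have h1 := (S j₀).ht_le u v hr hd hpow
    have h2 := (S j₀).radius_le
    have h3 : 90 * κ * 2 ^ j₀ ≤ 90 * κ * (2 * t) := Nat.mul_le_mul_left _ hpow
    have h4 : t ≤ κ * t := Nat.le_mul_of_pos_left _ hκ
    have h5 : 90 * κ * (2 * t) = 180 * (κ * t) := by ring
    have h6 : 368 * κ * t = 368 * (κ * t) := by ring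
    omega

end Layout

/-! ### The table -/

/-- Consecutive placement of blocks of prescribed lengths. The addresses depend only on the lengths,
so that the blocks may contain addresses of other blocks. -/
theorem exists_placement {ι : Type*} [DecidableEq ι] (base : ℕ) (len : ι → ℕ) (s : Finset ι) :
    ∃ addr : ι → ℕ, (∀ i ∈ s, base ≤ addr i ∧ addr i + len i ≤ base + ∑ i ∈ s, len i) ∧
      ∀ (head : ℕ → ℕ) (content : ι → ℕ → ℕ), ∃ dat : List ℕ,
        dat.length = base + ∑ i ∈ s, len i ∧ (∀ k < base, dat.getD k 0 = head k) ∧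
        (∀ i ∈ s, ∀ k < len i, dat.getD (addr i + k) 0 = content i k) ∧
        ∀ x ∈ dat, (∃ k < base, x = head k) ∨ ∃ i ∈ s, ∃ k < len i, x = content i k := by
  induction s using Finset.induction_on with
  | empty =>
    refine ⟨fun _ => 0, by simp, fun head content => ⟨List.ofFn fun k : Fin base => head k,
      by simp, ?_, by simp, ?_⟩⟩
    · intro k hk
      simp [List.getD_eq_getElem?_getD, hk]
    · intro x hx
      obtain ⟨k, rfl⟩ := (List.mem_ofFn' _ _).mp hx
      exact Or.inl ⟨k, k.isLt, rfl⟩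
  | insert a s ha ih =>
    obtain ⟨addr, haddr, h⟩ := ih
    have hne : ∀ i ∈ s, i ≠ a := fun i hi h => ha (h ▸ hi)
    refine ⟨Function.update addr a (base + ∑ i ∈ s, len i), ?_, fun head content => ?_⟩
    · intro i hi
      rw [Finset.sum_insert ha]
      rcases Finset.mem_insert.mp hi with rfl | hi
      · rw [Function.update_self]
        omega
      · rw [Function.update_of_ne (hne i hi)]
        have := haddr i hi
        omega
    · obtain ⟨dat, h1, h2, h3, h4⟩ := h head content
      refine ⟨dat ++ List.ofFn fun k : Fin (len a) => content a k, ?_, ?_, ?_, ?_⟩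
      · rw [List.length_append, List.length_ofFn, h1, Finset.sum_insert ha]
        omega
      · intro k hk
        rw [List.getD_append _ _ _ _ (by omega), h2 k hk]
      · intro i hi k hk
        rcases Finset.mem_insert.mp hi with rfl | hi
        · rw [Function.update_self, List.getD_append_right _ _ _ _ (by omega), h1,
            Nat.add_sub_cancel_left]
          simp [List.getD_eq_getElem?_getD, hk]
        · have := haddr i hi
          rw [Function.update_of_ne (hne i hi), List.getD_append _ _ _ _ (by omega), h3 i hi k hk]
      · intro x hx
        rcases List.mem_append.mp hx with hx | hx
        · rcases h4 x hx with h | ⟨i, hi, h⟩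
          · exact Or.inl h
          · exact Or.inr ⟨i, Finset.mem_insert_of_mem hi, h⟩
        · obtain ⟨k, rfl⟩ := (List.mem_ofFn' _ _).mp hx
          exact Or.inr ⟨a, Finset.mem_insert_self _ _, k, k.isLt, rfl⟩

section Table

variable {n : ℕ} {H : SimpleGraph (Fin n)} {Rad : Fin n → ℕ} {m κ : ℕ}

/-- The blocks of the table besides the records of the vertices: adjacency lists, directories, and
cells with the name of a vertex, for each vertex; and, for each scale, records of
vertices, tables of net points, and paths between net points. -/
abbrev Block (n J : ℕ) : Type :=
  Fin n ⊕ Fin n ⊕ Fin n ⊕ (Fin J × Fin n) ⊕ (Fin J × Fin n) ⊕ (Fin J × Fin n × Fin n)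

open Classical in
/-- The table. The records of the vertices come first, eight words each; all other parts are blocks,
whose contents refer to each other by their addresses. -/
theorem exists_table (S : ∀ j : ℕ, Scale H Rad m κ (2 ^ j)) (J : ℕ) {W : ℕ}
    (hW : 18 * n + 2 * H.edgeSet.ncard + 7 * (J * n) +
      ∑ j ∈ Finset.range J, (4 * m * (S j).net.card + (S j).clusters.used.card * (S j).len) +
      4 * m + 10 ≤ W) :
    ∃ (dat : List ℕ) (comp : Fin n → ℕ) (adj : Fin n → List (Fin n)) (adr dir : Fin n → ℕ)
      (rec tab : ℕ → Fin n → ℕ),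
      dat.length ≤ 9 * n + 2 * H.edgeSet.ncard + 7 * (J * n) +
        ∑ j ∈ Finset.range J, (4 * m * (S j).net.card + (S j).clusters.used.card * (S j).len) ∧
      (∀ x ∈ dat, x < W) ∧
      GraphLayout H (fun a => dat.getD a 0) W comp (fun x => (ballF H x (Rad x)).card) adj adr dir ∧
      (∀ u v, comp u = comp v ↔ H.Reachable v u) ∧ (∀ x, (adj x).length = H.degree x) ∧
      ScaleLayout S (fun a => dat.getD a 0) W J dir rec tab := by
  -- the paths between the used pairs of net points
  have hpath : ∀ j x y, ∃ l : List ℕ, ((x, y) ∉ (S j).clusters.used → l = []) ∧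
      ((x, y) ∈ (S j).clusters.used → ∃ p : H.Walk x y, p.length ≤ (S j).len ∧
        l = p.support.tail.map Fin.val) := by
    intro j x y
    by_cases h : (x, y) ∈ (S j).clusters.used
    · obtain ⟨p, hp⟩ := ((S j).clusters.used_near _ h).2
      exact ⟨_, fun h' => absurd h h', fun _ => ⟨p, hp, rfl⟩⟩
    · exact ⟨[], fun _ => rfl, fun h' => absurd h' h⟩
  choose path hpath0 hpath1 using hpath
  have hpathlen : ∀ j x y, (path j x y).length ≤
      if (x, y) ∈ (S j).clusters.used then (S j).len else 0 := by
    intro j x y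
    split_ifs with h
    · obtain ⟨p, hp, hl⟩ := hpath1 j x y h
      rw [hl]
      simpa using hp
    · rw [hpath0 j x y h]
      simp
  set adj : Fin n → List (Fin n) := fun x => (H.neighborFinset x).toList with hadj
  have hadjlen : ∀ x, (adj x).length = H.degree x := by
    intro x
    rw [hadj, Finset.length_toList, SimpleGraph.card_neighborFinset_eq_degree]
  set comp : Fin n → ℕ := fun x => ((H.connectedComponentMk x).out : Fin n) with hcomp
  set len : Block n J → ℕ := fun i => match i with
    | .inl x => (adj x).length
    | .inr (.inl _) => 3 * J
    | .inr (.inr (.inl _)) => 1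
    | .inr (.inr (.inr (.inl _))) => 4
    | .inr (.inr (.inr (.inr (.inl (j, x))))) => if x ∈ (S j).net then 4 * m else 0
    | .inr (.inr (.inr (.inr (.inr (j, x, y))))) => (path j x y).length with hlen
  obtain ⟨addr, haddr, hplace⟩ := exists_placement (8 * n) len Finset.univ
  set T := 8 * n + ∑ i, len i with hT
  have hTle : T ≤ 9 * n + 2 * H.edgeSet.ncard + 7 * (J * n) +
      ∑ j ∈ Finset.range J,
        (4 * m * (S j).net.card + (S j).clusters.used.card * (S j).len) := by
    have e1 : ∑ x, (adj x).length = 2 * H.edgeSet.ncard := by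
      simp only [hadjlen]
      rw [SimpleGraph.sum_degrees_eq_twice_card_edges, ← SimpleGraph.coe_edgeFinset,
        Set.ncard_coe_finset]
    have e2 : ∀ j : Fin J, ∑ x, (if x ∈ (S j).net then 4 * m else 0) = 4 * m * (S j).net.card := by
      intro j
      rw [Finset.sum_ite_mem, Finset.univ_inter, Finset.sum_const, smul_eq_mul, mul_comm]
    have e3 : ∀ j : Fin J, ∑ p : Fin n × Fin n, (path j p.1 p.2).length ≤
        (S j).clusters.used.card * (S j).len := by
      intro j
      refine (Finset.sum_le_sum fun p _ => hpathlen j p.1 p.2).trans ?_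
      rw [Finset.sum_ite_mem, Finset.univ_inter, Finset.sum_const, smul_eq_mul]
    have e4 : ∑ i, len i = ∑ x, (adj x).length + (n * (3 * J) + (n + (J * n * 4 +
        (∑ j : Fin J, ∑ x, (if x ∈ (S j).net then 4 * m else 0) +
          ∑ j : Fin J, ∑ p : Fin n × Fin n, (path j p.1 p.2).length)))) := by
      simp only [Fintype.sum_sum_type, hlen, Fintype.sum_prod_type (α₁ := Fin J), Finset.sum_const,
        Finset.card_univ, Fintype.card_fin, smul_eq_mul, mul_one, mul_assoc]
    have e5 : ∑ j : Fin J, ∑ x, (if x ∈ (S j).net then 4 * m else 0) +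
          ∑ j : Fin J, ∑ p : Fin n × Fin n, (path j p.1 p.2).length ≤ ∑ j ∈ Finset.range J,
          (4 * m * (S j).net.card + (S j).clusters.used.card * (S j).len) := by
      rw [Finset.sum_range, ← Finset.sum_add_distrib]
      exact Finset.sum_le_sum fun j _ => Nat.add_le_add (e2 j).le (e3 j)
    have e6 : n * (3 * J) = 3 * (J * n) := by ring
    omega
  set aAdj : Fin n → ℕ := fun x => addr (.inl x) with haAdj
  set aDir : Fin n → ℕ := fun x => addr (.inr (.inl x)) with haDir
  set aCell : Fin n → ℕ := fun x => addr (.inr (.inr (.inl x))) with haCell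
  set aRec : ℕ → Fin n → ℕ := fun j x =>
    if h : j < J then addr (.inr (.inr (.inr (.inl (⟨j, h⟩, x))))) else 0 with haRec
  set aTab : ℕ → Fin n → ℕ := fun j x =>
    if h : j < J then addr (.inr (.inr (.inr (.inr (.inl (⟨j, h⟩, x)))))) else 0 with haTab
  set aPath : ℕ → Fin n → Fin n → ℕ := fun j x y =>
    if h : j < J then addr (.inr (.inr (.inr (.inr (.inr (⟨j, h⟩, x, y)))))) else 0 with haPath
  -- the words of a vertex record, a directory entry, a pivot record, and a record of a slot
  set vtx : Fin n → ℕ → ℕ := fun x c => match c with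
    | 0 => comp x
    | 1 => (ballF H x (Rad x)).card
    | 2 => aAdj x
    | 3 => aAdj x + (adj x).length
    | 4 => aDir x
    | 5 => n
    | _ => 0 with hvtx
  set ent : Fin n → ℕ → ℕ → ℕ := fun x j c => match c with
    | 0 => aRec j x
    | 1 => aTab j ((S j).forest.piv x)
    | _ => 4 * (S j).clusters.home ((S j).forest.piv x) with hent
  set prec : ℕ → Fin n → ℕ → ℕ := fun j x c => match c with
    | 1 => aRec j ((S j).forest.nxt x)
    | 2 => aCell ((S j).forest.nxt x)
    | 3 => if x ∈ (S j).net then 0 else 1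
    | _ => 0 with hprec
  set slot : ℕ → Fin n → ℕ → ℕ → ℕ := fun j x g c => match c with
    | 0 => label ((S j).clusters.ctr g x)
    | 1 => aTab j ((S j).clusters.par g x) + 4 * g
    | 2 => aPath j x ((S j).clusters.par g x)
    | _ => if (S j).clusters.ctr g x = some x then 0 else
          (path j x ((S j).clusters.par g x)).length with hslot
  obtain ⟨dat, h1, h2, h3, h4⟩ := hplace
    (fun k => if h : k / 8 < n then vtx ⟨k / 8, h⟩ (k % 8) else 0)
    (fun i k => match i with
    | .inl x => ((adj x).map Fin.val).getD k 0
    | .inr (.inl x) => ent x (k / 3) (k % 3)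
    | .inr (.inr (.inl x)) => x
    | .inr (.inr (.inr (.inl (j, x)))) => prec j x k
    | .inr (.inr (.inr (.inr (.inl (j, x))))) => slot j x (k / 4) (k % 4)
    | .inr (.inr (.inr (.inr (.inr (j, x, y))))) => (path j x y).getD k 0)
  have hA : ∀ i, addr i + len i ≤ T := fun i => (haddr i (Finset.mem_univ i)).2
  have gvtx : ∀ (x : Fin n) c, c < 8 → dat.getD (8 * x + c) 0 = vtx x c := by
    intro x c hc
    have hx := x.isLt
    have e : (8 * (x : ℕ) + c) / 8 = x := by omega
    have e' : (8 * (x : ℕ) + c) % 8 = c := by omega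
    rw [h2 _ (by omega)]
    simp only [e, e', hx, dif_pos]
  have gadj : ∀ (x : Fin n) k, k < (adj x).length →
      dat.getD (aAdj x + k) 0 = ((adj x).map Fin.val).getD k 0 :=
    fun x k hk => h3 (.inl x) (Finset.mem_univ _) k hk
  have gent : ∀ (x : Fin n) j c, j < J → c < 3 → dat.getD (aDir x + (3 * j + c)) 0 = ent x j c := by
    intro x j c hj hc
    have e : (3 * j + c) / 3 = j := by omega
    have e' : (3 * j + c) % 3 = c := by omega
    have := h3 (.inr (.inl x)) (Finset.mem_univ _) (3 * j + c) (show 3 * j + c < 3 * J by omega)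
    simp only [e, e'] at this
    exact this
  have gcell : ∀ x : Fin n, dat.getD (aCell x) 0 = x :=
    fun x => h3 (.inr (.inr (.inl x))) (Finset.mem_univ _) 0 Nat.one_pos
  have gprec : ∀ j < J, ∀ x c, c < 4 → dat.getD (aRec j x + c) 0 = prec j x c := by
    intro j hj x c hc
    have := h3 (.inr (.inr (.inr (.inl (⟨j, hj⟩, x))))) (Finset.mem_univ _) c hc
    simp only [haRec, hj, dif_pos]
    exact this
  have gslot : ∀ j < J, ∀ x ∈ (S j).net, ∀ g < m, ∀ c < 4,
      dat.getD (aTab j x + 4 * g + c) 0 = slot j x g c := by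
    intro j hj x hx g hg c hc
    have e : (4 * g + c) / 4 = g := by omega
    have e' : (4 * g + c) % 4 = c := by omega
    have := h3 (.inr (.inr (.inr (.inr (.inl (⟨j, hj⟩, x)))))) (Finset.mem_univ _) (4 * g + c)
      (show 4 * g + c < if x ∈ (S j).net then 4 * m else 0 by rw [if_pos hx]; omega)
    simp only [e, e'] at this
    simp only [haTab, hj, dif_pos, add_assoc]
    exact this
  have gpath : ∀ j < J, ∀ x y k, k < (path j x y).length →
      dat.getD (aPath j x y + k) 0 = (path j x y).getD k 0 := by
    intro j hj x y k hk
    have := h3 (.inr (.inr (.inr (.inr (.inr (⟨j, hj⟩, x, y)))))) (Finset.mem_univ _) k hk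
    simp only [haPath, hj, dif_pos]
    exact this
  have bAdj : ∀ x, aAdj x + (adj x).length ≤ T := fun x => hA (.inl x)
  have bDir : ∀ x, aDir x + 3 * J ≤ T := fun x => hA (.inr (.inl x))
  have bCell : ∀ x, aCell x + 1 ≤ T := fun x => hA (.inr (.inr (.inl x)))
  have bRec : ∀ j x, aRec j x ≤ T := by
    intro j x
    simp only [haRec]
    split_ifs with hj
    · exact (Nat.le_add_right _ _).trans (hA _)
    · exact Nat.zero_le _
  have bRec' : ∀ j < J, ∀ x, aRec j x + 4 ≤ T := by
    intro j hj x
    simp only [haRec, hj, dif_pos]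
    exact hA (.inr (.inr (.inr (.inl (⟨j, hj⟩, x)))))
  have bTab : ∀ j x, aTab j x ≤ T := by
    intro j x
    simp only [haTab]
    split_ifs with hj
    · exact (Nat.le_add_right _ _).trans (hA _)
    · exact Nat.zero_le _
  have bTab' : ∀ j < J, ∀ x ∈ (S j).net, aTab j x + 4 * m ≤ T := by
    intro j hj x hx
    have := hA (.inr (.inr (.inr (.inr (.inl (⟨j, hj⟩, x))))))
    simp only [hlen, if_pos hx] at this
    simp only [haTab, hj, dif_pos]
    exact this
  have bPath : ∀ j x y, aPath j x y ≤ T := by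
    intro j x y
    simp only [haPath]
    split_ifs with hj
    · exact (Nat.le_add_right _ _).trans (hA _)
    · exact Nat.zero_le _
  have bPath' : ∀ j < J, ∀ x y, aPath j x y + (path j x y).length ≤ T := by
    intro j hj x y
    simp only [haPath, hj, dif_pos]
    exact hA (.inr (.inr (.inr (.inr (.inr (⟨j, hj⟩, x, y))))))
  have bList : ∀ (l : List (Fin n)) k, (l.map Fin.val).getD k 0 ≤ n := by
    intro l k
    rw [List.getD_eq_getElem?_getD]
    rcases hl : (l.map Fin.val)[k]? with _ | y
    · simp
    · obtain ⟨z, -, rfl⟩ := List.mem_map.mp (List.mem_of_getElem? hl)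
      simp [z.isLt.le]
  have bPathVal : ∀ j x y k, (path j x y).getD k 0 ≤ n := by
    intro j x y k
    by_cases h : (x, y) ∈ (S j).clusters.used
    · obtain ⟨p, -, hl⟩ := hpath1 j x y h
      rw [hl]
      exact bList _ _
    · rw [hpath0 j x y h]
      simp
  refine ⟨dat, comp, adj, aAdj, aDir, aRec, aTab, h1 ▸ hTle, ?_, ?_, ?_, hadjlen, ?_⟩
  · intro y hy
    rcases h4 y hy with ⟨k, hk, rfl⟩ | ⟨i, -, k, hk, rfl⟩
    · rw [dif_pos (by omega)]
      generalize (⟨k / 8, _⟩ : Fin n) = x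
      have b1 : comp x ≤ n := (Fin.isLt _).le
      have b2 : (ballF H x (Rad x)).card ≤ n := by
        simpa using (ballF H x (Rad x)).card_le_univ
      have b3 := bAdj x
      have b4 := bDir x
      simp only [hvtx]
      split <;> omega
    · rcases i with x | x | x | ⟨j, x⟩ | ⟨j, x⟩ | ⟨j, x, y⟩
      · have := bList (adj x) k
        simp only
        omega
      · have b1 := bRec (k / 3) x
        have b2 := bTab (k / 3) ((S (k / 3)).forest.piv x)
        have b3 := (S (k / 3)).clusters.home_lt ((S (k / 3)).forest.piv x)
        simp only [hent]
        split <;> omega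
      · have := x.isLt
        simp only
        omega
      · have b1 := bRec j ((S j).forest.nxt x)
        have b2 := bCell ((S j).forest.nxt x)
        simp only [hprec]
        split
        · omega
        · omega
        · split_ifs <;> omega
        · omega
      · have hx : x ∈ (S j).net := by
          by_contra h
          simp [hlen, h] at hk
        simp only [hlen, if_pos hx] at hk
        have b1 := label_le ((S j).clusters.ctr (k / 4) x)
        have b2 := bTab j ((S j).clusters.par (k / 4) x)
        have b3 := bPath j x ((S j).clusters.par (k / 4) x)
        have b4 := bPath' j j.isLt x ((S j).clusters.par (k / 4) x)
        simp only [hslot]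
        split
        · omega
        · omega
        · omega
        · split_ifs <;> omega
      · have := bPathVal j x y k
        simp only
        omega
  · refine ⟨fun x => gvtx x 0 (by norm_num), fun x => gvtx x 1 (by norm_num),
      fun x => gvtx x 2 (by norm_num), fun x => gvtx x 3 (by norm_num),
      fun x => gvtx x 4 (by norm_num), fun x => gvtx x 5 (by norm_num), ?_, ?_, ?_⟩
    · intro x
      have := bAdj x
      omega
    · intro x i hi
      simp only [gadj x i hi]
      simp [List.getD_eq_getElem?_getD, hi]
    · intro x y
      simp [hadj]
  · intro u v
    constructor
    · intro h
      have h' := Fin.ext h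
      have := congrArg H.connectedComponentMk h'
      rw [← SimpleGraph.ConnectedComponent.eq]
      simpa [SimpleGraph.connectedComponentMk] using this.symm
    · intro h
      simp only [hcomp]
      rw [SimpleGraph.ConnectedComponent.eq.mpr h]
  · refine ⟨?_, ?_, ?_, ?_, ?_, ?_, ?_, ?_, ?_, ?_, ?_⟩
    · exact fun j hj x => gent x j 0 hj (by norm_num)
    · exact fun j hj x => gent x j 1 hj (by norm_num)
    · exact fun j hj x => gent x j 2 hj (by norm_num)
    · intro j hj x
      have := bDir x
      omega
    · intro j hj x
      have := bRec' j hj x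
      omega
    · intro j hj x hx
      simp only [gprec j hj x 3 (by norm_num), hprec, if_pos hx]
    · intro j hj x hx
      have := bCell ((S j).forest.nxt x)
      simp only [gprec j hj x 1 (by norm_num), gprec j hj x 2 (by norm_num),
        gprec j hj x 3 (by norm_num), hprec, if_neg hx]
      exact ⟨trivial, trivial, by omega, gcell _⟩
    · intro j hj x hx g hg
      have := bTab' j hj x hx
      omega
    · intro j hj x hx g hg
      exact gslot j hj x hx g hg 0 (by norm_num)
    · intro j hj x hx g hg hc
      simp only [gslot j hj x hx g hg 3 (by norm_num), hslot, if_pos hc]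
    · intro j hj x hx g hg hc hu
      obtain ⟨p, hp, hl⟩ := hpath1 j _ _ hu
      have hll : (path j x ((S j).clusters.par g x)).length = p.length := by rw [hl]; simp
      have hb := bPath' j hj x ((S j).clusters.par g x)
      simp only [gslot j hj x hx g hg 1 (by norm_num), gslot j hj x hx g hg 2 (by norm_num),
        gslot j hj x hx g hg 3 (by norm_num), hslot, if_neg hc]
      refine ⟨p, hp, trivial, hll, by omega, ?_⟩
      intro i hi
      rw [gpath j hj _ _ i (by rw [hl]; exact hi), hl, List.getD_eq_getElem _ _ hi]

end Table

/-! ### The oracle -/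

/-- Sufficient conditions on an oracle which is computed deterministically. -/
theorem hasOracle_of_reports {n w : ℕ} {P : Program} {G : SimpleGraph (Fin n)} (O : Oracle w)
    {α β C q S : ℝ} (c : ℝ)
    (h0 : ∀ u v, ¬ G.Reachable u v → ∃ T : ℕ, Reports P O u v T [] ∧ (T : ℝ) ≤ C * q)
    (h1 : ∀ u v, G.Reachable u v → ∃ (T : ℕ) (p : G.Walk u v),
      Reports P O u v T (p.support.map Fin.val) ∧ (p.length : ℝ) ≤ α * G.dist u v + β ∧
      (T : ℝ) ≤ C * (q + p.length))
    (hS : (O.space : ℝ) ≤ S) : HasOracle P w G α β C q S c := by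
  classical
  refine ⟨PMF.pure O, ?_, ?_⟩
  · intro O' hO'
    rw [PMF.support_pure, Set.mem_singleton_iff] at hO'
    subst hO'
    intro u v
    by_cases hr : G.Reachable u v
    · obtain ⟨T, p, hT, hp, -⟩ := h1 u v hr
      exact ⟨T, _, hT, fun _ => ⟨p, rfl, SimpleGraph.dist_le p, hp⟩, fun h => absurd hr h⟩
    · obtain ⟨T, hT, -⟩ := h0 u v hr
      exact ⟨T, _, hT, fun h => absurd h hr, fun _ => rfl⟩
  · rw [PMF.toOuterMeasure_pure_apply, if_pos]
    · exact tsub_le_self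
    refine ⟨fun u v => ?_, hS⟩
    by_cases hr : G.Reachable u v
    · obtain ⟨T, p, hT, -, ht⟩ := h1 u v hr
      refine ⟨T, _, hT, ?_⟩
      simpa using ht
    · obtain ⟨T, hT, ht⟩ := h0 u v hr
      refine ⟨T, _, hT, ?_⟩
      simpa using ht

theorem ncard_edgeSet_le {n : ℕ} (H : SimpleGraph (Fin n)) : 2 * H.edgeSet.ncard ≤ n * n := by
  classical
  rw [← vol_univ, vol]
  refine (Finset.sum_le_card_nsmul _ _ n fun x _ => ?_).trans (by simp)
  have := H.degree_lt_card_verts x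
  rw [Fintype.card_fin] at this
  exact this.le

/-- The oracle for given parameters of the spanner (`b`, `L`, `r`) and of the clusters (`B`, `κ`).
Words of `11 * n.size` bits suffice, as all addresses are `O(n ^ 4)`. -/
theorem exists_oracle {n b L r B κ : ℕ} (hn : 1 ≤ n) (G : SimpleGraph (Fin n)) (hb : 1 ≤ b)
    (hL1 : 1 ≤ L) (hr : 16 * (L + 1) ≤ r) (hL : n < b ^ (2 ^ L - 1)) (hB : 1 ≤ B)
    (hBn : B ≤ 2 * n) (hκ : 1 ≤ κ) (hκn : κ ≤ n) (hBκ : n ≤ B ^ κ) :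
    ∃ O : Oracle (11 * n.size),
      O.space ≤ 775 * κ * (L * (r ^ L) ^ 2 * b * n * n.size ^ 2) ∧
      (∀ u v, ¬ G.Reachable u v → ∃ T, Reports (queryCmd.compile 0) O u v T [] ∧ T ≤ 20) ∧
      ∀ u v, G.Reachable u v → ∃ T, ∃ p : G.Walk u v,
        Reports (queryCmd.compile 0) O u v T (p.support.map Fin.val) ∧
        p.length ≤ 368 * κ * (3 * G.dist u v + 3 * r ^ L) ∧
        T ≤ 33 * (B * B) + 48 * p.length + 220 := by
  classical
  set s := n.size with hs
  have hs1 : 1 ≤ s := Nat.size_pos.mpr hn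
  have hsn : s ≤ n := Nat.size_le.mpr Nat.lt_two_pow_self
  have h2s : 2 ^ s ≤ 2 * n := by
    have : 2 ^ (s - 1) ≤ n := Nat.lt_size.mp (by omega)
    calc 2 ^ s = 2 * 2 ^ (s - 1) := by rw [← pow_succ']; congr 1; omega
      _ ≤ _ := by omega
  have hns : n < 2 ^ s := Nat.lt_size_self n
  set Y := r ^ L with hY
  have hY1 : 1 ≤ Y := Nat.pos_of_ne_zero (pow_ne_zero _ (by omega))
  obtain ⟨H, hHG, hM, hH⟩ := exists_spanner G hb hr (by simpa using hL)
  rw [Nat.card_fin] at hM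
  set M := H.edgeSet.ncard with hMdef
  have hMn : 2 * M ≤ n * n := ncard_edgeSet_le H
  choose Rad hRadD hRad using exists_radius H (B * B)
  have hscale : ∀ j : ℕ, ∃ S : Scale H Rad (B * s) κ (2 ^ j), S.len ≤ 6 * 2 ^ j + 5 * B ∧
      4 * (B * s) * S.net.card + S.clusters.used.card * S.len ≤
        20 * M * Y * s + 64 * L * Y * b * n * s := by
    intro j
    rcases lt_or_ge (2 ^ j) (Y * B) with hj | hj
    · obtain ⟨S, h1, h2⟩ := exists_scale_of_lt hB hκ hRad le_rfl (by simpa using hBκ)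
        (s := s) (by simp [hs]) hs1 hY1 hj
      exact ⟨S, h1, h2.trans (Nat.le_add_right _ _)⟩
    · obtain ⟨S, h1, h2⟩ := exists_scale_of_le hB hκ hRad le_rfl (by simpa using hBκ)
        (s := s) (by simp [hs]) hs1 hb hL1 hr (by simpa using hL) hj
      rw [Fintype.card_fin] at h2
      exact ⟨S, h1, h2.trans (Nat.le_add_left _ _)⟩
  choose S hSlen hSspace using hscale
  set Z := ∑ j ∈ Finset.range (s + 1),
    (4 * (B * s) * (S j).net.card + (S j).clusters.used.card * (S j).len) with hZ
  -- a polynomial bound for the addresses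
  have hZ1 : Z ≤ 60 * n ^ 4 := by
    have h1 : ∀ j ∈ Finset.range (s + 1),
        4 * (B * s) * (S j).net.card + (S j).clusters.used.card * (S j).len ≤ 30 * n ^ 3 := by
      intro j hj
      have h2 : (S j).net.card ≤ n := by simpa using (S j).net.card_le_univ
      have h3 : (S j).clusters.used.card ≤ n * n := by simpa using (S j).clusters.card_used_le
      have h4 : 2 ^ j ≤ 2 * n :=
        (Nat.pow_le_pow_right (by norm_num) (by simpa [Nat.lt_succ_iff] using hj)).trans h2s
      have h5 : (S j).len ≤ 22 * n := by
        have := hSlen j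
        omega
      calc 4 * (B * s) * (S j).net.card + (S j).clusters.used.card * (S j).len
          ≤ 4 * (2 * n * n) * n + n * n * (22 * n) := by gcongr
        _ = 30 * n ^ 3 := by ring
    calc Z ≤ (s + 1) * (30 * n ^ 3) := by simpa using Finset.sum_le_card_nsmul _ _ _ h1
      _ ≤ (2 * n) * (30 * n ^ 3) := by gcongr; omega
      _ = _ := by ring
  have hW4 : 128 * n ^ 4 ≤ 2 ^ (11 * s) := by
    calc 128 * n ^ 4 ≤ (2 ^ s) ^ 7 * (2 ^ s) ^ 4 := by
          gcongr
          calc 128 = 2 ^ 7 := by norm_num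
            _ ≤ (2 ^ s) ^ 7 := by
              gcongr
              exact Nat.le_self_pow (by omega) 2
      _ = 2 ^ (11 * s) := by rw [← pow_add, ← pow_mul, mul_comm]
  have hW2 : 512 * n ^ 2 ≤ 2 ^ (11 * s) := by
    calc 512 * n ^ 2 ≤ (2 ^ s) ^ 9 * (2 ^ s) ^ 2 := by
          gcongr
          calc 512 = 2 ^ 9 := by norm_num
            _ ≤ (2 ^ s) ^ 9 := by
              gcongr
              exact Nat.le_self_pow (by omega) 2
      _ = 2 ^ (11 * s) := by rw [← pow_add, ← pow_mul, mul_comm]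
  have hn2 : n ≤ n ^ 2 := Nat.le_self_pow (by norm_num) n
  have hn24 : n ^ 2 ≤ n ^ 4 := Nat.pow_le_pow_right hn (by norm_num)
  have hJn : (s + 1) * n ≤ 2 * n ^ 2 := by
    calc (s + 1) * n ≤ (2 * n) * n := by gcongr; omega
      _ = _ := by ring
  have hBs : 4 * (B * s) ≤ 8 * n ^ 2 := by
    calc 4 * (B * s) ≤ 4 * (2 * n * n) := by gcongr
      _ = _ := by ring
  have hnn : n * n = n ^ 2 := (sq n).symm
  obtain ⟨dat, comp, adj, adr, dir, rec, tab, hdatlen, hdat, Ly, hcomp, hadj, SL⟩ :=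
    exists_table S (s + 1) (W := 2 ^ (11 * s)) (by omega)
  set sc := 2 * n + 2 + 368 * κ * n with hsc
  have hκn2 : 368 * κ * n ≤ 368 * n ^ 2 := by
    calc 368 * κ * n ≤ 368 * n * n := by gcongr
      _ = _ := by ring
  have hscW : sc < 2 ^ (11 * s) := by omega
  have hquery := fun u v : Fin n => query_spec (u := u) (v := v) hscW (by omega) Ly
    (K := ballF H v (Rad v)) (R := Rad v) (D := B * B) (bound := 368 * κ * H.dist v u)
    (fun x => mem_ballF) rfl (by simp only [hadj]; exact hRadD v) (hcomp u v) (by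
      by_cases hr : H.Reachable v u
      · have := dist_lt_of_reachable hr
        have := Nat.mul_le_mul_left (368 * κ) this.le
        omega
      · rw [SimpleGraph.dist_eq_zero_of_not_reachable hr]
        omega)
    (fun hr hd => SL.hasMeeting (Nat.lt_succ_self _) hκ hr hd)
    (fun _ => Nat.le_mul_of_pos_left _ (by omega))
  have hw : 0 < 11 * s := by omega
  have hlt : ∀ x : Fin n, (x : ℕ) < 2 ^ (11 * s) := fun x => by have := x.isLt; omega
  have hHr : ∀ u v, G.Reachable u v → H.Reachable v u :=
    fun u v h => (hH _ _ _ (near_dist h)).reachable.symm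
  refine ⟨⟨dat.map (BitVec.ofNat (11 * s)), sc⟩, ?_, ?_, ?_⟩
  · have hX : Z ≤ (s + 1) * (20 * M * Y * s + 64 * L * Y * b * n * s) := by
      simpa using Finset.sum_le_card_nsmul _ _ _ fun j (_ : j ∈ Finset.range (s + 1)) => hSspace j
    have hX2 : Z ≤ 368 * (L * Y ^ 2 * b * n * s ^ 2) := by
      calc Z ≤ (s + 1) * (20 * M * Y * s + 64 * L * Y * b * n * s) := hX
        _ ≤ (2 * s) * (20 * (L * (6 * Y * (n * b))) * Y * s + 64 * L * (Y * Y) * b * n * s) := by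
          gcongr
          · omega
          · exact Nat.le_mul_of_pos_left _ hY1
        _ = _ := by ring
    have hXM : M ≤ 6 * (L * Y ^ 2 * b * n * s ^ 2) := by
      calc M ≤ L * (6 * Y * (n * b)) := hM
        _ = 6 * (L * Y ^ 1 * b * n * s ^ 0) := by ring
        _ ≤ _ := by gcongr <;> omega
    have hXJ : (s + 1) * n ≤ 2 * (L * Y ^ 2 * b * n * s ^ 2) := by
      calc (s + 1) * n ≤ (2 * s) * n := by gcongr; omega
        _ = 2 * (1 * 1 ^ 2 * 1 * n * s ^ 1) := by ring
        _ ≤ _ := by gcongr; omega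
    have hXn : n ≤ L * Y ^ 2 * b * n * s ^ 2 := by
      calc n = 1 * 1 ^ 2 * 1 * n * 1 ^ 2 := by ring
        _ ≤ _ := by gcongr
    have hspace : Oracle.space (⟨dat.map (BitVec.ofNat (11 * s)), sc⟩ : Oracle (11 * s)) =
        dat.length + sc := by
      simp [Oracle.space]
    rw [hspace]
    set X := L * Y ^ 2 * b * n * s ^ 2 with hXdef
    have h1 : 368 * κ * n ≤ 368 * (κ * X) := by
      rw [mul_assoc]
      gcongr
    have h2 : X ≤ κ * X := Nat.le_mul_of_pos_left _ hκ
    have h3 : 775 * κ * X = 775 * (κ * X) := by ring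
    omega
  · intro u v hr
    obtain ⟨t, σ', hEx, hout, ht⟩ := (hquery u v).1 fun h => hr (h.symm.mono hHG)
    have h := Ex.reports hw hdat (hlt u) (hlt v) (by decide) hEx (by simp [hout])
    rw [hout] at h
    exact ⟨t, h, ht⟩
  · intro u v hr
    obtain ⟨t, σ', p, hEx, hout, hp, ht⟩ := (hquery u v).2 (hHr u v hr)
    have h := Ex.reports hw hdat (hlt u) (hlt v) (by decide) hEx (by
      rw [hout]
      intro x hx
      obtain ⟨y, -, rfl⟩ := List.mem_map.mp hx
      exact hlt y)
    rw [hout] at h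
    refine ⟨t, p.mapLe hHG, by simpa using h, ?_, ?_⟩
    · rw [SimpleGraph.Walk.length_map]
      refine hp.trans (Nat.mul_le_mul_left _ ?_)
      rw [SimpleGraph.dist_comm]
      exact (hH _ _ _ (near_dist hr)).dist_le
    · rw [SimpleGraph.Walk.length_map]
      have := card_ballF_le (H := H) v (Rad v)
      have := hRadD v
      omega

/-! ### Choice of parameters -/

/-- The bound `β` for the additive stretch and for the factor `β` of the space. The spanner has
`L = size (2 * k)` levels, and `Y = (16 * (L + 1)) ^ L` is its additive error. The additive stretch
is only `O(κ * Y)`; the factor `L * Y * k ^ 2` is needed for the space, where `k ^ 2` comes from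
bounding `(log n) ^ 2` by a power of `n`. -/
noncomputable def slack (κ k : ℕ) : ℝ :=
  1104 * κ * (2 * k).size * ((16 * ((2 * k).size + 1) : ℝ) ^ (2 * k).size) ^ 2 * (k : ℝ) ^ 2

/-- The number `⌊n ^ (1 / a)⌋ + 1`, which is the base for ball growing and for the spanner. -/
theorem exists_base {n a : ℕ} (hn : 1 ≤ n) (ha : 1 ≤ a) :
    ∃ b : ℕ, 2 ≤ b ∧ n < b ^ a ∧ b ≤ 2 * n ∧ (b : ℝ) ≤ 2 * (n : ℝ) ^ (1 / (a : ℝ)) := by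
  have hn' : (1 : ℝ) ≤ n := by exact_mod_cast hn
  have ha' : (1 : ℝ) ≤ a := by exact_mod_cast ha
  have hx1 : (1 : ℝ) ≤ (n : ℝ) ^ (1 / (a : ℝ)) := Real.one_le_rpow hn' (by positivity)
  have hxn : (n : ℝ) ^ (1 / (a : ℝ)) ≤ n := by
    conv_rhs => rw [← Real.rpow_one (n : ℝ)]
    exact Real.rpow_le_rpow_of_exponent_le hn' (by rw [div_le_one (by linarith)]; exact ha')
  have hfl : (⌊(n : ℝ) ^ (1 / (a : ℝ))⌋₊ : ℝ) ≤ (n : ℝ) ^ (1 / (a : ℝ)) :=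
    Nat.floor_le (by linarith)
  have hfl1 : 1 ≤ ⌊(n : ℝ) ^ (1 / (a : ℝ))⌋₊ := Nat.le_floor (by simpa using hx1)
  refine ⟨⌊(n : ℝ) ^ (1 / (a : ℝ))⌋₊ + 1, by omega, ?_, ?_, ?_⟩
  · have h1 : (n : ℝ) ^ (1 / (a : ℝ)) < ⌊(n : ℝ) ^ (1 / (a : ℝ))⌋₊ + 1 := Nat.lt_floor_add_one _
    have h2 : ((n : ℝ) ^ (1 / (a : ℝ))) ^ a = n := by
      rw [one_div, Real.rpow_inv_natCast_pow (by linarith) (by omega)]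
    have h3 := pow_lt_pow_left₀ h1 (by linarith) (n := a) (by omega)
    rw [h2] at h3
    exact_mod_cast h3
  · have : (⌊(n : ℝ) ^ (1 / (a : ℝ))⌋₊ : ℝ) ≤ n := hfl.trans hxn
    have : ⌊(n : ℝ) ^ (1 / (a : ℝ))⌋₊ ≤ n := by exact_mod_cast this
    omega
  · push_cast
    linarith

/-- The two logarithmic factors of the space, one from the slots and one from the scales, are
absorbed by the part of `n ^ (1 / k)` that the spanner does not use. -/
theorem size_sq_le {n k : ℕ} (hn : 1 ≤ n) (hk : 1 ≤ k) :
    (n.size : ℝ) ^ 2 ≤ 81 * (k : ℝ) ^ 2 * (n : ℝ) ^ (1 / (2 * (k : ℝ))) := by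
  have hn' : (1 : ℝ) ≤ n := by exact_mod_cast hn
  have hk' : (1 : ℝ) ≤ k := by exact_mod_cast hk
  set y : ℝ := (n : ℝ) ^ (1 / (4 * (k : ℝ))) with hy
  have hy1 : 1 ≤ y := Real.one_le_rpow hn' (by positivity)
  have h1 : Real.log n ≤ 4 * k * y := by
    have := Real.log_le_rpow_div (x := (n : ℝ)) (ε := 1 / (4 * (k : ℝ))) (by linarith)
      (by positivity)
    rwa [div_div_eq_mul_div, div_one, mul_comm] at this
  have h2 : ((n.size : ℝ) - 1) * Real.log 2 ≤ Real.log n := by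
    have h3 : 2 ^ (n.size - 1) ≤ n := Nat.lt_size.mp (by
      have := Nat.size_pos.mpr hn
      omega)
    have h4 : (2 : ℝ) ^ (n.size - 1) ≤ n := by exact_mod_cast h3
    have h5 := Real.log_le_log (by positivity) h4
    rw [Real.log_pow, Nat.cast_sub (Nat.size_pos.mpr hn)] at h5
    simpa using h5
  have h3 : (n.size : ℝ) ≤ 9 * k * y := by
    have := Real.log_two_gt_d9
    have hs : (1 : ℝ) ≤ n.size := by exact_mod_cast Nat.size_pos.mpr hn
    have hky : 1 ≤ k * y := by nlinarith
    nlinarith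
  have h4 : y ^ 2 = (n : ℝ) ^ (1 / (2 * (k : ℝ))) := by
    rw [hy, ← Real.rpow_natCast, ← Real.rpow_mul (by linarith)]
    congr 1
    push_cast
    field_simp
    norm_num
  calc (n.size : ℝ) ^ 2 ≤ (9 * k * y) ^ 2 := by gcongr
    _ = 81 * (k : ℝ) ^ 2 * y ^ 2 := by ring
    _ = _ := by rw [h4]

/-- The oracle with `κ` levels of ball growing for the parameter `k`. -/
theorem hasOracle {n k κ : ℕ} (hn : 1 ≤ n) (hk : 1 ≤ k) (hκ : 1 ≤ κ) (G : SimpleGraph (Fin n))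
    {α C q : ℝ} (c : ℝ) (hα : 1104 * κ ≤ α) (hC : 125550 ≤ C)
    (hq : (n : ℝ) ^ (2 / (κ : ℝ)) ≤ q) :
    HasOracle (queryCmd.compile 0) (11 * n.size) G α (slack κ k) C q
      (C * (slack κ k * (n : ℝ) ^ (1 + 1 / (k : ℝ)))) c := by
  have hn' : (1 : ℝ) ≤ n := by exact_mod_cast hn
  have hk' : (1 : ℝ) ≤ k := by exact_mod_cast hk
  have hκ' : (1 : ℝ) ≤ κ := by exact_mod_cast hκ
  obtain ⟨B, hB2, hBκ, hBn, hBr⟩ := exists_base hn hκ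
  obtain ⟨b, hb2, hbk, -, hbr⟩ := exists_base hn (a := 2 * k) (by omega)
  set L := (2 * k).size with hL
  have hL1 : 1 ≤ L := Nat.size_pos.mpr (by omega)
  have hLk : 2 * k < 2 ^ L := Nat.lt_size_self _
  set Y := (16 * (L + 1)) ^ L with hY
  have hY1 : 1 ≤ Y := Nat.pos_of_ne_zero (pow_ne_zero _ (by omega))
  have hslack : slack κ k = 1104 * κ * L * (Y : ℝ) ^ 2 * (k : ℝ) ^ 2 := by
    rw [slack, hY, ← hL]
    push_cast
    ring
  have hY1' : (1 : ℝ) ≤ Y := by exact_mod_cast hY1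
  have hL1' : (1 : ℝ) ≤ L := by exact_mod_cast hL1
  -- More than `n` levels of ball growing are never needed; the cap `n` bounds the addresses by a
  -- polynomial in `n` which does not depend on `κ`.
  have hBκ' : n ≤ B ^ min κ n := by
    rcases le_total κ n with h | h
    · rw [min_eq_left h]
      exact hBκ.le
    · rw [min_eq_right h]
      exact Nat.lt_two_pow_self.le.trans (Nat.pow_le_pow_left hB2 n)
  obtain ⟨O, hspace, h0, h1⟩ := exists_oracle hn G (b := b) (by omega) hL1 (le_refl (16 * (L + 1)))
    (hbk.trans_le (Nat.pow_le_pow_right (by omega) (by omega))) (by omega) hBn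
    (le_min hκ hn) (min_le_right _ _) hBκ'
  have hq1 : 1 ≤ q := (Real.one_le_rpow hn' (by positivity)).trans hq
  have hBq : ((B * B : ℕ) : ℝ) ≤ 4 * q := by
    have h2 : (n : ℝ) ^ (1 / (κ : ℝ)) * (n : ℝ) ^ (1 / (κ : ℝ)) = (n : ℝ) ^ (2 / (κ : ℝ)) := by
      rw [← Real.rpow_add (by linarith)]
      congr 1
      ring
    push_cast
    calc (B : ℝ) * B ≤ (2 * (n : ℝ) ^ (1 / (κ : ℝ))) * (2 * (n : ℝ) ^ (1 / (κ : ℝ))) := by gcongr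
      _ = 4 * ((n : ℝ) ^ (1 / (κ : ℝ)) * (n : ℝ) ^ (1 / (κ : ℝ))) := by ring
      _ ≤ 4 * q := by rw [h2]; linarith
  have hmin : ((min κ n : ℕ) : ℝ) ≤ κ := by exact_mod_cast min_le_left _ _
  refine hasOracle_of_reports O c ?_ ?_ ?_
  · intro u v hr
    obtain ⟨T, hT, ht⟩ := h0 u v hr
    refine ⟨T, hT, ?_⟩
    have : (T : ℝ) ≤ 20 := by exact_mod_cast ht
    nlinarith
  · intro u v hr
    obtain ⟨T, p, hT, hp, ht⟩ := h1 u v hr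
    refine ⟨T, p, hT, ?_, ?_⟩
    · have hp' : (p.length : ℝ) ≤ 368 * (min κ n : ℕ) * (3 * G.dist u v + 3 * Y) := by
        exact_mod_cast hp
      have hd : (0 : ℝ) ≤ G.dist u v := Nat.cast_nonneg _
      calc (p.length : ℝ) ≤ 368 * (min κ n : ℕ) * (3 * G.dist u v + 3 * Y) := hp'
        _ ≤ 368 * κ * (3 * G.dist u v + 3 * Y) := by gcongr
        _ = 1104 * κ * G.dist u v + 1104 * κ * 1 * (Y : ℝ) ^ 1 * 1 ^ 2 := by ring
        _ ≤ α * G.dist u v + 1104 * κ * L * (Y : ℝ) ^ 2 * (k : ℝ) ^ 2 := by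
          gcongr
          norm_num
        _ = _ := by rw [hslack]
    · have ht' : (T : ℝ) ≤ 33 * (B * B : ℕ) + 48 * p.length + 220 := by exact_mod_cast ht
      have hp0 : (0 : ℝ) ≤ p.length := Nat.cast_nonneg _
      nlinarith
  · have hs' : (O.space : ℝ) ≤ 775 * (min κ n : ℕ) * (L * (Y : ℝ) ^ 2 * b * n * n.size ^ 2) := by
      exact_mod_cast hspace
    have hrp : (n : ℝ) ^ (1 + 1 / (k : ℝ)) =
        (n : ℝ) ^ (1 / ((2 * k : ℕ) : ℝ)) * n * (n : ℝ) ^ (1 / (2 * (k : ℝ))) := by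
      have hn0 : (0 : ℝ) < n := by linarith
      have hsum : 1 + 1 / (k : ℝ) = 1 / ((2 * k : ℕ) : ℝ) + 1 + 1 / (2 * (k : ℝ)) := by
        push_cast
        field_simp
        ring
      rw [hsum, Real.rpow_add hn0, Real.rpow_add hn0, Real.rpow_one]
    calc (O.space : ℝ) ≤ 775 * (min κ n : ℕ) * (L * (Y : ℝ) ^ 2 * b * n * n.size ^ 2) := hs'
      _ ≤ 775 * κ * (L * (Y : ℝ) ^ 2 * (2 * (n : ℝ) ^ (1 / ((2 * k : ℕ) : ℝ))) * n *
          (81 * (k : ℝ) ^ 2 * (n : ℝ) ^ (1 / (2 * (k : ℝ))))) := by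
        gcongr
        exact size_sq_le hn hk
      _ = 125550 * (κ * L * (Y : ℝ) ^ 2 * (k : ℝ) ^ 2 * (n : ℝ) ^ (1 + 1 / (k : ℝ))) := by
        rw [hrp]; ring
      _ ≤ C * (1104 * κ * L * (Y : ℝ) ^ 2 * (k : ℝ) ^ 2 * (n : ℝ) ^ (1 + 1 / (k : ℝ))) := by
        gcongr
        nlinarith
      _ = _ := by rw [hslack]

theorem slack_mono {κ κ' k : ℕ} (h : κ ≤ κ') : slack κ k ≤ slack κ' k := by
  unfold slack
  gcongr

/-- With `l = log k`, the main term is at most `(l ^ 2) ^ (4 * l) = k ^ (8 * log l)`. -/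
theorem eventually_slack_le :
    ∀ᶠ k : ℕ in Filter.atTop, slack k k ≤ (k : ℝ) ^ (14 * Real.log (Real.log (k : ℝ))) := by
  have hlog : Filter.Tendsto (fun k : ℕ => Real.log (k : ℝ)) Filter.atTop Filter.atTop :=
    Real.tendsto_log_atTop.comp tendsto_natCast_atTop_atTop
  filter_upwards [hlog.eventually_ge_atTop 48, Filter.eventually_ge_atTop 1104] with k hl hk
  set l := Real.log (k : ℝ) with hldef
  have hk' : (1104 : ℝ) ≤ k := by exact_mod_cast hk
  have hsize : ((2 * k).size : ℝ) ≤ 2 * l := by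
    have h3 : 2 ^ ((2 * k).size - 1) ≤ 2 * k := Nat.lt_size.mp (by
      have := Nat.size_pos.mpr (show 0 < 2 * k by omega)
      omega)
    have h4 : (2 : ℝ) ^ ((2 * k).size - 1) ≤ 2 * k := by exact_mod_cast h3
    have h5 := Real.log_le_log (by positivity) h4
    rw [Real.log_pow, Nat.cast_sub (Nat.size_pos.mpr (by omega)),
      Real.log_mul (by norm_num) (by linarith)] at h5
    have := Real.log_two_gt_d9
    push_cast at h5
    nlinarith
  have hlk : l ≤ k := (Real.log_le_sub_one_of_pos (by linarith)).trans (by linarith)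
  have hll : 1 ≤ Real.log l := by
    rw [Real.le_log_iff_exp_le (by linarith)]
    have := Real.exp_one_lt_d9
    linarith
  have hsk : ((2 * k).size : ℝ) ≤ k ^ 2 := by nlinarith
  have hY : (((16 * ((2 * k).size + 1) : ℝ)) ^ (2 * k).size) ^ 2 ≤ (k : ℝ) ^ (8 * Real.log l) := by
    calc (((16 * ((2 * k).size + 1) : ℝ)) ^ (2 * k).size) ^ 2
        ≤ ((l ^ 2) ^ (2 * k).size) ^ 2 := by
          gcongr
          nlinarith
      _ = l ^ (4 * (2 * k).size) := by
          rw [← pow_mul, ← pow_mul]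
          congr 1
          ring
      _ = l ^ (4 * ((2 * k).size : ℝ)) := by
          rw [← Real.rpow_natCast]
          push_cast
          rfl
      _ ≤ l ^ (8 * l) := Real.rpow_le_rpow_of_exponent_le (by linarith) (by linarith)
      _ = (k : ℝ) ^ (8 * Real.log l) := by
          rw [Real.rpow_def_of_pos (by linarith), Real.rpow_def_of_pos (by linarith), ← hldef]
          congr 1
          ring
  have hk6 : (k : ℝ) ^ 6 ≤ (k : ℝ) ^ (6 * Real.log l) := by
    rw [← Real.rpow_natCast]
    refine Real.rpow_le_rpow_of_exponent_le (by linarith) ?_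
    push_cast
    linarith
  calc slack k k ≤ k * k * k ^ 2 * (k : ℝ) ^ (8 * Real.log l) * k ^ 2 := by
        unfold slack
        gcongr
    _ = k ^ 6 * (k : ℝ) ^ (8 * Real.log l) := by ring
    _ ≤ (k : ℝ) ^ (6 * Real.log l) * (k : ℝ) ^ (8 * Real.log l) := by gcongr
    _ = (k : ℝ) ^ (14 * Real.log l) := by
        rw [← Real.rpow_add (by linarith)]
        congr 1
        ring

theorem six_le_logb : 6 ≤ Real.logb (4 / 3) 7 := by
  rw [Real.le_logb_iff_rpow_le (by norm_num) (by norm_num)]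
  norm_num

end PathOracle

theorem theorem6 :
    ∃ A : ℝ,
      (∀ ε : ℝ, 0 < ε → ∀ c : ℝ,
        ∃ (P : PathOracle.Program) (b : ℕ) (C : ℝ) (β : ℕ → ℝ),
          (∀ᶠ k : ℕ in Filter.atTop, β k ≤ (k : ℝ) ^ (A * Real.log (Real.log (k : ℝ)))) ∧
          ∀ k : ℕ, 1 ≤ k → ∀ n : ℕ, 1 ≤ n → ∀ G : SimpleGraph (Fin n),
            PathOracle.HasOracle P (b * n.size) G C (β k) C ((n : ℝ) ^ ε)
              (C * (β k * (n : ℝ) ^ (1 + 1 / (k : ℝ)))) c) ∧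
      (∀ η : ℝ, 0 < η → ∀ c : ℝ,
        ∃ (P : PathOracle.Program) (b : ℕ) (C : ℝ) (α β : ℕ → ℝ),
          (α =o[Filter.atTop] fun k : ℕ => (k : ℝ)) ∧
          (∀ᶠ k : ℕ in Filter.atTop, β k ≤ (k : ℝ) ^ (A * Real.log (Real.log (k : ℝ)))) ∧
          ∀ k : ℕ, 1 ≤ k → ∀ n : ℕ, 1 ≤ n → ∀ G : SimpleGraph (Fin n),
            PathOracle.HasOracle P (b * n.size) G (α k) (β k) C
              ((n : ℝ) ^ (C * (k : ℝ) ^ (-(1 / (Real.logb (4 / 3) 7 + η)))))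
              (C * (β k * (n : ℝ) ^ (1 + 1 / (k : ℝ)))) c) := by
  refine ⟨14, ?_, ?_⟩
  · intro ε hε c
    have hκ0 : 0 < ⌈2 / ε⌉₊ := Nat.ceil_pos.mpr (by positivity)
    set κ := ⌈2 / ε⌉₊ with hκ
    have hκ' : (0 : ℝ) < κ := by exact_mod_cast hκ0
    refine ⟨PathOracle.queryCmd.compile 0, 11, 125550 + 1104 * κ, PathOracle.slack κ, ?_, ?_⟩
    · filter_upwards [PathOracle.eventually_slack_le, Filter.eventually_ge_atTop κ] with k h1 h2
      exact (PathOracle.slack_mono h2).trans h1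
    · intro k hk n hn G
      refine PathOracle.hasOracle hn hk hκ0 G c (by linarith) (by linarith) ?_
      refine Real.rpow_le_rpow_of_exponent_le (by exact_mod_cast hn) ?_
      rw [div_le_iff₀ hκ', mul_comm, ← div_le_iff₀ hε]
      exact Nat.le_ceil _
  · intro η hη c
    refine ⟨PathOracle.queryCmd.compile 0, 11, 125550, fun k => 1104 * ⌈(k : ℝ) ^ (1 / 6 : ℝ)⌉₊,
      fun k => PathOracle.slack ⌈(k : ℝ) ^ (1 / 6 : ℝ)⌉₊ k, ?_, ?_, ?_⟩
    · refine Asymptotics.IsBigO.trans_isLittleO (g := fun k : ℕ => (k : ℝ) ^ (1 / 6 : ℝ)) ?_ ?_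
      · refine Asymptotics.IsBigO.of_bound 2208 ?_
        filter_upwards [Filter.eventually_ge_atTop 1] with k hk
        have h1 : (1 : ℝ) ≤ (k : ℝ) ^ (1 / 6 : ℝ) :=
          Real.one_le_rpow (by exact_mod_cast hk) (by norm_num)
        have h2 := Nat.ceil_lt_add_one (show 0 ≤ (k : ℝ) ^ (1 / 6 : ℝ) by linarith)
        rw [Real.norm_of_nonneg (by positivity), Real.norm_of_nonneg (by positivity)]
        linarith
      · refine Asymptotics.isLittleO_of_tendsto' ?_ ?_
        · filter_upwards [Filter.eventually_ge_atTop 1] with k hk h0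
          have : (1 : ℝ) ≤ k := by exact_mod_cast hk
          linarith
        · refine ((tendsto_rpow_neg_atTop (y := 5 / 6) (by norm_num)).comp
            tendsto_natCast_atTop_atTop).congr' ?_
          filter_upwards [Filter.eventually_ge_atTop 1] with k hk
          have hk0 : (0 : ℝ) < k := by exact_mod_cast hk
          rw [Function.comp_apply, ← Real.rpow_sub_one hk0.ne']
          norm_num
    · filter_upwards [PathOracle.eventually_slack_le, Filter.eventually_ge_atTop 1] with k h1 h2
      refine (PathOracle.slack_mono (Nat.ceil_le.mpr ?_)).trans h1
      conv_rhs => rw [← Real.rpow_one (k : ℝ)]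
      exact Real.rpow_le_rpow_of_exponent_le (by exact_mod_cast h2) (by norm_num)
    · intro k hk n hn G
      -- The choice `κ ≥ k ^ (1 / 6)` is large enough because `1 / (log_{4/3} 7 + η) < 1 / 6`.
      have hk' : (1 : ℝ) ≤ k := by exact_mod_cast hk
      have h6 := PathOracle.six_le_logb
      have hpos : 0 < (k : ℝ) ^ (1 / 6 : ℝ) := by positivity
      refine PathOracle.hasOracle hn hk (Nat.ceil_pos.mpr hpos) G c le_rfl le_rfl ?_
      refine Real.rpow_le_rpow_of_exponent_le (by exact_mod_cast hn) ?_
      have h1 : (k : ℝ) ^ (-(1 / 6) : ℝ) ≤ (k : ℝ) ^ (-(1 / (Real.logb (4 / 3) 7 + η))) := by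
        refine Real.rpow_le_rpow_of_exponent_le hk' (neg_le_neg ?_)
        exact one_div_le_one_div_of_le (by norm_num) (by linarith)
      calc 2 / (⌈(k : ℝ) ^ (1 / 6 : ℝ)⌉₊ : ℝ) ≤ 2 / (k : ℝ) ^ (1 / 6 : ℝ) := by
            gcongr
            exact Nat.le_ceil _
        _ = 2 * (k : ℝ) ^ (-(1 / 6) : ℝ) := by rw [Real.rpow_neg (by linarith), div_eq_mul_inv]
        _ ≤ 125550 * (k : ℝ) ^ (-(1 / (Real.logb (4 / 3) 7 + η))) := by
            gcongr
            norm_num
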